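/- Let $\mathbf{k}$ be a field and let $\mathbb{V}$ be a complex line, i.e. a one-dimensional complex vector space, with a norm $|\cdot|$. For a topological space $X$, let $D^{\mathrm b}(\mathbf{k}_X)$ be the bounded derived category of sheaves of $\mathbf{k}$-vector spaces on $X$. For $F\in D^{\mathrm b}(\mathbf{k}_{\mathbb V})$ set $$\mathrm{smash}(F)=i^{-1}\,\mathrm{R}j_*\,\gamma^{-1}F,$$ where $j\colon\mathbb{V}\times\mathbb{R}_{<0}\to\mathbb{V}\times\mathbb{R}$ is the open embedding, $i\colon\mathbb{V}\to\mathbb{V}\times\mathbb{R}$ is given by $i(x)=(x,0)$, and $\gamma\colon\mathbb{V}\times\mathbb{R}_{<0}\to\mathbb{V}$ is given by $\gamma(x,s)=x/|s|$. For $R>0$, let $c^R\colon\mathbb{V}\to\mathbb{V}$ be the continuous map given by $c^R(x)=0$ if $|x|\le R$ and $c^R(x)=\frac{|x|-R}{|x|}\,x$ if $|x|\ge R$. Let $R>0$ and let $F\in D^{\mathrm b}(\mathbf{k}_{\mathbb V})$ be locally constant on $\{|x|\ge R\}$, i.e. all the cohomology sheaves of the restriction of $F$ to the closed subspace $\{x\in\mathbb{V}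 : |x|\ge R\}$ are locally constant. Then $$\mathrm{smash}(F)\;\simeq\;\mathrm{R}c^R_*F\;\simeq\;\mathrm{R}c^R_!F,$$ where $\mathrm{R}c^R_*$ and $\mathrm{R}c^R_!$ are the derived functors of direct image and of direct image with proper supports. -/

import Mathlib

universe u

open CategoryTheory CategoryTheory.Limits TopologicalSpace Opposite Topology

noncomputable section

namespace Smash

section Sheaves

variable (k : Type u) [Field k]

/-- The category of sheaves of `k`-vector spaces on `X`. -/
abbrev Sh (X : TopCat.{u}) := TopCat.Sheaf (ModuleCat.{u} k) X

instance (X : TopCat.{u}) : HasDerivedCategory.{u + 1} (Sh k X) :=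
  HasDerivedCategory.standard (Sh k X)

/-- The bounded derived category `Dᵇ(k_X)`. -/
abbrev Db (X : TopCat.{u}) := DerivedCategory.Bounded (Sh k X)

/-- The bounded below derived category `D⁺(k_X)`, which contains `Dᵇ(k_X)` as a full
subcategory. -/
abbrev Dplus (X : TopCat.{u}) := DerivedCategory.Plus (Sh k X)

/-- The inclusion of `Dᵇ(k_X)` in `D⁺(k_X)`. -/
def dbToPlus (X : TopCat.{u}) : Db k X ⥤ Dplus k X :=
  ObjectProperty.ιOfLE inf_le_left

variable {k}
variable {X Y : TopCat.{u}}

instance (f : X ⟶ Y) : PreservesFiniteLimits (TopCat.Sheaf.pullback (ModuleCat.{u} k) f) := by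
  apply Functor.SmallCategories.instPreservesFiniteLimitsSheafSheafPullbackOfRepresentablyFlat

instance (f : X ⟶ Y) : (TopCat.Sheaf.pullback (ModuleCat.{u} k) f).Additive :=
  Functor.additive_of_preserves_binary_products _

instance (f : X ⟶ Y) : (TopCat.Sheaf.pushforward (ModuleCat.{u} k) f).Additive :=
  Functor.additive_of_preserves_binary_products _

/-- The functor `f⁻¹ : D⁺(k_Y) ⥤ D⁺(k_X)` induced by the exact functor `f⁻¹` on sheaves. -/
def inverseImage (f : X ⟶ Y) : Dplus k Y ⥤ Dplus k X :=
  ObjectProperty.lift _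
    (DerivedCategory.Plus.ι ⋙ (TopCat.Sheaf.pullback (ModuleCat.{u} k) f).mapDerivedCategory) (by
      rintro ⟨F, n, K, e, hK⟩
      exact ⟨n, ⟨_, (Functor.mapDerivedCategory _).mapIso e ≪≫
        (Functor.mapDerivedCategoryFactors _).app K, inferInstance⟩⟩)

/-- The derived direct image `Rf_* : D⁺(k_X) ⥤ D⁺(k_Y)`. -/
def derivedDirectImage (f : X ⟶ Y) : Dplus k X ⥤ Dplus k Y :=
  (TopCat.Sheaf.pushforward (ModuleCat.{u} k) f).rightDerivedFunctorPlus

/-- The support of a section `s` of `F` over the open set `U`: the points of `U` which have no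
open neighborhood in `U` on which `s` vanishes. -/
def sectionSupport (F : X.Presheaf (ModuleCat.{u} k)) {U : Opens X} (s : F.obj (op U)) : Set X :=
  {x | x ∈ U ∧ ∀ (W : Opens X) (h : W ≤ U), x ∈ W → F.map (homOfLE h).op s ≠ 0}

/-- For `S ⊆ f ⁻¹(U)`, the map `S → U` induced by `f` is proper. -/
def ProperOver (f : X ⟶ Y) (U : Opens Y) (S : Set X) : Prop :=
  ∃ h : ∀ x ∈ S, f x ∈ U, IsProperMap fun x : S => (⟨f x, h x x.2⟩ : U)

theorem properOver_iff (f : X ⟶ Y) (U : Opens Y) (S : Set X) :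
    ProperOver f U S ↔ (∀ x ∈ S, f x ∈ U) ∧ ∀ (l : Ultrafilter X) (y : Y), S ∈ l → y ∈ U →
      Filter.Tendsto f l (𝓝 y) → ∃ x ∈ S, f x = y ∧ (l : Filter X) ≤ 𝓝 x := by
  constructor
  · rintro ⟨h, hp⟩
    refine ⟨h, fun l y hS hy hl => ?_⟩
    have hr : Set.range (Subtype.val : S → X) ∈ l := by simpa using hS
    let m : Ultrafilter S := l.comap Subtype.val_injective hr
    have hm : Filter.map Subtype.val (m : Filter S) = l := by
      rw [Ultrafilter.coe_comap, Filter.map_comap_of_mem hr]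
    have ht : Filter.Tendsto (fun x : S => (⟨f x, h x x.2⟩ : U)) m (𝓝 ⟨y, hy⟩) := by
      rw [tendsto_subtype_rng]
      exact hl.comp (by rw [Filter.Tendsto, hm])
    obtain ⟨x, hx, hle⟩ := hp.ultrafilter_le_nhds_of_tendsto ht
    refine ⟨x, x.2, congrArg Subtype.val hx, ?_⟩
    rw [← hm]
    exact (Filter.map_mono hle).trans continuous_subtype_val.continuousAt
  · rintro ⟨h, hp⟩
    refine ⟨h, isProperMap_iff_ultrafilter.2 ⟨by fun_prop, fun m y hm => ?_⟩⟩
    obtain ⟨x, hx, hxy, hle⟩ := hp (m.map Subtype.val) y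
      (by simp only [Ultrafilter.mem_map]; exact Filter.univ_mem' fun x => x.2) y.2
      (by
        rw [Ultrafilter.coe_map, Filter.tendsto_map'_iff]
        exact (continuous_subtype_val.tendsto y).comp hm)
    refine ⟨⟨x, hx⟩, Subtype.ext hxy, ?_⟩
    rw [nhds_subtype, ← Filter.map_le_iff_le_comap]
    exact hle

theorem ProperOver.restrict {f : X ⟶ Y} {U V : Opens Y} {S T : Set X} (h : ProperOver f U S)
    (hVU : V ≤ U) (hT : ∀ x, x ∈ T ↔ x ∈ S ∧ f x ∈ V) : ProperOver f V T := by
  rw [properOver_iff] at h ⊢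
  refine ⟨fun x hx => ((hT x).1 hx).2, fun l y hl hy ht => ?_⟩
  obtain ⟨x, hx, rfl, hle⟩ := h.2 l y (Filter.mem_of_superset hl fun x hx => ((hT x).1 hx).1)
    (hVU hy) ht
  exact ⟨x, (hT x).2 ⟨hx, hy⟩, rfl, hle⟩

theorem properOver_of_local {f : X ⟶ Y} {U : Opens Y} {S : Set X} (hS : ∀ x ∈ S, f x ∈ U)
    (h : ∀ y ∈ U, ∃ V : Opens Y, y ∈ V ∧ ProperOver f V (S ∩ f ⁻¹' V)) : ProperOver f U S := by
  rw [properOver_iff]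
  refine ⟨hS, fun l y hl hy ht => ?_⟩
  obtain ⟨V, hyV, hV⟩ := h y hy
  rw [properOver_iff] at hV
  obtain ⟨x, hx, hxy, hle⟩ := hV.2 l y
    (Filter.inter_mem hl (ht (V.isOpen.mem_nhds hyV))) hyV ht
  exact ⟨x, hx.1, hxy, hle⟩

theorem ProperOver.of_subset_union {f : X ⟶ Y} {U : Opens Y} {S T T' : Set X}
    (h : ProperOver f U T) (h' : ProperOver f U T') (hS : S ⊆ T ∪ T')
    (hcl : ∀ x, f x ∈ U → x ∈ closure S → x ∈ S) : ProperOver f U S := by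
  rw [properOver_iff] at h h' ⊢
  refine ⟨fun x hx => (hS hx).elim (h.1 x) (h'.1 x), fun l y hl hy ht => ?_⟩
  have key : ∃ x, f x = y ∧ (l : Filter X) ≤ 𝓝 x := by
    rcases Ultrafilter.union_mem_iff.1 (Filter.mem_of_superset hl hS) with hm | hm
    · obtain ⟨x, -, hx⟩ := h.2 l y hm hy ht
      exact ⟨x, hx⟩
    · obtain ⟨x, -, hx⟩ := h'.2 l y hm hy ht
      exact ⟨x, hx⟩
  obtain ⟨x, hx, hle⟩ := key
  exact ⟨x, hcl x (hx ▸ hy) (mem_closure_iff_ultrafilter.2 ⟨l, hl, hle⟩), hx, hle⟩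

theorem properOver_empty (f : X ⟶ Y) (U : Opens Y) : ProperOver f U ∅ := by
  rw [properOver_iff]
  exact ⟨by simp, fun l y hl => (l.empty_notMem hl).elim⟩

section Support

variable (F : X.Presheaf (ModuleCat.{u} k)) {U V : Opens X}

theorem map_map_apply {W : Opens X} (h : V ≤ U) (h' : W ≤ V) (s : F.obj (op U)) :
    F.map (homOfLE h').op (F.map (homOfLE h).op s) = F.map (homOfLE (h'.trans h)).op s := by
  rw [← ModuleCat.comp_apply, ← F.map_comp]
  rfl

theorem map_eq_zero_of_le {W : Opens X} (h : V ≤ U) (h' : W ≤ V) (s : F.obj (op U))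
    (hs : F.map (homOfLE h).op s = 0) : F.map (homOfLE (h'.trans h)).op s = 0 := by
  rw [← map_map_apply F h h', hs, map_zero]

theorem notMem_sectionSupport {s : F.obj (op U)} {x : X} (hx : x ∈ U) :
    x ∉ sectionSupport F s ↔
      ∃ (W : Opens X) (h : W ≤ U), x ∈ W ∧ F.map (homOfLE h).op s = 0 := by
  simp only [sectionSupport, Set.mem_ofPred_eq, not_and, not_forall, not_not]
  exact ⟨fun h => by obtain ⟨W, a, b, c⟩ := h hx; exact ⟨W, a, b, c⟩,
    fun ⟨W, a, b, c⟩ _ => ⟨W, a, b, c⟩⟩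

theorem sectionSupport_closed {s : F.obj (op U)} {x : X} (hx : x ∈ U)
    (hc : x ∈ closure (sectionSupport F s)) : x ∈ sectionSupport F s := by
  by_contra hn
  obtain ⟨W, hW, hxW, hs⟩ := (notMem_sectionSupport F hx).1 hn
  obtain ⟨y, hyW, hy⟩ := mem_closure_iff.1 hc W W.isOpen hxW
  exact hy.2 W hW hyW hs

theorem mem_sectionSupport_map (h : V ≤ U) (s : F.obj (op U)) (x : X) :
    x ∈ sectionSupport F (F.map (homOfLE h).op s) ↔ x ∈ sectionSupport F s ∧ x ∈ V := by
  constructor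
  · rintro ⟨hx, hs⟩
    refine ⟨⟨h hx, fun W hW hxW h0 => hs (W ⊓ V) inf_le_right ⟨hxW, hx⟩ ?_⟩, hx⟩
    rw [map_map_apply]
    exact map_eq_zero_of_le F hW inf_le_left s h0
  · rintro ⟨⟨-, hs⟩, hx⟩
    refine ⟨hx, fun W hW hxW h0 => hs W (hW.trans h) hxW ?_⟩
    rwa [map_map_apply] at h0

theorem sectionSupport_zero : sectionSupport F (0 : F.obj (op U)) = ∅ :=
  Set.eq_empty_of_forall_notMem fun _ hx => hx.2 U le_rfl hx.1 (map_zero _)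

theorem sectionSupport_add (s t : F.obj (op U)) :
    sectionSupport F (s + t) ⊆ sectionSupport F s ∪ sectionSupport F t := by
  intro x hx
  by_contra hn
  simp only [Set.mem_union, not_or, notMem_sectionSupport F hx.1] at hn
  obtain ⟨⟨W, hW, hxW, hs⟩, ⟨W', hW', hxW', ht⟩⟩ := hn
  refine hx.2 (W ⊓ W') (inf_le_left.trans hW) ⟨hxW, hxW'⟩ ?_
  rw [map_add, map_eq_zero_of_le F hW inf_le_left s hs,
    map_eq_zero_of_le F hW' inf_le_right t ht, add_zero]

theorem sectionSupport_smul (c : k) (s : F.obj (op U)) :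
    sectionSupport F (c • s) ⊆ sectionSupport F s := by
  refine fun x hx => ⟨hx.1, fun W hW hxW h0 => hx.2 W hW hxW ?_⟩
  rw [map_smul, h0, smul_zero]

theorem sectionSupport_app {F G : X.Presheaf (ModuleCat.{u} k)} (φ : F ⟶ G) (s : F.obj (op U)) :
    sectionSupport G (φ.app (op U) s) ⊆ sectionSupport F s := by
  refine fun x hx => ⟨hx.1, fun W hW hxW h0 => hx.2 W hW hxW ?_⟩
  rw [← ModuleCat.comp_apply, ← φ.naturality, ModuleCat.comp_apply, h0, map_zero]

end Support

/-- The subspace of the sections `s ∈ F(f⁻¹(U))` such that `f : supp(s) → U` is proper. -/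
def properSections (f : X ⟶ Y) (F : X.Presheaf (ModuleCat.{u} k)) (U : Opens Y) :
    Submodule k (F.obj (op ((Opens.map f).obj U))) where
  carrier := {s | ProperOver f U (sectionSupport F s)}
  zero_mem' := by
    simpa only [Set.mem_ofPred_eq, sectionSupport_zero] using properOver_empty f U
  add_mem' {s t} hs ht := ProperOver.of_subset_union hs ht (sectionSupport_add F s t)
    fun _ hx hc => sectionSupport_closed F hx hc
  smul_mem' c s hs := ProperOver.of_subset_union hs hs
    ((sectionSupport_smul F c s).trans Set.subset_union_left)
    fun _ hx hc => sectionSupport_closed F hx hc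

theorem map_mem_properSections (f : X ⟶ Y) (F : X.Presheaf (ModuleCat.{u} k)) {U V : (Opens Y)ᵒᵖ}
    (i : U ⟶ V) (s : F.obj (op ((Opens.map f).obj U.unop))) (hs : s ∈ properSections f F U.unop) :
    F.map ((Opens.map f).map i.unop).op s ∈ properSections f F V.unop :=
  ProperOver.restrict hs i.unop.le fun x =>
    mem_sectionSupport_map F ((Opens.map f).map i.unop).le s x

theorem app_mem_properSections (f : X ⟶ Y) {F G : X.Presheaf (ModuleCat.{u} k)} (φ : F ⟶ G)
    (U : Opens Y) (s : F.obj (op ((Opens.map f).obj U))) (hs : s ∈ properSections f F U) :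
    φ.app _ s ∈ properSections f G U :=
  ProperOver.of_subset_union hs hs ((sectionSupport_app φ s).trans Set.subset_union_left)
    fun _ hx hc => sectionSupport_closed G hx hc

/-- The presheaf `U ↦ {s ∈ F(f⁻¹(U)) | f : supp(s) → U is proper}` on `Y`. -/
def properDirectImagePresheaf (f : X ⟶ Y) (F : X.Presheaf (ModuleCat.{u} k)) :
    Y.Presheaf (ModuleCat.{u} k) where
  obj U := ModuleCat.of k (properSections f F U.unop)
  map i := ModuleCat.ofHom ((F.map ((Opens.map f).map i.unop).op).hom.restrict
    (map_mem_properSections f F i))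
  map_id _ := ModuleCat.hom_ext <| LinearMap.ext fun s => Subtype.ext (congrArg (fun g => g.hom s.1) (F.map_id _))
  map_comp i j := ModuleCat.hom_ext <| LinearMap.ext fun s => Subtype.ext (congrArg (fun g => g.hom s.1)
      (F.map_comp ((Opens.map f).map i.unop).op ((Opens.map f).map j.unop).op))

theorem properDirectImagePresheaf_isSheaf (f : X ⟶ Y) (F : Sh k X) :
    (properDirectImagePresheaf f F.1).IsSheaf := by
  have hF : Presieve.IsSheaf (Opens.grothendieckTopology Y)
      (((TopCat.Sheaf.pushforward (ModuleCat.{u} k) f).obj F).1 ⋙ forget (ModuleCat.{u} k)) :=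
    (isSheaf_iff_isSheaf_of_type _ _).1 ((TopCat.Presheaf.isSheaf_iff_isSheaf_comp
      (forget (ModuleCat.{u} k)) _).1 ((TopCat.Sheaf.pushforward (ModuleCat.{u} k) f).obj F).2)
  let G : Subfunctor
      (((TopCat.Sheaf.pushforward (ModuleCat.{u} k) f).obj F).1 ⋙ forget (ModuleCat.{u} k)) :=
    { obj := fun U => {s | s ∈ properSections f F.1 U.unop}
      map := fun i s hs => map_mem_properSections f F.1 i s hs }
  rw [TopCat.Presheaf.isSheaf_iff_isSheaf_comp (forget (ModuleCat.{u} k))]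
  refine (isSheaf_iff_isSheaf_of_type _ _).2 (?_ : Presieve.IsSheaf _ G.toFunctor)
  rw [Subfunctor.isSheaf_iff _ hF]
  intro U s hs
  refine properOver_of_local (fun x hx => hx.1) fun y hy => ?_
  obtain ⟨V, i, hV, hyV⟩ := hs y hy
  refine ⟨V, hyV, ProperOver.restrict (S := sectionSupport F.1 (F.1.map
    ((Opens.map f).map i).op s)) (U := V) hV le_rfl fun x => ?_⟩
  have := mem_sectionSupport_map F.1 ((Opens.map f).map i).le s x
  exact ⟨fun h => ⟨this.2 h, h.2⟩, fun h => this.1 h.1⟩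

/-- The direct image with proper supports
`(f_! F)(U) = {s ∈ F(f⁻¹(U)) | f : supp(s) → U is proper}`. -/
def properDirectImage (f : X ⟶ Y) : Sh k X ⥤ Sh k Y where
  obj F := ⟨properDirectImagePresheaf f F.1, properDirectImagePresheaf_isSheaf f F⟩
  map φ := ⟨{
    app := fun U => ModuleCat.ofHom ((φ.1.app _).hom.restrict
      (app_mem_properSections f φ.1 U.unop))
    naturality := fun _ _ i => ModuleCat.hom_ext <| LinearMap.ext fun s => Subtype.ext (congrArg (fun g => g.hom s.1)
        (φ.1.naturality ((Opens.map f).map i.unop).op)) }⟩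
  map_id _ := rfl
  map_comp _ _ := rfl

instance (f : X ⟶ Y) : (properDirectImage (k := k) f).Additive where
  map_add := rfl

/-- The derived direct image with proper supports `Rf_! : D⁺(k_X) ⥤ D⁺(k_Y)`. -/
def derivedProperDirectImage (f : X ⟶ Y) : Dplus k X ⥤ Dplus k Y :=
  (properDirectImage (k := k) f).rightDerivedFunctorPlus

/-- A sheaf is locally constant if every point has an open neighborhood on which its restriction
is isomorphic to a constant sheaf. -/
def IsLocallyConstantSheaf (F : Sh k X) : Prop :=
  ∀ x : X, ∃ U : Opens X, x ∈ U ∧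
    Sheaf.IsConstant (Opens.grothendieckTopology U) (U.sheafRestrict.obj F)

/-- An object of `D⁺(k_X)` is locally constant if all its cohomology sheaves are. -/
def IsLocallyConstant (F : Dplus k X) : Prop :=
  ∀ n : ℤ, IsLocallyConstantSheaf ((DerivedCategory.Plus.homologyFunctor (Sh k X) n).obj F)

/-- `F` is locally constant on the subset `Z` if its restriction to the subspace `Z` is. -/
def IsLocallyConstantOn (F : Dplus k X) (Z : Set X) : Prop :=
  IsLocallyConstant
    ((inverseImage (k := k) (TopCat.ofHom ⟨((↑) : Z → X), continuous_subtype_val⟩ :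
      TopCat.of Z ⟶ X)).obj F)

end Sheaves

section Smash

variable (E : Type u) [NormedAddCommGroup E] [NormedSpace ℂ E]

/-- The map `γ : E × ℝ_{<0} → E`, `γ(x, s) = x / |s|`. -/
def gammaMap : TopCat.of (E × Set.Iio (0 : ℝ)) ⟶ TopCat.of E :=
  TopCat.ofHom ⟨fun p => |(p.2 : ℝ)|⁻¹ • p.1, by
    have h : ∀ p : E × Set.Iio (0 : ℝ), |(p.2 : ℝ)| ≠ 0 := fun p => abs_ne_zero.2 p.2.2.ne
    fun_prop (disch := exact h _)⟩

/-- The open embedding `j : E × ℝ_{<0} → E × ℝ`. -/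
def jMap : TopCat.of (E × Set.Iio (0 : ℝ)) ⟶ TopCat.of (E × ℝ) :=
  TopCat.ofHom ⟨fun p => (p.1, (p.2 : ℝ)), by fun_prop⟩

/-- The closed embedding `i : E → E × ℝ`, `i(x) = (x, 0)`. -/
def iMap : TopCat.of E ⟶ TopCat.of (E × ℝ) :=
  TopCat.ofHom ⟨fun x => (x, (0 : ℝ)), by fun_prop⟩

/-- The smash functor `smash(F) = i⁻¹ Rj_* γ⁻¹ F`. -/
def smash (k : Type u) [Field k] : Dplus k (TopCat.of E) ⥤ Dplus k (TopCat.of E) :=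
  inverseImage (gammaMap E) ⋙ derivedDirectImage (jMap E) ⋙ inverseImage (iMap E)

variable {E}

open scoped Classical in
/-- The map contracting the closed ball `‖x‖ ≤ R` to the origin. -/
def contractFun (R : ℝ) (x : E) : E :=
  if ‖x‖ ≤ R then 0 else ((‖x‖ - R) / ‖x‖) • x

theorem continuous_contractFun {R : ℝ} (hR : 0 < R) :
    Continuous (contractFun R : E → E) := by
  have h : (contractFun R : E → E) = fun x => (max (‖x‖ - R) 0 / max ‖x‖ R) • x := by
    funext x
    unfold contractFun
    split_ifs with hx
    · rw [max_eq_right (by linarith : ‖x‖ - R ≤ 0), zero_div, zero_smul]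
    · rw [max_eq_left (by linarith : 0 ≤ ‖x‖ - R), max_eq_left (by linarith : R ≤ ‖x‖)]
  rw [h]
  have h' : ∀ x : E, max ‖x‖ R ≠ 0 := fun x => (lt_max_of_lt_right hR).ne'
  fun_prop (disch := exact h' _)

variable (E) in
/-- The continuous map `c^R : E → E`, for `R > 0`. -/
def contractMap (R : ℝ) (hR : 0 < R) : TopCat.of E ⟶ TopCat.of E :=
  TopCat.ofHom ⟨contractFun R, continuous_contractFun hR⟩

end Smash

end Smash

end

/-! Put `Y = E × ℝ_{<0}`. Three maps are added to `γ`, `j`, `i`. The map `q(x, s) = c^{R|s|}(x)` for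
`s ≤ 0`, extended by `x` for `s ≥ 0` (`retractMap`), satisfies `q ∘ i = id`. The map `p : Y → E`
(`flowProj`) satisfies `c^R ∘ p = q ∘ j`. The map `σ(x) = (x, -1)` (`unitSection`) is a section of
both `γ` and `p`. The homeomorphism `flowHomeo : E × ℝ ≃ Y` turns `p` into the first projection. On
the fibre of `p` over `w`, the map `γ` is constant if `‖w‖ ≤ R`, and otherwise it stays in `{‖x‖ ≥
R}`. Hence the cohomology of `γ⁻¹F` is locally constant along all fibres of `p`.

This has two consequences. First, `Rp_* γ⁻¹F ≃ σ⁻¹γ⁻¹F = F` (`quasiIso_sectionMapC_flowProj`).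
Second, `i⁻¹Rj_* γ⁻¹F ≃ Rq_*Rj_* γ⁻¹F` (`quasiIso_sectionMapC_retractMap`), because the part of
`q⁻¹(U)` in `Y` is a product `D × ℝ`, and its part near `s = 0` is `D` times a half-line. Therefore
`smash F ≃ Rq_*Rj_* γ⁻¹F = Rc_*Rp_* γ⁻¹F ≃ Rc_*F`; this formal argument is
`nonempty_iso_derivedDirectImage`. Finally `c^R` is proper, so `c_!` and `c_*` are isomorphic
functors.

The core is homotopy invariance for a bounded below flasque complex whose stalk cohomology is
locally constant along the lines of `A × ℝ`: restricting from `D × ℝ` to `D` times an open interval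
or half-line has vanishing relative cohomology, which is the predicate `Good`. It follows from
`good_of_isStarAbove`, by induction on the degree and Zorn's lemma on partial primitives. The
complexes are handled through sections and germs of cocycles; `quasiIso_iff_stalkMap`,
`stalkPb_bijective` and `stalkPf_bijective` translate the result back into quasi-isomorphisms. -/

noncomputable section

namespace Smash

/-! ### Sections, cocycles and relative primitives for complexes of sheaves -/

section Sections

variable {k : Type u} [Field k] {X Y : TopCat.{u}}

/-- The sections over `V` of the component of degree `n` of a complex of sheaves. -/
abbrev Sec (K : CochainComplex (Sh k X) ℤ) (n : ℤ) (V : Opens X) : Type u :=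
  ((K.X n).1.obj (op V) : ModuleCat.{u} k)

section Sheaf

/-- Restriction of the sections of a sheaf. -/
def shRes (F : Sh k X) {U V : Opens X} (h : U ≤ V) :
    (F.1.obj (op V) : ModuleCat.{u} k) →ₗ[k] (F.1.obj (op U) : ModuleCat.{u} k) :=
  (F.1.map (homOfLE h).op).hom

/-- The map induced on sections by a morphism of sheaves. -/
def shMap {F G : Sh k X} (f : F ⟶ G) (V : Opens X) :
    (F.1.obj (op V) : ModuleCat.{u} k) →ₗ[k] (G.1.obj (op V) : ModuleCat.{u} k) :=
  (f.1.app (op V)).hom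

variable (F : Sh k X)

@[simp] theorem shRes_self {V : Opens X} (h : V ≤ V) (s : (F.1.obj (op V) : ModuleCat.{u} k)) :
    shRes F h s = s := by
  simp [shRes]

@[simp] theorem shRes_shRes {U V W : Opens X} (h : U ≤ V) (h' : V ≤ W)
    (s : (F.1.obj (op W) : ModuleCat.{u} k)) :
    shRes F h (shRes F h' s) = shRes F (h.trans h') s := by
  have : (homOfLE (h.trans h')).op = (homOfLE h').op ≫ (homOfLE h).op := rfl
  simp [shRes, this]

theorem shMap_shRes {F G : Sh k X} (f : F ⟶ G) {U V : Opens X} (h : U ≤ V)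
    (s : (F.1.obj (op V) : ModuleCat.{u} k)) :
    shMap f U (shRes F h s) = shRes G h (shMap f V s) := by
  have := f.1.naturality (homOfLE h).op
  exact congrArg (fun g => g.hom s) this

theorem shMap_comp {F G H : Sh k X} (f : F ⟶ G) (g : G ⟶ H) (V : Opens X)
    (s : (F.1.obj (op V) : ModuleCat.{u} k)) : shMap (f ≫ g) V s = shMap g V (shMap f V s) := rfl

@[simp] theorem shMap_id (V : Opens X)
    (s : (F.1.obj (op V) : ModuleCat.{u} k)) : shMap (𝟙 F) V s = s := rfl

@[simp] theorem shMap_zero {F G : Sh k X} (V : Opens X)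
    (s : (F.1.obj (op V) : ModuleCat.{u} k)) : shMap (0 : F ⟶ G) V s = 0 := rfl

theorem exists_glue {ι : Type u} (U : ι → Opens X) (s : ∀ i, (F.1.obj (op (U i)) : ModuleCat.{u} k))
    (hs : ∀ i j, shRes F (inf_le_left : U i ⊓ U j ≤ U i) (s i) =
      shRes F (inf_le_right : U i ⊓ U j ≤ U j) (s j)) :
    ∃ t : (F.1.obj (op (iSup U)) : ModuleCat.{u} k), ∀ i, shRes F (le_iSup U i) t = s i :=
  (F.existsUnique_gluing U s hs).exists

theorem shRes_ext {V : Opens X} (s t : (F.1.obj (op V) : ModuleCat.{u} k))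
    (h : ∀ x ∈ V, ∃ (W : Opens X) (hW : W ≤ V), x ∈ W ∧ shRes F hW s = shRes F hW t) : s = t := by
  choose W hW hx hst using h
  refine F.eq_of_locally_eq' (fun x : V => W x x.2) V (fun x => homOfLE (hW x x.2))
    (fun x hx' => Opens.mem_iSup.2 ⟨⟨x, hx'⟩, hx x hx'⟩) s t fun i => hst i i.2

theorem exists_glue₂ {U V : Opens X} (s : (F.1.obj (op U) : ModuleCat.{u} k))
    (t : (F.1.obj (op V) : ModuleCat.{u} k))
    (hst : shRes F (inf_le_left : U ⊓ V ≤ U) s = shRes F (inf_le_right : U ⊓ V ≤ V) t) :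
    ∃ r : (F.1.obj (op (U ⊔ V)) : ModuleCat.{u} k),
      shRes F le_sup_left r = s ∧ shRes F le_sup_right r = t := by
  let W : ULift.{u} Bool → Opens X := fun b => if b.down then U else V
  let z : ∀ b, (F.1.obj (op (W b)) : ModuleCat.{u} k) := fun b =>
    match b with
    | ⟨true⟩ => s
    | ⟨false⟩ => t
  have hst' : shRes F (inf_le_left : V ⊓ U ≤ V) t = shRes F (inf_le_right : V ⊓ U ≤ U) s := by
    have := congrArg (shRes F (le_of_eq (inf_comm _ _) : V ⊓ U ≤ U ⊓ V)) hst
    simpa using this.symm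
  obtain ⟨r, hr⟩ := exists_glue F W z (by
    rintro ⟨(_ | _)⟩ ⟨(_ | _)⟩
    · rfl
    · exact hst'
    · exact hst
    · rfl)
  have h : U ⊔ V ≤ iSup W := sup_le (le_iSup W ⟨true⟩) (le_iSup W ⟨false⟩)
  refine ⟨shRes F h r, ?_, ?_⟩
  · rw [shRes_shRes]; exact hr ⟨true⟩
  · rw [shRes_shRes]; exact hr ⟨false⟩

end Sheaf

variable (K L : CochainComplex (Sh k X) ℤ)

/-- Restriction of sections. -/
def rs {n : ℤ} {U V : Opens X} (h : U ≤ V) : Sec K n V →ₗ[k] Sec K n U := shRes (K.X n) h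

/-- The differential on sections. -/
def dd (i j : ℤ) {V : Opens X} : Sec K i V →ₗ[k] Sec K j V := shMap (K.d i j) V

variable {L} in
/-- The map induced on sections by a morphism of complexes. -/
def mp {K L : CochainComplex (Sh k X) ℤ} (f : K ⟶ L) {n : ℤ} {V : Opens X} :
    Sec K n V →ₗ[k] Sec L n V := shMap (f.f n) V

@[simp] theorem rs_self {n : ℤ} {V : Opens X} (h : V ≤ V) (s : Sec K n V) : rs K h s = s :=
  shRes_self _ h s

@[simp] theorem rs_rs {n : ℤ} {U V W : Opens X} (h : U ≤ V) (h' : V ≤ W) (s : Sec K n W) :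
    rs K h (rs K h' s) = rs K (h.trans h') s := shRes_shRes _ h h' s

theorem dd_rs {i j : ℤ} {U V : Opens X} (h : U ≤ V) (s : Sec K i V) :
    dd K i j (rs K h s) = rs K h (dd K i j s) := shMap_shRes _ h s

@[simp] theorem dd_dd {i j l : ℤ} {V : Opens X} (s : Sec K i V) :
    dd K j l (dd K i j s) = 0 := by
  have := K.d_comp_d i j l
  exact (shMap_comp _ _ V s).symm.trans (by rw [this]; rfl)

theorem mp_rs {K L : CochainComplex (Sh k X) ℤ} (f : K ⟶ L) {n : ℤ} {U V : Opens X} (h : U ≤ V)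
    (s : Sec K n V) : mp f (rs K h s) = rs L h (mp f s) := shMap_shRes _ h s

theorem mp_dd {K L : CochainComplex (Sh k X) ℤ} (f : K ⟶ L) {i j : ℤ} {V : Opens X}
    (s : Sec K i V) : mp f (dd K i j s) = dd L i j (mp f s) := by
  have := f.comm i j
  exact (shMap_comp _ _ V s).symm.trans ((by rw [this] : _ = shMap (f.f i ≫ L.d i j) V s).trans
    (shMap_comp _ _ V s))

theorem rs_ext {n : ℤ} {V : Opens X} (s t : Sec K n V)
    (h : ∀ x ∈ V, ∃ (W : Opens X) (hW : W ≤ V), x ∈ W ∧ rs K hW s = rs K hW t) : s = t :=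
  shRes_ext _ s t h

/-- A complex of flasque sheaves. -/
def Flasque : Prop := ∀ (n : ℤ) (U V : Opens X) (h : U ≤ V), Function.Surjective (rs K (n := n) h)

variable {K} in
/-- The sections annihilated by the differential. -/
def IsCocycle {n : ℤ} {V : Opens X} (z : Sec K n V) : Prop := ∀ j, dd K n j z = 0

theorem dd_eq_zero_of_not_rel {i j : ℤ} (hij : i + 1 ≠ j) {V : Opens X} (s : Sec K i V) :
    dd K i j s = 0 := by
  have : K.d i j = 0 := K.shape i j hij
  rw [dd, this, shMap_zero]

variable {K} in
theorem isCocycle_iff {i j : ℤ} (hij : i + 1 = j) {V : Opens X} {s : Sec K i V} :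
    IsCocycle s ↔ dd K i j s = 0 := by
  refine ⟨fun h => h j, fun h l => ?_⟩
  by_cases hl : i + 1 = l
  · obtain rfl : j = l := hij.symm.trans hl
    exact h
  · exact dd_eq_zero_of_not_rel K hl s

variable {K} in
theorem IsCocycle.rs {n : ℤ} {U V : Opens X} {z : Sec K n V} (hz : IsCocycle z) (h : U ≤ V) :
    IsCocycle (rs K h z) := fun j => by rw [dd_rs, hz, map_zero]

variable {K} in
theorem IsCocycle.sub {n : ℤ} {V : Opens X} {z z' : Sec K n V} (hz : IsCocycle z)
    (hz' : IsCocycle z') : IsCocycle (z - z') := fun j => by rw [map_sub, hz, hz', sub_zero]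

variable {K} in
theorem IsCocycle.add {n : ℤ} {V : Opens X} {z z' : Sec K n V} (hz : IsCocycle z)
    (hz' : IsCocycle z') : IsCocycle (z + z') := fun j => by rw [map_add, hz, hz', add_zero]

theorem isCocycle_zero {n : ℤ} {V : Opens X} : IsCocycle (0 : Sec K n V) := fun _ => map_zero _

theorem isCocycle_dd {i n : ℤ} {V : Opens X} (t : Sec K i V) : IsCocycle (dd K i n t) :=
  fun _ => dd_dd K t

theorem IsCocycle.mp {K L : CochainComplex (Sh k X) ℤ} (f : K ⟶ L) {n : ℤ} {V : Opens X}
    {z : Sec K n V} (hz : IsCocycle z) : IsCocycle (mp f z) := fun j => by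
  rw [← mp_dd, hz, map_zero]

variable {K} in
theorem isCocycle_of_sup {n : ℤ} {U V : Opens X} {z : Sec K n (U ⊔ V)}
    (h : IsCocycle (rs K le_sup_left z)) (h' : IsCocycle (rs K le_sup_right z)) :
    IsCocycle z := fun j => by
  refine shRes_ext _ _ _ fun x hx => ?_
  rcases hx with hx | hx
  · exact ⟨U, le_sup_left, hx, (dd_rs K le_sup_left z).symm.trans ((h j).trans (map_zero _).symm)⟩
  · exact ⟨V, le_sup_right, hx,
      (dd_rs K le_sup_right z).symm.trans ((h' j).trans (map_zero _).symm)⟩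

/-- Every cocycle on `V` vanishing on `U` is the differential of a section vanishing on `U`. -/
def Good (n : ℤ) (U V : Opens X) : Prop :=
  ∃ h : U ≤ V, ∀ s : Sec K n V, IsCocycle s → rs K h s = 0 →
    ∃ t : Sec K (n - 1) V, dd K (n - 1) n t = s ∧ rs K h t = 0

variable {K}

/-- A primitive over `V` extends to `W` by flasqueness. The remaining error vanishes on `V`, so `h₂`
removes it by a correction that is zero on `V`, hence on `U`. -/
theorem Good.trans (hK : Flasque K) {n : ℤ} {U V W : Opens X} (h₁ : Good K n U V)
    (h₂ : Good K n V W) : Good K n U W := by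
  obtain ⟨hUV, h₁⟩ := h₁
  obtain ⟨hVW, h₂⟩ := h₂
  refine ⟨hUV.trans hVW, fun s hs hsU => ?_⟩
  obtain ⟨t', ht', ht'U⟩ := h₁ (rs K hVW s) (hs.rs hVW) (by rw [rs_rs, hsU])
  obtain ⟨t, rfl⟩ := hK _ _ _ hVW t'
  obtain ⟨u, hu, huV⟩ := h₂ (s - dd K (n - 1) n t) (hs.sub (isCocycle_dd K t))
    (by rw [map_sub, ← dd_rs, ht', sub_self])
  refine ⟨t + u, by rw [map_add, hu]; abel, ?_⟩
  rw [map_add, ← rs_rs K hUV hVW t, ht'U, ← rs_rs K hUV hVW u, huV, map_zero, add_zero]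

end Sections

/-! ### Stalk cohomology as germs of cocycles, and local constancy along a path -/

section CohomologyGerms

variable {k : Type u} [Field k] {X : TopCat.{u}} (K : CochainComplex (Sh k X) ℤ)

/-- A cocycle defined on a neighborhood of `x`. -/
structure CocycleGerm (n : ℤ) (x : X) where
  /-- the open neighborhood -/
  V : Opens X
  mem : x ∈ V
  /-- the section -/
  z : Sec K n V
  isCocycle : IsCocycle z

/-- Two cocycles are cohomologous near `x`. -/
def CohomologousAt {n : ℤ} (x : X) {V V' : Opens X} (z : Sec K n V) (z' : Sec K n V') : Prop :=
  ∃ (W : Opens X) (h : W ≤ V) (h' : W ≤ V'), x ∈ W ∧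
    ∃ t : Sec K (n - 1) W, dd K (n - 1) n t = rs K h z - rs K h' z'

variable {K} in
theorem CohomologousAt.symm {n : ℤ} {x : X} {V V' : Opens X} {z : Sec K n V} {z' : Sec K n V'}
    (h : CohomologousAt K x z z') : CohomologousAt K x z' z := by
  obtain ⟨W, h, h', hx, t, ht⟩ := h
  exact ⟨W, h', h, hx, -t, by rw [map_neg, ht, neg_sub]⟩

variable {K} in
theorem CohomologousAt.trans {n : ℤ} {x : X} {V V' V'' : Opens X} {z : Sec K n V} {z' : Sec K n V'}
    {z'' : Sec K n V''} (h : CohomologousAt K x z z') (h' : CohomologousAt K x z' z'') :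
    CohomologousAt K x z z'' := by
  obtain ⟨W, h₁, h₂, hx, t, ht⟩ := h
  obtain ⟨W', h₁', h₂', hx', t', ht'⟩ := h'
  refine ⟨W ⊓ W', inf_le_left.trans h₁, inf_le_right.trans h₂', ⟨hx, hx'⟩,
    rs K inf_le_left t + rs K inf_le_right t', ?_⟩
  rw [map_add, dd_rs, dd_rs, ht, ht', map_sub, map_sub]
  simp only [rs_rs]
  abel

theorem cohomologousAt_of_eq {n : ℤ} {x : X} {V V' W : Opens X} {z : Sec K n V} {z' : Sec K n V'}
    (h : W ≤ V) (h' : W ≤ V') (hx : x ∈ W) (hz : rs K h z = rs K h' z') :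
    CohomologousAt K x z z' :=
  ⟨W, h, h', hx, 0, by rw [hz, sub_self, map_zero]⟩

instance cocycleGermSetoid (n : ℤ) (x : X) : Setoid (CocycleGerm K n x) where
  r g g' := CohomologousAt K x g.z g'.z
  iseqv := ⟨fun g => cohomologousAt_of_eq K le_rfl le_rfl g.mem rfl, fun h => h.symm,
    fun h h' => h.trans h'⟩

/-- The cohomology of the stalk at `x`. -/
def StalkCoh (n : ℤ) (x : X) : Type u := Quotient (cocycleGermSetoid K n x)

variable {K}

/-- The class of a cocycle in the cohomology of the stalk at `x`. -/
def cls {n : ℤ} {V : Opens X} (x : X) (hx : x ∈ V) (z : Sec K n V) (hz : IsCocycle z) :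
    StalkCoh K n x := Quotient.mk _ ⟨V, hx, z, hz⟩

theorem cls_eq_iff {n : ℤ} {x : X} {V V' : Opens X} {hx : x ∈ V} {hx' : x ∈ V'} {z : Sec K n V}
    {z' : Sec K n V'} {hz : IsCocycle z} {hz' : IsCocycle z'} :
    cls x hx z hz = cls x hx' z' hz' ↔ CohomologousAt K x z z' :=
  Quotient.eq (r := cocycleGermSetoid K n x)

theorem exists_cls {n : ℤ} {x : X} (c : StalkCoh K n x) :
    ∃ (V : Opens X) (hx : x ∈ V) (z : Sec K n V) (hz : IsCocycle z), cls x hx z hz = c := by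
  obtain ⟨⟨V, hx, z, hz⟩, rfl⟩ := Quotient.exists_rep c
  exact ⟨V, hx, z, hz, rfl⟩

theorem cls_rs {n : ℤ} {x : X} {U V : Opens X} (h : U ≤ V) (hx : x ∈ U) {z : Sec K n V}
    (hz : IsCocycle z) : cls x hx (rs K h z) (hz.rs h) = cls x (h hx) z hz :=
  cls_eq_iff.2 (cohomologousAt_of_eq K le_rfl h hx (by rw [rs_self]))

theorem CohomologousAt.eventually {n : ℤ} {x : X} {V V' : Opens X} {z : Sec K n V}
    {z' : Sec K n V'} (h : CohomologousAt K x z z') : ∀ᶠ y in 𝓝 x, CohomologousAt K y z z' := by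
  obtain ⟨W, h, h', hx, t, ht⟩ := h
  filter_upwards [W.isOpen.mem_nhds hx] with y hy using ⟨W, h, h', hy, t, ht⟩

/-- The cohomology of the stalks of `K` in degree `n` is locally constant along the path `p`. -/
def LocConstAlong (K : CochainComplex (Sh k X) ℤ) (n : ℤ) (p : ℝ → X) : Prop :=
  ∀ b, ∃ N ∈ 𝓝 b, ∃ (M : Type u) (h : M → ∀ r, StalkCoh K n (p r)),
    (∀ r ∈ N, Function.Bijective fun m => h m r) ∧
    ∀ m, ∀ r ∈ N, ∃ (V : Opens X) (z : Sec K n V) (hz : IsCocycle z), p r ∈ V ∧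
      ∀ᶠ r' in 𝓝 r, ∀ hm : p r' ∈ V, cls (p r') hm z hz = h m r'

end CohomologyGerms

/-! ### Continuing cocycles and primitives along a path -/

section Propagation

/-- Connectedness of the interval, through the supremum of the points where `P` holds. Only forward
transport is required, which is what step-by-step gluing along a segment provides. -/
theorem real_chain {P : ℝ → Prop} {a b : ℝ} (hab : a ≤ b)
    (h : ∀ r ∈ Set.Icc a b, ∃ N ∈ 𝓝 r, ∀ c ∈ N, ∀ c' ∈ N, a ≤ c → c ≤ c' → c' ≤ b → P c → P c')
    (ha : P a) : P b := by
  let S := {c | c ∈ Set.Icc a b ∧ P c}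
  have haS : a ∈ S := ⟨⟨le_rfl, hab⟩, ha⟩
  have hbd : BddAbove S := ⟨b, fun c hc => hc.1.2⟩
  have hle : sSup S ≤ b := csSup_le ⟨a, haS⟩ fun c hc => hc.1.2
  have hge : a ≤ sSup S := le_csSup hbd haS
  obtain ⟨N, hN, hP⟩ := h (sSup S) ⟨hge, hle⟩
  obtain ⟨ε, hε, hNε⟩ := Metric.mem_nhds_iff.1 hN
  obtain ⟨c, hcS, hc⟩ := exists_lt_of_lt_csSup ⟨a, haS⟩ (sub_lt_self (sSup S) hε)
  have hc' := le_csSup hbd hcS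
  have hcN : c ∈ N := hNε (by rw [Metric.mem_ball, Real.dist_eq, abs_lt]; constructor <;> linarith)
  by_cases hlt : sSup S < b
  · exfalso
    let d := min b (sSup S + ε / 2)
    have hd : sSup S < d := lt_min hlt (by linarith)
    have hd' : d ≤ sSup S + ε / 2 := min_le_right _ _
    have hdN : d ∈ N :=
      hNε (by rw [Metric.mem_ball, Real.dist_eq, abs_lt]; constructor <;> linarith)
    have hdS : d ∈ S := ⟨⟨by linarith, min_le_left _ _⟩,
      hP c hcN d hdN hcS.1.1 (by linarith) (min_le_left _ _) hcS.2⟩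
    linarith [le_csSup hbd hdS]
  · obtain hb : sSup S = b := le_antisymm hle (not_lt.1 hlt)
    rw [← hb]
    exact hP c hcN _ (mem_of_mem_nhds hN) hcS.1.1 hc' hle hcS.2

/-- The compact sets `C₁ \ W` and `C₂` are disjoint, hence separated; adding `W` to the neighborhood
of the first creates no overlap outside `W`. -/
theorem exists_opens_inf_le {X : Type*} [TopologicalSpace X] [T2Space X] {C₁ C₂ : Set X}
    (h₁ : IsCompact C₁) (h₂ : IsCompact C₂) (W : Opens X) (h : C₁ ∩ C₂ ⊆ W) :
    ∃ A B : Opens X, C₁ ⊆ A ∧ C₂ ⊆ B ∧ A ⊓ B ≤ W := by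
  obtain ⟨U, V, hU, hV, hCU, hCV, hd⟩ := SeparatedNhds.of_isCompact_isCompact
    (h₁.diff W.isOpen) h₂ (Set.disjoint_left.2 fun x hx hx' => hx.2 (h ⟨hx.1, hx'⟩))
  refine ⟨⟨U, hU⟩ ⊔ W, ⟨V, hV⟩, fun x hx => ?_, hCV, fun x hx => ?_⟩
  · by_cases hxW : x ∈ W
    · exact Or.inr hxW
    · exact Or.inl (hCU ⟨hx, hxW⟩)
  · rcases hx.1 with hxU | hxW
    · exact (Set.disjoint_left.1 hd hxU hx.2).elim
    · exact hxW

variable {k : Type u} [Field k] {X : TopCat.{u}} [T2Space X] {K : CochainComplex (Sh k X) ℤ}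

/-- Sections on neighborhoods of two compact subsets which agree near their intersection can be
glued. -/
theorem exists_glue_of_isCompact {n : ℤ} {C₁ C₂ : Set X} (h₁ : IsCompact C₁) (h₂ : IsCompact C₂)
    {V₁ V₂ W : Opens X} (hC₁ : C₁ ⊆ V₁) (hC₂ : C₂ ⊆ V₂) (hW : C₁ ∩ C₂ ⊆ W) (hW₁ : W ≤ V₁)
    (hW₂ : W ≤ V₂) (s₁ : Sec K n V₁) (s₂ : Sec K n V₂) (h : rs K hW₁ s₁ = rs K hW₂ s₂) :
    ∃ (A B : Opens X) (hA : A ≤ V₁) (hB : B ≤ V₂) (s : Sec K n (A ⊔ B)), C₁ ⊆ A ∧ C₂ ⊆ B ∧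
      rs K le_sup_left s = rs K hA s₁ ∧ rs K le_sup_right s = rs K hB s₂ := by
  obtain ⟨A, B, hA, hB, hAB⟩ := exists_opens_inf_le h₁ h₂ W hW
  have hle : (V₁ ⊓ A) ⊓ (V₂ ⊓ B) ≤ W := (inf_le_inf inf_le_right inf_le_right).trans hAB
  obtain ⟨s, hs₁, hs₂⟩ := exists_glue₂ (K.X n) (U := V₁ ⊓ A) (V := V₂ ⊓ B)
    (rs K inf_le_left s₁) (rs K inf_le_left s₂) (by
      have := congrArg (rs K hle) h
      simp only [rs_rs] at this
      refine (rs_rs K _ _ s₁).trans (this.trans (rs_rs K _ _ s₂).symm))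
  exact ⟨V₁ ⊓ A, V₂ ⊓ B, inf_le_left, inf_le_left, s, fun x hx => ⟨hC₁ hx, hA hx⟩,
    fun x hx => ⟨hC₂ hx, hB hx⟩, hs₁, hs₂⟩

variable {p : ℝ → X} (hp : Continuous p) (hinj : Function.Injective p) (hK : Flasque K)

include hp hinj hK

/-- Near `b` the class of `z` is one label `m` of the trivialization, and every point of the segment
has a cocycle representing `m` nearby. These representatives are glued one after the other, each
being first corrected by a coboundary. Tracking the class at the right end keeps the induction
going. -/
theorem exists_cocycle_extension {n : ℤ} (hlc : LocConstAlong K n p) (b : ℝ) :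
    ∃ N ∈ 𝓝 b, ∀ a ∈ N, ∀ c ∈ N, a ≤ c → ∀ (V : Opens X) (z : Sec K n V), IsCocycle z → p a ∈ V →
      ∃ (V' : Opens X) (z' : Sec K n V'), IsCocycle z' ∧ (∀ r ∈ Set.Icc a c, p r ∈ V') ∧
        ∃ (W : Opens X) (h : W ≤ V') (h' : W ≤ V), p a ∈ W ∧ rs K h z' = rs K h' z := by
  obtain ⟨N₁, hN₁, M, h, hbij, hloc⟩ := hlc b
  obtain ⟨ε, hε, hN⟩ := Metric.mem_nhds_iff.1 hN₁
  refine ⟨_, Metric.ball_mem_nhds b hε, fun a ha c hc hac V z hz haV => ?_⟩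
  have hsub : Set.Icc a c ⊆ N₁ := by
    refine fun r hr => hN ?_
    rw [Real.ball_eq_Ioo] at ha hc ⊢
    exact ⟨ha.1.trans_le hr.1, hr.2.trans_lt hc.2⟩
  obtain ⟨m, hm⟩ := (hbij a (hN ha)).2 (cls (p a) haV z hz)
  have key : ∃ (V' : Opens X) (z' : Sec K n V') (hz' : IsCocycle z'),
      (∀ r ∈ Set.Icc a c, p r ∈ V') ∧
      (∃ (W : Opens X) (h : W ≤ V') (h' : W ≤ V), p a ∈ W ∧ rs K h z' = rs K h' z) ∧
      ∃ hm : p c ∈ V', cls (p c) hm z' hz' = h m c := by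
    refine real_chain (P := fun c => ∃ (V' : Opens X) (z' : Sec K n V') (hz' : IsCocycle z'),
      (∀ r ∈ Set.Icc a c, p r ∈ V') ∧
      (∃ (W : Opens X) (h : W ≤ V') (h' : W ≤ V), p a ∈ W ∧ rs K h z' = rs K h' z) ∧
      ∃ hm : p c ∈ V', cls (p c) hm z' hz' = h m c) hac (fun r hr => ?_) ?_
    · obtain ⟨V₁, z₁, hz₁, hr₁, hev⟩ := hloc m r (hsub hr)
      have hev' := hev.and (hp.continuousAt.eventually (V₁.isOpen.mem_nhds hr₁))
      obtain ⟨δ, hδ, hball⟩ := Metric.eventually_nhds_iff_ball.1 hev'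
      refine ⟨_, Metric.ball_mem_nhds r hδ, ?_⟩
      rintro c₁ hc₁ c₂ hc₂ hac₁ hc₁₂ hc₂c ⟨V', z', hz', hV', ⟨W₀, hW₀', hW₀, haW₀, hzW₀⟩, hcV', hcls⟩
      have hcls' := hcls.trans ((hball c₁ hc₁).1 (hball c₁ hc₁).2).symm
      obtain ⟨W, hW, hW', hcW, t, ht⟩ := cls_eq_iff.1 hcls'
      -- Flasqueness extends the primitive of the difference to all of `V₁`, so that `z₁ + dt` is a
      -- cocycle on `V₁` agreeing with `z'` near `p c₁`.
      obtain ⟨t, rfl⟩ := hK _ _ _ hW' t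
      have hseg : Set.Icc c₁ c₂ ⊆ Metric.ball r δ := by
        rw [Real.ball_eq_Ioo] at hc₁ hc₂ ⊢
        exact fun x hx => ⟨hc₁.1.trans_le hx.1, hx.2.trans_lt hc₂.2⟩
      obtain ⟨A, B, hA, hB, s, hCA, hCB, hsA, hsB⟩ := exists_glue_of_isCompact (K := K) (n := n)
        ((isCompact_Icc (a := a) (b := c₁)).image hp) ((isCompact_Icc (a := c₁) (b := c₂)).image hp)
        (V₁ := V') (V₂ := V₁) (W := W)
        (Set.image_subset_iff.2 hV') (Set.image_subset_iff.2 fun x hx => (hball x (hseg hx)).2)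
        (by
          rintro _ ⟨⟨x, hx, rfl⟩, ⟨y, hy, hxy⟩⟩
          -- Injectivity of the path makes the two consecutive segments meet in the single point `p
          -- c₁`, the only place where agreement is known.
          obtain rfl := hinj hxy
          obtain rfl := le_antisymm hx.2 hy.1
          exact hcW) hW hW' z' (z₁ + dd K (n - 1) n t) (by
            rw [map_add, ← dd_rs, ht]; abel)
      have hs : IsCocycle s := isCocycle_of_sup (hsA ▸ hz'.rs hA)
        (hsB ▸ (hz₁.add (isCocycle_dd K t)).rs hB)
      have hc₂B : p c₂ ∈ B := hCB ⟨c₂, ⟨hc₁₂, le_rfl⟩, rfl⟩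
      refine ⟨A ⊔ B, s, hs, fun x hx => ?_,
        ⟨A ⊓ W₀, inf_le_left.trans le_sup_left, inf_le_right.trans hW₀,
          ⟨hCA ⟨a, ⟨le_rfl, hac₁⟩, rfl⟩, haW₀⟩, ?_⟩, Or.inr hc₂B, ?_⟩
      · rcases le_total x c₁ with hx₁ | hx₁
        · exact Or.inl (hCA ⟨x, ⟨hx.1, hx₁⟩, rfl⟩)
        · exact Or.inr (hCB ⟨x, ⟨hx₁, hx.2⟩, rfl⟩)
      · rw [← rs_rs K inf_le_left le_sup_left, hsA, rs_rs, ← rs_rs K inf_le_right hW₀, ← hzW₀,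
          rs_rs]
      · refine (cls_eq_iff.2 ?_).trans ((hball c₂ hc₂).1 (hball c₂ hc₂).2)
        refine ⟨B, le_sup_right, hB, hc₂B, rs K hB t, ?_⟩
        rw [hsB, map_add, dd_rs]
        abel
    · exact ⟨V, z, hz, fun r hr => by rwa [le_antisymm hr.2 hr.1],
        ⟨V, le_rfl, le_rfl, haV, rfl⟩, haV, hm.symm⟩
  obtain ⟨V', z', hz', h₁, h₂, -⟩ := key
  exact ⟨V', z', hz', h₁, h₂⟩

/-- Local constancy in degree `n` spreads the vanishing of the class of `s` along the segment,
giving local primitives. Two of them differ by a cocycle of degree `n - 1`, and local constancy in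
that degree continues the difference, so that the primitives can be adjusted and glued. -/
theorem exists_primitive {n : ℤ} (hlc : LocConstAlong K n p) (hlc' : LocConstAlong K (n - 1) p)
    {a b : ℝ} (hab : a ≤ b) {V W₀ : Opens X} (s : Sec K n V) (hs : IsCocycle s)
    (hV : ∀ r ∈ Set.Icc a b, p r ∈ V) (hW₀ : W₀ ≤ V) (ha : p a ∈ W₀) (hs₀ : rs K hW₀ s = 0) :
    ∃ (V' : Opens X) (hV' : V' ≤ V) (t : Sec K (n - 1) V'), (∀ r ∈ Set.Icc a b, p r ∈ V') ∧
      dd K (n - 1) n t = rs K hV' s ∧ ∃ (W : Opens X) (h : W ≤ V'), p a ∈ W ∧ rs K h t = 0 := by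
  have hnull : ∀ c ∈ Set.Icc a b, CohomologousAt K (p c) s (0 : Sec K n V) := by
    intro c hc
    refine real_chain (P := fun c => CohomologousAt K (p c) s (0 : Sec K n V)) hc.1
      (fun r hr => ?_) (cohomologousAt_of_eq K hW₀ hW₀ ha (by rw [hs₀, map_zero]))
    have hrV : p r ∈ V := hV r ⟨hr.1, hr.2.trans hc.2⟩
    obtain ⟨N, hN, M, h, hbij, hloc⟩ := hlc r
    have hrN := mem_of_mem_nhds hN
    -- A cocycle defined near `p r` has a constant label for nearby parameters. Applied to `s` and
    -- to `0`, this means that equality of the two classes at one such parameter forces equality at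
    -- the others.
    have aux : ∀ (z : Sec K n V) (hz : IsCocycle z), ∃ m, ∀ᶠ c in 𝓝 r, ∀ hm : p c ∈ V,
        cls (p c) hm z hz = h m c := by
      intro z hz
      obtain ⟨m, hm⟩ := (hbij r hrN).2 (cls (p r) hrV z hz)
      obtain ⟨V₁, z₁, hz₁, hr₁, hev⟩ := hloc m r hrN
      have h₁ := hm.symm.trans (hev.self_of_nhds hr₁).symm
      refine ⟨m, ?_⟩
      filter_upwards [hp.continuousAt.eventually (cls_eq_iff.1 h₁).eventually, hev,
        hp.continuousAt.eventually (V₁.isOpen.mem_nhds hr₁)] with c h₁ h₂ h₃ hm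
      rw [← h₂ h₃]
      exact cls_eq_iff.2 h₁
    obtain ⟨m, hm⟩ := aux s hs
    obtain ⟨m', hm'⟩ := aux 0 (isCocycle_zero K)
    have hev := (hm.and hm').and
      ((hp.continuousAt.eventually (V.isOpen.mem_nhds hrV)).and hN)
    refine ⟨_, hev, ?_⟩
    rintro c₁ ⟨⟨h₁, h₁'⟩, h₁V, h₁N⟩ c₂ ⟨⟨h₂, h₂'⟩, h₂V, h₂N⟩ - - - hc₁
    have := cls_eq_iff (hx := h₁V) (hx' := h₁V) (hz := hs) (hz' := isCocycle_zero K) |>.2 hc₁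
    rw [h₁, h₁'] at this
    obtain rfl := (hbij c₁ h₁N).1 this
    refine cls_eq_iff (hx := h₂V) (hx' := h₂V) (hz := hs) (hz' := isCocycle_zero K) |>.1 ?_
    rw [h₂, h₂']
  refine real_chain (P := fun b => ∃ (V' : Opens X) (hV' : V' ≤ V) (t : Sec K (n - 1) V'),
    (∀ r ∈ Set.Icc a b, p r ∈ V') ∧ dd K (n - 1) n t = rs K hV' s ∧
      ∃ (W : Opens X) (h : W ≤ V'), p a ∈ W ∧ rs K h t = 0) hab (fun r hr => ?_) ?_
  · obtain ⟨Wr, hWr, _, hrW, tr, htr⟩ := hnull r hr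
    rw [map_zero, sub_zero] at htr
    obtain ⟨N, hN, hext⟩ := exists_cocycle_extension hp hinj hK hlc' r
    obtain ⟨δ, hδ, hball⟩ := Metric.mem_nhds_iff.1
      (Filter.inter_mem hN (hp.continuousAt.eventually (Wr.isOpen.mem_nhds hrW)))
    refine ⟨_, Metric.ball_mem_nhds r hδ, ?_⟩
    rintro c₁ hc₁ c₂ hc₂ hac₁ hc₁₂ hc₂b ⟨V', hV', t, hseg, ht, W₁, hW₁, haW₁, htW₁⟩
    have hsub : Set.Icc c₁ c₂ ⊆ Metric.ball r δ := by
      rw [Real.ball_eq_Ioo] at hc₁ hc₂ ⊢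
      exact fun x hx => ⟨hc₁.1.trans_le hx.1, hx.2.trans_lt hc₂.2⟩
    -- The primitives `t` and `tr` of `s` differ near `p c₁` by a cocycle; its continuation `z`
    -- along the next segment makes `tr + z` agree with `t` near `p c₁`.
    obtain ⟨V'', z, hz, hzV, W, hW'', hW, hcW, hzW⟩ := hext c₁ (hball hc₁).1 c₂ (hball hc₂).1 hc₁₂
      (V' ⊓ Wr) (rs K inf_le_left t - rs K inf_le_right tr) ((isCocycle_iff (sub_add_cancel n 1)).2
        (by rw [map_sub, dd_rs, dd_rs, ht, htr]; simp only [rs_rs, sub_self]))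
      ⟨hseg c₁ ⟨hac₁, le_rfl⟩, (hball hc₁).2⟩
    obtain ⟨A, B, hA, hB, u, hCA, hCB, huA, huB⟩ := exists_glue_of_isCompact (K := K) (n := n - 1)
        ((isCompact_Icc (a := a) (b := c₁)).image hp) ((isCompact_Icc (a := c₁) (b := c₂)).image hp)
        (V₁ := V') (V₂ := Wr ⊓ V'') (W := W)
        (Set.image_subset_iff.2 hseg)
        (Set.image_subset_iff.2 fun x hx => ⟨(hball (hsub hx)).2, hzV x hx⟩)
        (by
          rintro _ ⟨⟨x, hx, rfl⟩, ⟨y, hy, hxy⟩⟩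
          obtain rfl := hinj hxy
          obtain rfl := le_antisymm hx.2 hy.1
          exact hcW) (hW.trans inf_le_left) (le_inf (hW.trans inf_le_right) hW'') t
        (rs K inf_le_left tr + rs K inf_le_right z) (by
            rw [map_add, rs_rs, rs_rs, hzW, map_sub, rs_rs, rs_rs]; abel)
    refine ⟨A ⊔ B, sup_le (hA.trans hV') (hB.trans (inf_le_left.trans hWr)), u, fun x hx => ?_, ?_,
      A ⊓ W₁, inf_le_left.trans le_sup_left, ⟨hCA ⟨a, ⟨le_rfl, hac₁⟩, rfl⟩, haW₁⟩, ?_⟩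
    · rcases le_total x c₁ with hx₁ | hx₁
      · exact Or.inl (hCA ⟨x, ⟨hx.1, hx₁⟩, rfl⟩)
      · exact Or.inr (hCB ⟨x, ⟨hx₁, hx.2⟩, rfl⟩)
    · refine rs_ext K _ _ fun x hx => ?_
      rcases hx with hx | hx
      · refine ⟨A, le_sup_left, hx, ?_⟩
        rw [← dd_rs, huA, dd_rs, ht, rs_rs, rs_rs]
      · refine ⟨B, le_sup_right, hx, ?_⟩
        rw [← dd_rs, huB, dd_rs, map_add, dd_rs, dd_rs, htr, hz, map_zero, add_zero, rs_rs, rs_rs,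
          rs_rs]
    · rw [← rs_rs K inf_le_left le_sup_left, huA, rs_rs, ← rs_rs K inf_le_right hW₁, htW₁, map_zero]
  · exact ⟨W₀, hW₀, 0, fun r hr => by rwa [le_antisymm hr.2 hr.1], by rw [hs₀, map_zero],
      W₀, le_rfl, ha, map_zero _⟩

end Propagation

/-! ### Vanishing of relative cohomology for open sets star-shaped along lines -/

section Star

variable {k : Type u} [Field k] {X : TopCat.{u}} {K : CochainComplex (Sh k X) ℤ}
  {A : Type u} [TopologicalSpace A]

/-- `P` contains, with `e (w, r)` where `r₀ ≤ r`, the segment from `e (w, r₀)` to `e (w, r)`. -/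
def IsStarAbove (e : A × ℝ ≃ₜ X) (r₀ : ℝ) (P : Opens X) : Prop :=
  ∀ w r, e (w, r) ∈ P → ∀ r' ∈ Set.Icc r₀ r, e (w, r') ∈ P

/-- The image in `X` of `D × (a, b)`. -/
def boxOpens (e : A × ℝ ≃ₜ X) (D : Opens A) (J : Opens ℝ) : Opens X :=
  ⟨e.symm ⁻¹' (D ×ˢ J), (D.isOpen.prod J.isOpen).preimage e.symm.continuous⟩

@[simp] theorem mem_boxOpens (e : A × ℝ ≃ₜ X) (D : Opens A) (J : Opens ℝ) (w : A) (r : ℝ) :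
    e (w, r) ∈ boxOpens e D J ↔ w ∈ D ∧ r ∈ J := by
  change e.symm (e (w, r)) ∈ (D : Set A) ×ˢ (J : Set ℝ) ↔ _
  rw [e.symm_apply_apply]
  rfl

theorem opens_le_iff (e : A × ℝ ≃ₜ X) {U V : Opens X} :
    U ≤ V ↔ ∀ w r, e (w, r) ∈ U → e (w, r) ∈ V := by
  refine ⟨fun h w r hw => h hw, fun h x hx => ?_⟩
  obtain ⟨⟨w, r⟩, rfl⟩ := e.surjective x
  exact h w r hx

/-- The open interval `(a, b)`. -/
def iooOpens (a b : ℝ) : Opens ℝ := ⟨Set.Ioo a b, isOpen_Ioo⟩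

theorem mem_iooOpens {a b r : ℝ} : r ∈ iooOpens a b ↔ a < r ∧ r < b := Iff.rfl

/-- The open interval `(a, ∞)`. -/
def ioiOpens (a : ℝ) : Opens ℝ := ⟨Set.Ioi a, isOpen_Ioi⟩

theorem mem_ioiOpens {a r : ℝ} : r ∈ ioiOpens a ↔ a < r := Iff.rfl

/-- The tube lemma, applied to `{w} × [a, b]` and to `{w} × {a}`; intersecting the bases and taking
the smaller margin gives common `D` and `δ`. -/
theorem exists_boxOpens_le (e : A × ℝ ≃ₜ X) {V W : Opens X} {w : A} {a b : ℝ} (hab : a ≤ b)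
    (hV : ∀ r ∈ Set.Icc a b, e (w, r) ∈ V) (hW : e (w, a) ∈ W) :
    ∃ (D : Opens A) (δ : ℝ), w ∈ D ∧ 0 < δ ∧ boxOpens e D (iooOpens (a - δ) (b + δ)) ≤ V ∧
      boxOpens e D (iooOpens (a - δ) (a + δ)) ≤ W := by
  have tube : ∀ (c : ℝ) (V : Opens X), a ≤ c → (∀ r ∈ Set.Icc a c, e (w, r) ∈ V) →
      ∃ (D : Opens A) (δ : ℝ), w ∈ D ∧ 0 < δ ∧ boxOpens e D (iooOpens (a - δ) (c + δ)) ≤ V := by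
    intro c V hac hV
    obtain ⟨D, J, hD, hJ, hwD, hcJ, hDJ⟩ := generalized_tube_lemma (isCompact_singleton (x := w))
      (isCompact_Icc (a := a) (b := c)) (V.isOpen.preimage e.continuous) (by
        rintro ⟨w', r⟩ ⟨hw, hr⟩
        obtain rfl : w' = w := hw
        exact hV r hr)
    obtain ⟨δ₁, hδ₁, h₁⟩ := Metric.isOpen_iff.1 hJ a (hcJ ⟨le_rfl, hac⟩)
    obtain ⟨δ₂, hδ₂, h₂⟩ := Metric.isOpen_iff.1 hJ c (hcJ ⟨hac, le_rfl⟩)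
    rw [Real.ball_eq_Ioo] at h₁ h₂
    refine ⟨⟨D, hD⟩, min δ₁ δ₂, hwD rfl, lt_min hδ₁ hδ₂, (opens_le_iff e).2 fun w' r h => ?_⟩
    obtain ⟨hw', hr₁, hr₂⟩ := (mem_boxOpens _ _ _ _ _).1 h
    refine hDJ (⟨hw', ?_⟩ : (w', r) ∈ D ×ˢ J)
    have := min_le_left δ₁ δ₂
    have := min_le_right δ₁ δ₂
    rcases lt_or_ge r a with ha | ha
    · exact h₁ ⟨by linarith, by linarith⟩
    · rcases le_or_gt r c with hc | hc
      · exact hcJ ⟨ha, hc⟩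
      · exact h₂ ⟨by linarith, by linarith⟩
  obtain ⟨D₁, δ₁, hw₁, hδ₁, h₁⟩ := tube b V hab hV
  obtain ⟨D₂, δ₂, hw₂, hδ₂, h₂⟩ := tube a W le_rfl fun r hr => by rwa [le_antisymm hr.2 hr.1]
  refine ⟨D₁ ⊓ D₂, min δ₁ δ₂, ⟨hw₁, hw₂⟩, lt_min hδ₁ hδ₂, ?_, ?_⟩
  · refine le_trans ((opens_le_iff e).2 fun w r h => ?_) h₁
    rw [mem_boxOpens, mem_iooOpens] at h ⊢
    exact ⟨h.1.1, by linarith [min_le_left δ₁ δ₂, h.2.1], by linarith [min_le_left δ₁ δ₂, h.2.2]⟩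
  · refine le_trans ((opens_le_iff e).2 fun w r h => ?_) h₂
    rw [mem_boxOpens, mem_iooOpens] at h ⊢
    exact ⟨h.1.2, by linarith [min_le_right δ₁ δ₂, h.2.1], by linarith [min_le_right δ₁ δ₂, h.2.2]⟩

/-- A primitive of `s` on an open subset which is star-shaped above `r₀`. -/
structure PartialPrimitive (e : A × ℝ ≃ₜ X) (r₀ : ℝ) {n : ℤ} {O' O : Opens X} (s : Sec K n O) where
  /-- the open subset -/
  P : Opens X
  le : P ≤ O
  ge : O' ≤ P
  star : IsStarAbove e r₀ P
  /-- the primitive -/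
  t : Sec K (n - 1) P
  eq : dd K (n - 1) n t = rs K le s
  zero : rs K ge t = 0

/-- Zorn's lemma for the order by extension: the primitives of a chain are compatible and glue on
the union, and being star-shaped above `r₀` passes to unions. The given `p₀` bounds the empty chain.
-/
theorem PartialPrimitive.exists_maximal (e : A × ℝ ≃ₜ X) (r₀ : ℝ) {n : ℤ} {O' O : Opens X}
    (s : Sec K n O) (p₀ : PartialPrimitive (O' := O') e r₀ s) :
    ∃ p : PartialPrimitive (O' := O') e r₀ s, ∀ q : PartialPrimitive (O' := O') e r₀ s,
      (∃ h : p.P ≤ q.P, rs K h q.t = p.t) → q.P ≤ p.P := by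
  let R : PartialPrimitive (O' := O') e r₀ s → PartialPrimitive (O' := O') e r₀ s → Prop :=
    fun p q => ∃ h : p.P ≤ q.P, rs K h q.t = p.t
  have hchain : ∀ c : Set (PartialPrimitive (O' := O') e r₀ s), IsChain R c →
      ∃ ub, ∀ a ∈ c, R a ub := by
    intro c hc
    rcases c.eq_empty_or_nonempty with rfl | ⟨q₀, hq₀⟩
    · exact ⟨p₀, by simp⟩
    obtain ⟨t, ht⟩ := exists_glue (K.X (n - 1)) (fun q : c => q.1.P) (fun q => q.1.t) (by
      intro p q
      by_cases hpq : p.1 = q.1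
      · obtain rfl := Subtype.ext hpq
        rfl
      · rcases hc p.2 q.2 hpq with ⟨h, h'⟩ | ⟨h, h'⟩
        · exact (congrArg (shRes _ _) h'.symm).trans (shRes_shRes _ _ h _)
        · exact ((congrArg (shRes _ _) h'.symm).trans (shRes_shRes _ _ h _)).symm)
    have hge : O' ≤ ⨆ q : c, q.1.P := q₀.ge.trans (le_iSup (fun q : c => q.1.P) ⟨q₀, hq₀⟩)
    refine ⟨⟨⨆ q : c, q.1.P, iSup_le fun q => q.1.le, hge, fun w r h r' hr' => ?_, t, ?_, ?_⟩,
      fun q hq => ⟨le_iSup (fun q : c => q.1.P) ⟨q, hq⟩, ht ⟨q, hq⟩⟩⟩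
    · obtain ⟨q, hq⟩ := Opens.mem_iSup.1 h
      exact Opens.mem_iSup.2 ⟨q, q.1.star w r hq r' hr'⟩
    · refine rs_ext K _ _ fun x hx => ?_
      obtain ⟨q, hq⟩ := Opens.mem_iSup.1 hx
      refine ⟨q.1.P, le_iSup (fun q : c => q.1.P) q, hq, ?_⟩
      rw [← dd_rs, rs_rs]
      exact (congrArg (dd K (n - 1) n) (ht q)).trans q.1.eq
    · rw [← rs_rs K q₀.ge (le_iSup (fun q : c => q.1.P) ⟨q₀, hq₀⟩)]
      exact (congrArg (rs K q₀.ge) (ht ⟨q₀, hq₀⟩)).trans q₀.zero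
  obtain ⟨p, hp⟩ := exists_maximal_of_chains_bounded hchain
    (fun {a b c} ⟨h, hab⟩ ⟨h', hbc⟩ => ⟨h.trans h', by rw [← rs_rs K h h', hbc, hab]⟩)
  exact ⟨p, fun q hq => (hp q hq).1⟩

/-- Induction on the degree, starting below `n₀` where all sections vanish. If a maximal partial
primitive on `P` misses a point `e (w, r)` of `O`, a primitive is built along the segment from `r₀`
to `r` and thickened to a box `B`. Its disagreement with the old one on `P ⊓ B` is a cocycle of
degree `n - 1`, which is exact by the inductive hypothesis; removing it extends the primitive to `P
⊔ B`, contrary to maximality. -/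
theorem good_of_isStarAbove [T2Space X] (e : A × ℝ ≃ₜ X) (hK : Flasque K) {n₀ : ℤ}
    (hn₀ : ∀ n < n₀, ∀ V, Subsingleton (Sec K n V))
    (hlc : ∀ n w, LocConstAlong K n fun r => e (w, r)) (r₀ : ℝ) (m : ℕ) :
    ∀ (n : ℤ), n < n₀ + m → ∀ (O' O : Opens X), O' ≤ O → IsStarAbove e r₀ O' →
      IsStarAbove e r₀ O → (∀ w, ∀ r ≤ r₀, e (w, r) ∈ O → e (w, r) ∈ O') → Good K n O' O := by
  induction m with
  | zero =>
    intro n hn O' O hle _ _ _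
    have := hn₀ n (by simpa using hn) O
    exact ⟨hle, fun s _ _ => ⟨0, Subsingleton.elim _ _, map_zero _⟩⟩
  | succ m ih =>
    intro n hn O' O hle hO' hO hbase
    refine ⟨hle, fun s hs hs' => ?_⟩
    obtain ⟨p, hmax⟩ := PartialPrimitive.exists_maximal e r₀ s
      (⟨O', hle, le_rfl, hO', 0, by rw [map_zero, hs'], map_zero _⟩ :
        PartialPrimitive (O' := O') e r₀ s)
    suffices h : O ≤ p.P by
      refine ⟨rs K h p.t, ?_, by rw [rs_rs]; exact p.zero⟩
      rw [dd_rs, p.eq, rs_rs, rs_self]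
    rw [opens_le_iff e]
    intro w r hr
    by_contra hnot
    have hr₀ : r₀ ≤ r := by
      by_contra hlt
      exact hnot (p.ge (hbase w r (not_le.1 hlt).le hr))
    have hseg : ∀ r' ∈ Set.Icc r₀ r, e (w, r') ∈ O := hO w r hr
    have hP₀ : e (w, r₀) ∈ p.P := p.ge (hbase w r₀ le_rfl (hseg r₀ ⟨le_rfl, hr₀⟩))
    -- Subtracting the differential of an extension of `p.t` leaves a cocycle that vanishes on `P`,
    -- in particular near `e (w, r₀)`, as the propagation of primitives requires.
    obtain ⟨t', ht'⟩ := hK _ _ _ p.le p.t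
    obtain ⟨V', hV', t'', hsegV', ht'', W, hW, hW₀, htW⟩ := exists_primitive (p := fun r => e (w, r))
      (by fun_prop) (fun a b hab => by simpa using e.injective hab) hK (hlc n w) (hlc (n - 1) w) hr₀
      (s - dd K (n - 1) n t') (hs.sub (isCocycle_dd K t')) hseg p.le hP₀
      (by rw [map_sub, ← dd_rs, ht', p.eq, sub_self])
    obtain ⟨D, δ, hwD, hδ, hbox, hbox₀⟩ := exists_boxOpens_le e hr₀ hsegV'
      (W := W ⊓ p.P) ⟨hW₀, hP₀⟩
    set B := boxOpens e D (iooOpens (r₀ - δ) (r + δ)) with hB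
    set B₀ := boxOpens e D (iooOpens (r₀ - δ) (r₀ + δ)) with hB₀
    have hstarB : IsStarAbove e r₀ B := by
      intro w' r' h x hx
      rw [hB, mem_boxOpens, mem_iooOpens] at h ⊢
      exact ⟨h.1, by linarith [hx.1], hx.2.trans_lt h.2.2⟩
    have hB₀B : B₀ ≤ B := (opens_le_iff e).2 fun w' r' h => by
      rw [hB, hB₀, mem_boxOpens, mem_iooOpens] at *
      exact ⟨h.1, h.2.1, by linarith [h.2.2]⟩
    -- The pair `B₀ ≤ P ⊓ B` satisfies the same hypotheses: both are star-shaped above `r₀`, and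
    -- below `r₀` the box `B` has only points of `B₀`. On `P ⊓ B` the section `t''` is a cocycle,
    -- and it vanishes on `B₀`.
    obtain ⟨hle', hg⟩ := ih (n - 1) (by push_cast at hn; linarith) B₀ (p.P ⊓ B)
      (le_inf (hbox₀.trans inf_le_right) hB₀B)
      (by
        intro w' r' h x hx
        rw [hB₀, mem_boxOpens, mem_iooOpens] at h ⊢
        exact ⟨h.1, by linarith [hx.1], hx.2.trans_lt h.2.2⟩)
      (fun w' r' h x hx => ⟨p.star w' r' h.1 x hx, hstarB w' r' h.2 x hx⟩)
      (by
        intro w' r' hr' h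
        have h := (mem_boxOpens _ _ _ _ _).1 h.2
        rw [hB₀, mem_boxOpens, mem_iooOpens]
        exact ⟨h.1, h.2.1, by linarith⟩)
    obtain ⟨v, hv, -⟩ := hg (rs K (inf_le_right.trans hbox) t'')
      ((isCocycle_iff (sub_add_cancel n 1)).2 (by
        rw [dd_rs, ht'', rs_rs, ← rs_rs K inf_le_left p.le, map_sub, ← dd_rs, ht', p.eq, sub_self,
          map_zero]))
      (by rw [rs_rs, ← rs_rs K (hbox₀.trans inf_le_left) hW, htW, map_zero])
    -- With `v` extended to `B`, the section `t' + t'' - dv` is a primitive on all of `B` that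
    -- restricts to `p.t` on `P ⊓ B`.
    obtain ⟨v, rfl⟩ := hK _ _ _ inf_le_right v
    obtain ⟨t, htP, htB⟩ := exists_glue₂ (K.X (n - 1)) p.t
      (rs K (hbox.trans hV') t' + (rs K hbox t'' - dd K (n - 1 - 1) (n - 1) v)) (by
        refine Eq.trans ?_ (map_add (rs K (inf_le_right : p.P ⊓ B ≤ B)) _ _).symm
        rw [map_sub, ← dd_rs, hv, rs_rs, rs_rs, sub_self, add_zero, ← ht']
        exact rs_rs K _ _ _)
    have hBO : B ≤ O := hbox.trans hV'
    refine hnot (hmax ⟨p.P ⊔ B, sup_le p.le hBO, p.ge.trans le_sup_left, ?_, t, ?_, ?_⟩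
      ⟨le_sup_left, htP⟩ (Or.inr ?_))
    · rintro w' r' (h | h) x hx
      · exact Or.inl (p.star w' r' h x hx)
      · exact Or.inr (hstarB w' r' h x hx)
    · refine rs_ext K _ _ fun x hx => ?_
      rcases hx with hx | hx
      · refine ⟨p.P, le_sup_left, hx, ?_⟩
        rw [← dd_rs, rs_rs]
        exact (congrArg (dd K (n - 1) n) htP).trans p.eq
      · refine ⟨B, le_sup_right, hx, ?_⟩
        rw [← dd_rs, rs_rs]
        refine (congrArg (dd K (n - 1) n) htB).trans ?_
        rw [map_add, map_sub, dd_dd, sub_zero, dd_rs, dd_rs, ht'', rs_rs, map_sub]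
        abel
    · rw [← rs_rs K p.ge le_sup_left]
      exact (congrArg (rs K p.ge) htP).trans p.zero
    · exact (mem_boxOpens _ _ _ _ _).2 ⟨hwD, mem_iooOpens.2 ⟨by linarith, by linarith⟩⟩

end Star

/-! ### Restriction from a full line to a half-line or an interval -/

section Boxes

variable {k : Type u} [Field k] {X : TopCat.{u}} {K : CochainComplex (Sh k X) ℤ}
  {A : Type u} [TopologicalSpace A]

theorem LocConstAlong.comp {n : ℤ} {p : ℝ → X} (h : LocConstAlong K n p) {φ : ℝ → ℝ}
    (hφ : Continuous φ) : LocConstAlong K n fun r => p (φ r) := by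
  intro b
  obtain ⟨N, hN, M, g, hg, hM⟩ := h (φ b)
  refine ⟨φ ⁻¹' N, hφ.continuousAt hN, M, fun m r => g m (φ r), fun r hr => hg _ hr,
    fun m r hr => ?_⟩
  obtain ⟨V, z, hz, hV, hev⟩ := hM m (φ r) hr
  exact ⟨V, z, hz, hV, hφ.continuousAt.eventually hev⟩

/-- Reversal of the second coordinate. -/
def negSnd (e : A × ℝ ≃ₜ X) : A × ℝ ≃ₜ X :=
  ((Homeomorph.refl A).prodCongr (Homeomorph.neg ℝ)).trans e

theorem negSnd_apply (e : A × ℝ ≃ₜ X) (w : A) (r : ℝ) : negSnd e (w, r) = e (w, -r) := rfl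

variable [T2Space X] (e : A × ℝ ≃ₜ X) (hK : Flasque K) {n₀ : ℤ}
    (hn₀ : ∀ n < n₀, ∀ V, Subsingleton (Sec K n V))
    (hlc : ∀ n w, LocConstAlong K n fun r => e (w, r))

include hK hn₀ hlc

theorem good_boxOpens_ioi (D : Opens A) (a : ℝ) (n : ℤ) :
    Good K n (boxOpens e D (ioiOpens a)) (boxOpens e D ⊤) := by
  -- Reversing the line makes the half-line the lower part. Any base level below `-a` would do:
  -- reversed parameters at most `-a - 1` lie in the half-line. The number of steps is chosen so
  -- that `n < n₀ + m`.
  refine good_of_isStarAbove (negSnd e) hK hn₀ (fun n w => (hlc n w).comp continuous_neg) (-a - 1)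
    (n - n₀ + 1).toNat n (by omega) _ _ ((opens_le_iff e).2 fun w r h => ?_) ?_ ?_ ?_
  · rw [mem_boxOpens] at h ⊢
    exact ⟨h.1, trivial⟩
  · intro w r h r' hr'
    rw [negSnd_apply, mem_boxOpens, mem_ioiOpens] at h ⊢
    exact ⟨h.1, by linarith [hr'.2]⟩
  · intro w r h r' hr'
    rw [negSnd_apply, mem_boxOpens] at h ⊢
    exact ⟨h.1, trivial⟩
  · intro w r hr h
    rw [negSnd_apply, mem_boxOpens] at h ⊢
    exact ⟨h.1, mem_ioiOpens.2 (by linarith)⟩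

/-- The interval is first enlarged upwards to `(a, ∞)`, star-shaped above the midpoint, and then
downwards to the whole line. -/
theorem good_boxOpens_ioo (D : Opens A) {a b : ℝ} (hab : a < b) (n : ℤ) :
    Good K n (boxOpens e D (iooOpens a b)) (boxOpens e D ⊤) := by
  refine Good.trans hK ?_ (good_boxOpens_ioi e hK hn₀ hlc D a n)
  refine good_of_isStarAbove e hK hn₀ hlc ((a + b) / 2)
    (n - n₀ + 1).toNat n (by omega) _ _ ((opens_le_iff e).2 fun w r h => ?_) ?_ ?_ ?_
  · rw [mem_boxOpens] at h ⊢
    exact ⟨h.1, h.2.1⟩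
  · intro w r h r' hr'
    rw [mem_boxOpens, mem_iooOpens] at h ⊢
    exact ⟨h.1, by linarith [hr'.1], by linarith [hr'.2]⟩
  · intro w r h r' hr'
    rw [mem_boxOpens, mem_ioiOpens] at h ⊢
    exact ⟨h.1, by linarith [hr'.1]⟩
  · intro w r hr h
    rw [mem_boxOpens, mem_ioiOpens] at h
    rw [mem_boxOpens, mem_iooOpens]
    exact ⟨h.1, h.2, by linarith⟩

end Boxes

/-! ### Exactness of sequences of sheaves in terms of local sections -/

section Local

variable {k : Type u} [Field k] {X : TopCat.{u}}

/-- The functor of sections over an open set. -/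
abbrev sectionsFunctor (V : Opens X) : Sh k X ⥤ ModuleCat.{u} k :=
  TopCat.Sheaf.forget _ _ ⋙ (evaluation _ _).obj (op V)

instance (V : Opens X) : PreservesFiniteLimits (sectionsFunctor (k := k) V) := by
  have : PreservesFiniteLimits (TopCat.Sheaf.forget (ModuleCat.{u} k) X) :=
    inferInstanceAs (PreservesFiniteLimits (sheafToPresheaf _ _))
  have : PreservesFiniteLimits
      ((evaluation (Opens X)ᵒᵖ (ModuleCat.{u} k)).obj (op V)) := inferInstance
  exact comp_preservesFiniteLimits _ _

instance (V : Opens X) : (sectionsFunctor (k := k) V).Additive where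
  map_add := rfl

theorem shMap_injective {F G : Sh k X} (f : F ⟶ G) [Mono f] (V : Opens X) :
    Function.Injective (shMap f V) :=
  (ModuleCat.mono_iff_injective ((sectionsFunctor V).map f)).1 inferInstance

theorem exists_shMap_eq_of_epi {F G : Sh k X} (f : F ⟶ G) [Epi f] {V : Opens X}
    (s : (G.1.obj (op V) : ModuleCat.{u} k)) {x : X} (hx : x ∈ V) :
    ∃ (W : Opens X) (h : W ≤ V) (t : (F.1.obj (op W) : ModuleCat.{u} k)), x ∈ W ∧
      shMap f W t = shRes G h s := by
  obtain ⟨W, h, ⟨t, ht⟩, hxW⟩ := (TopCat.Presheaf.isLocallySurjective_iff f.1).1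
    ((TopCat.Sheaf.isLocallySurjective_iff_epi f).2 inferInstance) V s x hx
  exact ⟨W, h, t, hxW, ht⟩

theorem exists_shMap_eq_of_exact_of_mono {S : ShortComplex (Sh k X)} (hS : S.Exact) [Mono S.f]
    {V : Opens X} (s : (S.X₂.1.obj (op V) : ModuleCat.{u} k)) (hs : shMap S.g V s = 0) :
    ∃ t, shMap S.f V t = s :=
  (ShortComplex.moduleCat_exact_iff _).1
    (hS.map_of_mono_of_preservesKernel (sectionsFunctor V) inferInstance inferInstance) s hs

/-- A section killed by `S.g` comes from a section of the cycles over the whole of `V`, by left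
exactness. Lifting it along the epimorphism `S.toCycles` is possible only after shrinking. -/
theorem exists_shMap_eq_of_exact {S : ShortComplex (Sh k X)} (hS : S.Exact)
    {V : Opens X} (s : (S.X₂.1.obj (op V) : ModuleCat.{u} k)) (hs : shMap S.g V s = 0) {x : X}
    (hx : x ∈ V) : ∃ (W : Opens X) (h : W ≤ V) (t : (S.X₁.1.obj (op W) : ModuleCat.{u} k)), x ∈ W ∧
      shMap S.f W t = shRes S.X₂ h s := by
  have hS' : (ShortComplex.mk S.iCycles S.g S.iCycles_g).Exact :=
    ShortComplex.exact_of_f_is_kernel _ S.cyclesIsKernel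
  obtain ⟨c, hc⟩ := exists_shMap_eq_of_exact_of_mono hS' s hs
  have := hS.epi_toCycles
  obtain ⟨W, h, t, hxW, ht⟩ := exists_shMap_eq_of_epi S.toCycles c hx
  refine ⟨W, h, t, hxW, ?_⟩
  rw [← S.toCycles_i, shMap_comp, ht, shMap_shRes]
  exact congrArg _ hc

theorem isIso_of_locally {F G : Sh k X} (f : F ⟶ G)
    (hinj : ∀ (V : Opens X) (s : (F.1.obj (op V) : ModuleCat.{u} k)), shMap f V s = 0 →
      ∀ x ∈ V, ∃ (W : Opens X) (h : W ≤ V), x ∈ W ∧ shRes F h s = 0)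
    (hsurj : ∀ (V : Opens X) (s : (G.1.obj (op V) : ModuleCat.{u} k)), ∀ x ∈ V,
      ∃ (W : Opens X) (h : W ≤ V) (t : (F.1.obj (op W) : ModuleCat.{u} k)), x ∈ W ∧
        shMap f W t = shRes G h s) : IsIso f := by
  have : Epi f := (TopCat.Sheaf.isLocallySurjective_iff_epi f).1
    ((TopCat.Presheaf.isLocallySurjective_iff f.1).2 fun V s x hx => by
      obtain ⟨W, h, t, hxW, ht⟩ := hsurj V s x hx
      exact ⟨W, h, ⟨t, ht⟩, hxW⟩)
  have : ∀ V, Mono (f.1.app V) := fun V => (ModuleCat.mono_iff_injective _).2 <|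
    (injective_iff_map_eq_zero (shMap f V.unop)).2 fun s hs => shRes_ext F _ _ fun x hx => by
      obtain ⟨W, h, hxW, h0⟩ := hinj _ s hs x hx
      exact ⟨W, h, hxW, by rw [h0, map_zero]⟩
  have : Mono f.1 := NatTrans.mono_of_mono_app _
  have : Mono f := (TopCat.Sheaf.forget _ _).mono_of_mono_map this
  exact isIso_of_mono_of_epi f

end Local

/-! ### Cohomology sheaves and germs of cocycles; a criterion for quasi-isomorphisms -/

section CohomologySheaf

variable {k : Type u} [Field k] {X : TopCat.{u}} {K L : CochainComplex (Sh k X) ℤ}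

theorem exists_cycle {n : ℤ} {V : Opens X} {z : Sec K n V} (hz : IsCocycle z) :
    ∃ c, shMap (K.iCycles n) V c = z := by
  have hS' : (ShortComplex.mk (K.iCycles n) (K.d n (n + 1)) (by simp)).Exact :=
    ShortComplex.exact_of_f_is_kernel _ (K.cyclesIsKernel n (n + 1) (by simp))
  exact exists_shMap_eq_of_exact_of_mono hS' z (hz _)

/-- The section of the cohomology sheaf defined by a cocycle. -/
def hcl {n : ℤ} {V : Opens X} (z : Sec K n V) (hz : IsCocycle z) :
    ((K.homology n).1.obj (op V) : ModuleCat.{u} k) :=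
  shMap (K.homologyπ n) V (exists_cycle hz).choose

theorem hcl_eq {n : ℤ} {V : Opens X} {z : Sec K n V} (hz : IsCocycle z)
    (c : ((K.cycles n).1.obj (op V) : ModuleCat.{u} k)) (hc : shMap (K.iCycles n) V c = z) :
    hcl z hz = shMap (K.homologyπ n) V c :=
  congrArg _ (shMap_injective (K.iCycles n) V ((exists_cycle hz).choose_spec.trans hc.symm))

theorem hcl_rs {n : ℤ} {U V : Opens X} (h : U ≤ V) {z : Sec K n V} (hz : IsCocycle z) :
    hcl (rs K h z) (hz.rs h) = shRes _ h (hcl z hz) := by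
  obtain ⟨c, hc⟩ := exists_cycle hz
  rw [hcl_eq hz c hc, ← shMap_shRes]
  refine hcl_eq _ _ ?_
  rw [shMap_shRes, hc]
  rfl

theorem hcl_sub {n : ℤ} {V : Opens X} {z z' : Sec K n V} (hz : IsCocycle z)
    (hz' : IsCocycle z') : hcl (z - z') (hz.sub hz') = hcl z hz - hcl z' hz' := by
  obtain ⟨c, hc⟩ := exists_cycle hz
  obtain ⟨c', hc'⟩ := exists_cycle hz'
  rw [hcl_eq hz c hc, hcl_eq hz' c' hc', ← map_sub]
  exact hcl_eq _ _ (by rw [map_sub, hc, hc'])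

theorem hcl_mp (f : K ⟶ L) {n : ℤ} {V : Opens X} {z : Sec K n V} (hz : IsCocycle z) :
    hcl (mp f z) (hz.mp f) = shMap (HomologicalComplex.homologyMap f n) V (hcl z hz) := by
  obtain ⟨c, hc⟩ := exists_cycle hz
  rw [hcl_eq hz c hc, ← shMap_comp, HomologicalComplex.homologyπ_naturality, shMap_comp]
  refine hcl_eq _ _ ?_
  rw [← shMap_comp, HomologicalComplex.cyclesMap_i, shMap_comp, hc]
  rfl

theorem hcl_dd {n : ℤ} {V : Opens X} (t : Sec K (n - 1) V) :
    hcl (dd K (n - 1) n t) (isCocycle_dd K t) = 0 := by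
  rw [hcl_eq _ (shMap (K.toCycles (n - 1) n) V t), ← shMap_comp,
    HomologicalComplex.toCycles_comp_homologyπ, shMap_zero]
  rw [← shMap_comp, HomologicalComplex.toCycles_i]
  rfl

theorem exists_dd_of_hcl_eq_zero {n : ℤ} {V : Opens X} {z : Sec K n V} (hz : IsCocycle z)
    (h : hcl z hz = 0) {x : X} (hx : x ∈ V) :
    ∃ (W : Opens X) (h : W ≤ V), x ∈ W ∧ ∃ t : Sec K (n - 1) W, dd K (n - 1) n t = rs K h z := by
  obtain ⟨c, hc⟩ := exists_cycle hz
  rw [hcl_eq hz c hc] at h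
  have hS : (ShortComplex.mk (K.toCycles (n - 1) n) (K.homologyπ n) (by simp)).Exact :=
    ShortComplex.exact_of_g_is_cokernel _ (K.homologyIsCokernel (n - 1) n (by simp))
  obtain ⟨W, hW, t, hxW, ht⟩ := exists_shMap_eq_of_exact hS c h hx
  refine ⟨W, hW, hxW, t, ?_⟩
  rw [dd, ← K.toCycles_i, shMap_comp, ht, shMap_shRes]
  exact congrArg _ hc

theorem exists_hcl_eq {n : ℤ} {V : Opens X} (s : ((K.homology n).1.obj (op V) : ModuleCat.{u} k))
    {x : X} (hx : x ∈ V) : ∃ (W : Opens X) (h : W ≤ V) (z : Sec K n W) (hz : IsCocycle z),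
      x ∈ W ∧ hcl z hz = shRes _ h s := by
  obtain ⟨W, h, c, hxW, hc⟩ := exists_shMap_eq_of_epi (K.homologyπ n) s hx
  have hz : IsCocycle (n := n) (V := W) (shMap (K.iCycles n) W c) := fun j => by
    rw [dd, ← shMap_comp, HomologicalComplex.iCycles_d, shMap_zero]
  exact ⟨W, h, _, hz, hxW, (hcl_eq hz c rfl).trans hc⟩

/-- Sections of the cohomology sheaf vanish exactly when they are locally given by coboundaries.
This identifies `StalkCoh` with germs of the cohomology sheaf. -/
theorem cohomologousAt_iff_hcl {n : ℤ} {x : X} {V V' : Opens X} {z : Sec K n V} {z' : Sec K n V'}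
    (hz : IsCocycle z) (hz' : IsCocycle z') :
    CohomologousAt K x z z' ↔ ∃ (W : Opens X) (h : W ≤ V) (h' : W ≤ V'), x ∈ W ∧
      shRes _ h (hcl z hz) = shRes _ h' (hcl z' hz') := by
  constructor
  · rintro ⟨W, h, h', hxW, t, ht⟩
    refine ⟨W, h, h', hxW, ?_⟩
    rw [← hcl_rs, ← hcl_rs, ← sub_eq_zero, ← hcl_sub, ← hcl_dd t]
    congr 1
    exact ht.symm
  · rintro ⟨W, h, h', hxW, he⟩
    rw [← hcl_rs h hz, ← hcl_rs h' hz', ← sub_eq_zero, ← hcl_sub] at he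
    obtain ⟨W', hW', hxW', t, ht⟩ := exists_dd_of_hcl_eq_zero _ he hxW
    refine ⟨W', hW'.trans h, hW'.trans h', hxW', t, ?_⟩
    rw [ht, map_sub, rs_rs, rs_rs]

/-- The map on stalk cohomology induced by a morphism of complexes. -/
def stalkMap (f : K ⟶ L) (n : ℤ) (x : X) : StalkCoh K n x → StalkCoh L n x :=
  Quotient.lift (fun g => cls x g.mem (mp f g.z) (g.isCocycle.mp f)) fun g g' h => by
    obtain ⟨W, h, h', hx, t, ht⟩ := h
    exact cls_eq_iff.2 ⟨W, h, h', hx, mp f t, by rw [← mp_dd, ht, map_sub, mp_rs, mp_rs]⟩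

theorem stalkMap_cls (f : K ⟶ L) {n : ℤ} {x : X} {V : Opens X} (hx : x ∈ V) {z : Sec K n V}
    (hz : IsCocycle z) : stalkMap f n x (cls x hx z hz) = cls x hx (mp f z) (hz.mp f) := rfl

theorem cls_eq_cls_zero_iff {n : ℤ} {x : X} {V V' : Opens X} {hx : x ∈ V} {hx' : x ∈ V'}
    {z : Sec K n V} {hz : IsCocycle z} :
    cls x hx z hz = cls x hx' 0 (isCocycle_zero K) ↔
      ∃ (W : Opens X) (h : W ≤ V), x ∈ W ∧ ∃ t : Sec K (n - 1) W,
        dd K (n - 1) n t = rs K h z := by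
  rw [cls_eq_iff]
  constructor
  · rintro ⟨W, h, h', hxW, t, ht⟩
    exact ⟨W, h, hxW, t, by rw [ht, map_zero, sub_zero]⟩
  · rintro ⟨W, h, hxW, t, ht⟩
    exact ⟨W ⊓ V', inf_le_left.trans h, inf_le_right, ⟨hxW, hx'⟩, rs K inf_le_left t, by
      rw [dd_rs, ht, map_zero, sub_zero, rs_rs]⟩

/-- Every local section of a cohomology sheaf is locally the class of a cocycle, so injectivity and
surjectivity of the maps on cohomology sheaves can be tested on germs of cocycles. -/
theorem quasiIso_iff_stalkMap (f : K ⟶ L) :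
    QuasiIso f ↔ ∀ n x, Function.Bijective (stalkMap f n x) := by
  have hh : QuasiIso f ↔ ∀ n, IsIso (HomologicalComplex.homologyMap f n) := by
    rw [quasiIso_iff]
    exact forall_congr' fun n => quasiIsoAt_iff_isIso_homologyMap f n
  rw [hh]
  refine forall_congr' fun n => ⟨fun hn x => ⟨?_, ?_⟩, fun hn => isIso_of_locally _ ?_ ?_⟩
  · intro c c' h
    obtain ⟨V, hx, z, hz, rfl⟩ := exists_cls c
    obtain ⟨V', hx', z', hz', rfl⟩ := exists_cls c'
    rw [stalkMap_cls, stalkMap_cls, cls_eq_iff,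
      cohomologousAt_iff_hcl (hz.mp f) (hz'.mp f)] at h
    obtain ⟨W, h, h', hxW, he⟩ := h
    rw [cls_eq_iff, cohomologousAt_iff_hcl hz hz']
    refine ⟨W, h, h', hxW, shMap_injective (HomologicalComplex.homologyMap f n) W ?_⟩
    rw [shMap_shRes, shMap_shRes, ← hcl_mp, ← hcl_mp, he]
  · intro c
    obtain ⟨V, hx, z, hz, rfl⟩ := exists_cls c
    obtain ⟨W, h, t, hxW, ht⟩ :=
      exists_shMap_eq_of_epi (HomologicalComplex.homologyMap f n) (hcl z hz) hx
    obtain ⟨W', h', z', hz', hxW', he⟩ := exists_hcl_eq t hxW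
    refine ⟨cls x hxW' z' hz', ?_⟩
    rw [stalkMap_cls, cls_eq_iff, cohomologousAt_iff_hcl (hz'.mp f) hz]
    refine ⟨W', le_rfl, h'.trans h, hxW', ?_⟩
    rw [shRes_self, hcl_mp f hz', he, shMap_shRes, ht, shRes_shRes]
  · intro V s hs x hx
    obtain ⟨W, h, z, hz, hxW, he⟩ := exists_hcl_eq s hx
    have h0 : hcl (mp f z) (hz.mp f) = 0 := by
      rw [hcl_mp f hz, he, shMap_shRes, hs, map_zero]
    have hc : stalkMap f n x (cls x hxW z hz) =
        stalkMap f n x (cls x hxW 0 (isCocycle_zero K)) := by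
      rw [stalkMap_cls, stalkMap_cls, cls_eq_iff,
        cohomologousAt_iff_hcl (hz.mp f) ((isCocycle_zero K).mp f)]
      refine ⟨W, le_rfl, le_rfl, hxW, ?_⟩
      rw [h0, hcl_mp f (isCocycle_zero K), hcl_eq (isCocycle_zero K) 0 (map_zero _)]
      simp only [map_zero]
    obtain ⟨W', h', hxW', t, ht⟩ := cls_eq_cls_zero_iff.1 ((hn x).1 hc)
    refine ⟨W', h'.trans h, hxW', ?_⟩
    rw [← shRes_shRes _ h' h, ← he, ← hcl_rs, ← hcl_dd t]
    congr 1
    exact ht.symm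
  · intro V s x hx
    obtain ⟨W, h, z, hz, hxW, he⟩ := exists_hcl_eq s hx
    obtain ⟨c, hc⟩ := (hn x).2 (cls x hxW z hz)
    obtain ⟨W', hxW', z', hz', rfl⟩ := exists_cls c
    rw [stalkMap_cls, cls_eq_iff, cohomologousAt_iff_hcl (hz'.mp f) hz] at hc
    obtain ⟨W'', h₁, h₂, hx'', heq⟩ := hc
    refine ⟨W'', h₂.trans h, shRes _ h₁ (hcl z' hz'), hx'', ?_⟩
    rw [shMap_shRes, ← hcl_mp f hz', heq, he, shRes_shRes]

end CohomologySheaf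

/-! ### Local description of the sections of an inverse image sheaf -/

section InverseImage

variable {k : Type u} [Field k] {X Y : TopCat.{u}} (f : X ⟶ Y) (A : Sh k Y)

/-- The presheaf inverse image. -/
def prePullback : X.Presheaf (ModuleCat.{u} k) := (TopCat.Presheaf.pullback _ f).obj A.1

/-- The sheaf associated with the presheaf inverse image. -/
def sheafifiedPullback : Sh k X := (presheafToSheaf _ _).obj (prePullback f A)

/-- Comparison of the inverse image with the sheafification of the presheaf inverse image. -/
def pullbackComparison : (TopCat.Sheaf.pullback _ f).obj A ≅ sheafifiedPullback f A :=
  (TopCat.Sheaf.pullbackIso (ModuleCat.{u} k) f).app A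

/-- The restriction maps of the presheaf inverse image. -/
def preRes {U V : Opens X} (h : U ≤ V) :
    ((prePullback f A).obj (op V) : ModuleCat.{u} k) →ₗ[k]
      ((prePullback f A).obj (op U) : ModuleCat.{u} k) :=
  ((prePullback f A).map (homOfLE h).op).hom

/-- The sheafification map on the sections of the presheaf inverse image. -/
def preToSheaf (V : Opens X) : ((prePullback f A).obj (op V) : ModuleCat.{u} k) →ₗ[k]
    ((sheafifiedPullback f A).1.obj (op V) : ModuleCat.{u} k) :=
  ((toSheafify (Opens.grothendieckTopology X) (prePullback f A)).app (op V)).hom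

theorem preToSheaf_preRes {U V : Opens X} (h : U ≤ V)
    (p : ((prePullback f A).obj (op V) : ModuleCat.{u} k)) :
    preToSheaf f A U (preRes f A h p) = shRes _ h (preToSheaf f A V p) :=
  congrArg (fun g => g p)
    ((toSheafify (Opens.grothendieckTopology X) (prePullback f A)).naturality (homOfLE h).op)

/-- The unit of the adjunction between presheaves, on sections. -/
def preUnit (V : Opens Y) : (A.1.obj (op V) : ModuleCat.{u} k) →ₗ[k]
    ((prePullback f A).obj (op ((Opens.map f).obj V)) : ModuleCat.{u} k) :=
  (((TopCat.Presheaf.pullbackPushforwardAdjunction _ f).unit.app A.1).app (op V)).hom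

/-- The adjunction unit on sections. -/
def pbSec (V : Opens Y) : (A.1.obj (op V) : ModuleCat.{u} k) →ₗ[k]
    (((TopCat.Sheaf.pullback _ f).obj A).1.obj (op ((Opens.map f).obj V)) : ModuleCat.{u} k) :=
  shMap ((TopCat.Sheaf.pullbackPushforwardAdjunction (ModuleCat.{u} k) f).unit.app A) V

theorem sheafAdjunctionContinuous_unit_app :
    ((Functor.sheafPullbackConstruction.sheafAdjunctionContinuous (Opens.map f)
      (ModuleCat.{u} k) (Opens.grothendieckTopology Y) (Opens.grothendieckTopology X)).unit.app
        A).1 = (((Opens.map f).op.lanAdjunction _).comp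
        (sheafificationAdjunction (Opens.grothendieckTopology X) (ModuleCat.{u} k))).unit.app A.1 := by
  have := Adjunction.map_restrictFullyFaithful_unit_app
      (L := Functor.sheafPullbackConstruction.sheafPullback (Opens.map f)
        (ModuleCat.{u} k) (Opens.grothendieckTopology Y) (Opens.grothendieckTopology X))
      (R := (Opens.map f).sheafPushforwardContinuous (ModuleCat.{u} k)
        (Opens.grothendieckTopology Y) (Opens.grothendieckTopology X))
      (((Opens.map f).op.lanAdjunction _).comp
        (sheafificationAdjunction (Opens.grothendieckTopology X) (ModuleCat.{u} k)))
      (fullyFaithfulSheafToPresheaf (Opens.grothendieckTopology Y) (ModuleCat.{u} k))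
      (Functor.FullyFaithful.id _)
      (Iso.refl _) (Iso.refl _) A
  refine Eq.trans this ?_
  simp
  rfl

/-- Uniqueness of left adjoints is compatible with the units. This transports the abstract unit of
`f⁻¹` to the explicit one of the sheafified presheaf inverse image, where stalks are computable. -/
theorem pullbackComparison_pbSec (V : Opens Y) (v : (A.1.obj (op V) : ModuleCat.{u} k)) :
    shMap (pullbackComparison f A).hom _ (pbSec f A V v) =
      preToSheaf f A _ (preUnit f A V v) := by
  have h := Adjunction.unit_leftAdjointUniq_hom_app
    ((Opens.map f).sheafAdjunctionContinuous (ModuleCat.{u} k) (Opens.grothendieckTopology Y)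
      (Opens.grothendieckTopology X))
    (Functor.sheafPullbackConstruction.sheafAdjunctionContinuous (Opens.map f) (ModuleCat.{u} k)
      (Opens.grothendieckTopology Y) (Opens.grothendieckTopology X)) A
  refine (congrArg (fun g => g.1.app (op V) v) h).trans
    ((congrArg (fun g => g.app (op V) v) (sheafAdjunctionContinuous_unit_app f A)).trans ?_)
  rw [Adjunction.comp_unit_app]
  rfl

theorem pbSec_shRes {U V : Opens Y} (h : U ≤ V) (v : (A.1.obj (op V) : ModuleCat.{u} k)) :
    pbSec f A U (shRes A h v) =
      shRes _ (show (Opens.map f).obj U ≤ (Opens.map f).obj V from fun _ hx => h hx)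
        (pbSec f A V v) := shMap_shRes _ h v

theorem pbSec_shMap {A B : Sh k Y} (g : A ⟶ B) {V : Opens Y}
    (v : (A.1.obj (op V) : ModuleCat.{u} k)) :
    pbSec f B V (shMap g V v) =
      shMap ((TopCat.Sheaf.pullback _ f).map g) _ (pbSec f A V v) := by
  have := (TopCat.Sheaf.pullbackPushforwardAdjunction (ModuleCat.{u} k) f).unit.naturality g
  exact congrArg (fun g => g.1.app (op V) v) this

theorem stalkPullbackHom_germ {V : Opens Y} {x : X} (hx : f x ∈ V)
    (v : (A.1.obj (op V) : ModuleCat.{u} k)) :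
    TopCat.Presheaf.stalkPullbackHom _ f A.1 x (TopCat.Presheaf.germ A.1 V (f x) hx v) =
      TopCat.Presheaf.germ (prePullback f A) ((Opens.map f).obj V) x hx (preUnit f A V v) :=
  congrArg (fun g => g v) (TopCat.Presheaf.germ_stalkPullbackHom (ModuleCat.{u} k) f A.1 x V hx)

variable {f A}

/-- After shrinking, a section comes from the presheaf inverse image, and its germ at `x` is a germ
of `A` at `f x`, by the stalk isomorphism for presheaf inverse images. -/
theorem exists_pbSec_eq {U : Opens X}
    (s : (((TopCat.Sheaf.pullback _ f).obj A).1.obj (op U) : ModuleCat.{u} k)) {x : X}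
    (hx : x ∈ U) : ∃ (V : Opens Y) (W : Opens X) (h : W ≤ U) (h' : W ≤ (Opens.map f).obj V)
      (v : (A.1.obj (op V) : ModuleCat.{u} k)), x ∈ W ∧ shRes _ h s = shRes _ h' (pbSec f A V v) := by
  obtain ⟨W₁, h₁, ⟨p, hp⟩, hx₁⟩ := (TopCat.Presheaf.isLocallySurjective_iff _).1
    (Presheaf.isLocallySurjective_toSheafify' (Opens.grothendieckTopology X) (prePullback f A)) U
    (shMap (pullbackComparison f A).hom U s) x hx
  replace hp : preToSheaf f A W₁ p =
    shRes _ h₁ (shMap (pullbackComparison f A).hom U s) := hp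
  obtain ⟨g, hg⟩ : ∃ g, TopCat.Presheaf.stalkPullbackHom _ f A.1 x g =
      TopCat.Presheaf.germ (prePullback f A) W₁ x hx₁ p :=
    ⟨TopCat.Presheaf.stalkPullbackInv _ f A.1 x
      (TopCat.Presheaf.germ (prePullback f A) W₁ x hx₁ p),
      congrArg (fun g => g (TopCat.Presheaf.germ (prePullback f A) W₁ x hx₁ p))
        (TopCat.Presheaf.stalkPullbackIso _ f A.1 x).inv_hom_id⟩
  obtain ⟨V, hV, v, rfl⟩ := TopCat.Presheaf.exists_germ_eq A.1 g
  rw [stalkPullbackHom_germ] at hg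
  obtain ⟨W, hxW, i, i', hW⟩ := TopCat.Presheaf.germ_eq (prePullback f A) x hV hx₁ _ _ hg
  replace hW : preRes f A i.le (preUnit f A V v) = preRes f A i'.le p := hW
  refine ⟨V, W, i'.le.trans h₁, i.le, v, hxW,
    shMap_injective (pullbackComparison f A).hom W ?_⟩
  rw [shMap_shRes _ i.le, pullbackComparison_pbSec, ← preToSheaf_preRes, hW, preToSheaf_preRes, hp,
    shRes_shRes, shMap_shRes]

/-- Sheafification is locally injective, so the presheaf section already vanishes near `x`; the
stalk isomorphism then kills the germ of `v` at `f x`. -/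
theorem exists_eq_zero_of_pbSec {V : Opens Y} {v : (A.1.obj (op V) : ModuleCat.{u} k)} {W : Opens X}
    (h : W ≤ (Opens.map f).obj V) (hv : shRes _ h (pbSec f A V v) = 0) {x : X} (hx : x ∈ W) :
    ∃ (V' : Opens Y) (h : V' ≤ V), f x ∈ V' ∧ shRes A h v = 0 := by
  have e₁ : preToSheaf f A W (preRes f A h (preUnit f A V v)) = preToSheaf f A W 0 := by
    rw [preToSheaf_preRes, ← pullbackComparison_pbSec, ← shMap_shRes, hv, map_zero, map_zero]
  have := Presheaf.isLocallyInjective_toSheafify' (Opens.grothendieckTopology X) (prePullback f A)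
  obtain ⟨W', i, hi, hxW'⟩ := Presheaf.equalizerSieve_mem (Opens.grothendieckTopology X)
    (toSheafify (Opens.grothendieckTopology X) (prePullback f A)) _ _ e₁ x hx
  replace hi : preRes f A i.le (preRes f A h (preUnit f A V v)) = preRes f A i.le 0 := hi
  have hgerm : TopCat.Presheaf.stalkPullbackHom _ f A.1 x
      (TopCat.Presheaf.germ A.1 V (f x) (h hx) v) = 0 := by
    refine (stalkPullbackHom_germ f A (h hx) v).trans ?_
    have h3 := congrArg (TopCat.Presheaf.germ (prePullback f A) W' x hxW') hi
    rw [map_zero, map_zero] at h3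
    refine Eq.trans ?_ h3
    exact ((TopCat.Presheaf.germ_res_apply _ _ _ _ _).trans
      (TopCat.Presheaf.germ_res_apply (prePullback f A) (homOfLE h) x (i.le hxW') _)).symm
  have hgerm' : TopCat.Presheaf.germ A.1 V (f x) (h hx) v = 0 := by
    have := congrArg (TopCat.Presheaf.stalkPullbackInv _ f A.1 x) hgerm
    rw [map_zero] at this
    refine Eq.trans ?_ this
    exact (congrArg (fun g => g (TopCat.Presheaf.germ A.1 V (f x) (h hx) v))
      (TopCat.Presheaf.stalkPullbackIso _ f A.1 x).hom_inv_id).symm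
  obtain ⟨V', hxV', i, i', hV'⟩ := TopCat.Presheaf.germ_eq A.1 (f x) (h hx) (h hx) v 0
    (hgerm'.trans (map_zero _).symm)
  exact ⟨V', i.le, hxV', hV'.trans (map_zero _)⟩

end InverseImage

/-! ### Stalk cohomology of inverse and direct images -/

section ComplexFunctors

variable {k : Type u} [Field k] {X Y Z : TopCat.{u}}

/-- The inverse image of a complex. -/
abbrev pbC (f : X ⟶ Y) (K : CochainComplex (Sh k Y) ℤ) : CochainComplex (Sh k X) ℤ :=
  ((TopCat.Sheaf.pullback (ModuleCat.{u} k) f).mapHomologicalComplex _).obj K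

/-- The direct image of a complex. -/
abbrev pfC (f : X ⟶ Y) (K : CochainComplex (Sh k X) ℤ) : CochainComplex (Sh k Y) ℤ :=
  ((TopCat.Sheaf.pushforward (ModuleCat.{u} k) f).mapHomologicalComplex _).obj K

/-- The inverse image of a section. -/
def pbs (f : X ⟶ Y) (K : CochainComplex (Sh k Y) ℤ) {n : ℤ} {V : Opens Y} :
    Sec K n V →ₗ[k] Sec (pbC f K) n ((Opens.map f).obj V) := pbSec f (K.X n) V

theorem map_le (f : X ⟶ Y) {U V : Opens Y} (h : U ≤ V) :
    (Opens.map f).obj U ≤ (Opens.map f).obj V := fun _ hx => h hx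

variable (f : X ⟶ Y) {K : CochainComplex (Sh k Y) ℤ}

theorem pbs_rs {n : ℤ} {U V : Opens Y} (h : U ≤ V) (s : Sec K n V) :
    pbs f K (rs K h s) = rs (pbC f K) (map_le f h) (pbs f K s) := pbSec_shRes f _ h s

theorem pbs_dd {i j : ℤ} {V : Opens Y} (s : Sec K i V) :
    pbs f K (dd K i j s) = dd (pbC f K) i j (pbs f K s) := pbSec_shMap f (K.d i j) s

variable {f} in
theorem IsCocycle.pbs {n : ℤ} {V : Opens Y} {z : Sec K n V} (hz : IsCocycle z) :
    IsCocycle (pbs f K z) := fun j => by rw [← pbs_dd, hz, map_zero]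

theorem exists_pbs_eq {n : ℤ} {U : Opens X} (s : Sec (pbC f K) n U) {x : X} (hx : x ∈ U) :
    ∃ (V : Opens Y) (W : Opens X) (h : W ≤ U) (h' : W ≤ (Opens.map f).obj V) (v : Sec K n V),
      x ∈ W ∧ rs _ h s = rs _ h' (pbs f K v) := exists_pbSec_eq s hx

theorem exists_eq_zero_of_pbs {n : ℤ} {V : Opens Y} {v : Sec K n V} {W : Opens X}
    (h : W ≤ (Opens.map f).obj V) (hv : rs _ h (pbs f K v) = 0) {x : X} (hx : x ∈ W) :
    ∃ (V' : Opens Y) (h : V' ≤ V), f x ∈ V' ∧ rs K h v = 0 :=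
  exists_eq_zero_of_pbSec (A := K.X n) h hv hx

/-- The map between stalk cohomologies given by the inverse image. -/
def stalkPb (K : CochainComplex (Sh k Y) ℤ) (n : ℤ) {x : X} {y : Y} (hxy : f x = y) :
    StalkCoh K n y → StalkCoh (pbC f K) n x :=
  Quotient.lift (fun g => cls x (V := (Opens.map f).obj g.V) (by subst hxy; exact g.mem)
    (pbs f K g.z) g.isCocycle.pbs) fun g g' h => by
    obtain ⟨W, h, h', hx, t, ht⟩ := h
    exact cls_eq_iff.2 ⟨(Opens.map f).obj W, map_le f h, map_le f h', by subst hxy; exact hx,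
      pbs f K t, by rw [← pbs_dd, ht, map_sub, pbs_rs, pbs_rs]⟩

theorem stalkPb_cls {n : ℤ} {x : X} {y : Y} (hxy : f x = y) {V : Opens Y} (hy : y ∈ V)
    {z : Sec K n V} (hz : IsCocycle z) : stalkPb f K n hxy (cls y hy z hz) =
      cls x (V := (Opens.map f).obj V) (by subst hxy; exact hy) (pbs f K z) hz.pbs := rfl

/-- Inverse images preserve stalks: cochains of `f⁻¹K` near `x` are inverse images of cochains near
`f x`, and relations between such cochains hold already near `f x`. -/
theorem stalkPb_bijective (n : ℤ) {x : X} {y : Y} (hxy : f x = y) :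
    Function.Bijective (stalkPb f K n hxy) := by
  subst hxy
  constructor
  · intro c c' h
    obtain ⟨V, hx, z, hz, rfl⟩ := exists_cls c
    obtain ⟨V', hx', z', hz', rfl⟩ := exists_cls c'
    rw [stalkPb_cls, stalkPb_cls, cls_eq_iff] at h
    obtain ⟨W, h, h', hxW, t, ht⟩ := h
    obtain ⟨V₁, W₁, h₁, h₁', v, hx₁, hv⟩ := exists_pbs_eq f t hxW
    have hle : W₁ ≤ (Opens.map f).obj (V₁ ⊓ V ⊓ V') :=
      fun w hw => ⟨⟨h₁' hw, h (h₁ hw)⟩, h' (h₁ hw)⟩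
    have hVV : V₁ ⊓ V ⊓ V' ≤ V := inf_le_left.trans inf_le_right
    have hV₁ : V₁ ⊓ V ⊓ V' ≤ V₁ := inf_le_left.trans inf_le_left
    have h0 : rs _ hle (pbs f K (dd K (n - 1) n (rs K hV₁ v) -
        (rs K hVV z - rs K (inf_le_right : V₁ ⊓ V ⊓ V' ≤ V') z'))) = 0 := by
      rw [map_sub, map_sub, map_sub, map_sub, pbs_dd, pbs_rs, pbs_rs, pbs_rs, rs_rs, rs_rs,
        ← dd_rs, rs_rs, ← hv, dd_rs, ht, map_sub, rs_rs, rs_rs, sub_self]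
    obtain ⟨V₂, h₂, hx₂, he⟩ := exists_eq_zero_of_pbs f hle h0 hx₁
    rw [cls_eq_iff]
    refine ⟨V₂, h₂.trans hVV, h₂.trans inf_le_right, hx₂, rs K (h₂.trans hV₁) v, ?_⟩
    rwa [map_sub, map_sub, ← dd_rs, rs_rs, rs_rs, rs_rs, sub_eq_zero] at he
  · intro c
    obtain ⟨U, hx, s, hs, rfl⟩ := exists_cls c
    obtain ⟨V, W, h, h', v, hxW, hv⟩ := exists_pbs_eq f s hx
    obtain ⟨V₁, h₁, hx₁, he⟩ := exists_eq_zero_of_pbs f (v := dd K n (n + 1) v) h' (by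
      rw [pbs_dd, ← dd_rs, ← hv, dd_rs, hs, map_zero]) hxW
    have hz : IsCocycle (rs K h₁ v) := (isCocycle_iff rfl).2 (by rw [dd_rs, he])
    refine ⟨cls (f x) hx₁ (rs K h₁ v) hz, ?_⟩
    rw [stalkPb_cls, cls_eq_iff]
    refine cohomologousAt_of_eq _ (W := W ⊓ (Opens.map f).obj V₁) inf_le_right
      (inf_le_left.trans h) ⟨hxW, hx₁⟩ ?_
    rw [pbs_rs, rs_rs, ← rs_rs _ inf_le_left h, hv, rs_rs]

/-- Restriction from the stalk cohomology of the direct image. -/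
def stalkPf (K : CochainComplex (Sh k X) ℤ) (n : ℤ) {x : X} {y : Y} (hxy : f x = y) :
    StalkCoh (pfC f K) n y → StalkCoh K n x :=
  Quotient.lift (fun g => cls (K := K) x (V := (Opens.map f).obj g.V)
    (by subst hxy; exact g.mem) g.z g.isCocycle) fun g g' h => by
    obtain ⟨W, h, h', hx, t, ht⟩ := h
    exact cls_eq_iff.2 ⟨(Opens.map f).obj W, map_le f h, map_le f h', by subst hxy; exact hx,
      t, ht⟩

theorem stalkPf_cls {K : CochainComplex (Sh k X) ℤ} {n : ℤ} {x : X} {y : Y} (hxy : f x = y)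
    {V : Opens Y} (hy : y ∈ V) {z : Sec (pfC f K) n V} (hz : IsCocycle z) :
    stalkPf f K n hxy (cls y hy z hz) =
      cls (K := K) x (V := (Opens.map f).obj V) (by subst hxy; exact hy) z hz := rfl

theorem Flasque.pfC {K : CochainComplex (Sh k X) ℤ} (hK : Flasque K) : Flasque (pfC f K) :=
  fun n _ _ h => hK n _ _ (map_le f h)

theorem Good.pfC {K : CochainComplex (Sh k X) ℤ} {n : ℤ} {U V : Opens Y} (h : U ≤ V)
    (hg : Good K n ((Opens.map f).obj U) ((Opens.map f).obj V)) : Good (pfC f K) n U V :=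
  ⟨h, hg.2⟩

theorem Good.of_eq {K : CochainComplex (Sh k X) ℤ} {i j : ℤ} {U V : Opens X} (hg : Good K j U V)
    (hij : i + 1 = j) : ∃ h : U ≤ V, ∀ s : Sec K j V, IsCocycle s → rs K h s = 0 →
    ∃ t : Sec K i V, dd K i j t = s ∧ rs K h t = 0 := by
  obtain rfl : i = j - 1 := by omega
  exact hg

/-- A section over the small set `V'` extends to `f⁻¹(U')` by flasqueness, and the error in an
equation vanishes on `V'`, so `Good` removes it. Injectivity uses this in degree `n`, surjectivity
in degree `n + 1`. -/
theorem stalkPf_bijective {K : CochainComplex (Sh k X) ℤ} (hK : Flasque K) {x : X} {y : Y}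
    (hxy : f x = y)
    (hg : ∀ (V : Opens X) (U : Opens Y), x ∈ V → y ∈ U → ∃ V' ≤ V, ∃ U' ≤ U, x ∈ V' ∧ y ∈ U' ∧
      ∀ n, Good K n V' ((Opens.map f).obj U')) (n : ℤ) :
    Function.Bijective (stalkPf f K n hxy) := by
  constructor
  · intro c c' h
    obtain ⟨U, hy, z, hz, rfl⟩ := exists_cls c
    obtain ⟨U', hy', z', hz', rfl⟩ := exists_cls c'
    rw [stalkPf_cls, stalkPf_cls] at h
    replace h := cls_eq_iff.1 h
    obtain ⟨V, h, h', hxV, t, ht⟩ := h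
    obtain ⟨V', hV', W, hW, hxV', hyW, hgood⟩ := hg V (U ⊓ U') hxV ⟨hy, hy'⟩
    obtain ⟨hle, hgood⟩ := hgood n
    obtain ⟨t', ht'⟩ := hK _ _ _ hle (rs K hV' t)
    have hU : (Opens.map f).obj W ≤ (Opens.map f).obj U := map_le f (hW.trans inf_le_left)
    have hU' : (Opens.map f).obj W ≤ (Opens.map f).obj U' := map_le f (hW.trans inf_le_right)
    -- Sections of the direct image are by definition sections of `K` over preimages; the
    -- computation is made there and then applied to `z` and `z'`.
    have key : ∀ (a : Sec K n ((Opens.map f).obj U)) (b : Sec K n ((Opens.map f).obj U')),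
        IsCocycle a → IsCocycle b → dd K (n - 1) n t = rs K h a - rs K h' b →
        ∃ s : Sec K (n - 1) ((Opens.map f).obj W), dd K (n - 1) n s = rs K hU a - rs K hU' b := by
      intro a b ha hb ht
      obtain ⟨v, hv, -⟩ := hgood (rs K hU a - rs K hU' b - dd K (n - 1) n t')
        (((ha.rs hU).sub (hb.rs hU')).sub (isCocycle_dd K t')) (by
          rw [map_sub, map_sub, rs_rs, rs_rs, ← dd_rs, ht', dd_rs, ht, map_sub, rs_rs, rs_rs,
            sub_self])
      exact ⟨t' + v, by rw [map_add, hv, add_sub_cancel]⟩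
    obtain ⟨s, hs⟩ := key z z' hz hz' ht
    exact cls_eq_iff.2 ⟨W, hW.trans inf_le_left, hW.trans inf_le_right, hyW, s, hs⟩
  · intro c
    obtain ⟨V, hx, w, hw, rfl⟩ := exists_cls c
    obtain ⟨V', hV', W, hW, hxV', hyW, hgood⟩ := hg V ⊤ hx trivial
    obtain ⟨hle, hgood⟩ := (hgood (n + 1)).of_eq rfl
    obtain ⟨w', hw'⟩ := hK _ _ _ hle (rs K hV' w)
    obtain ⟨t, ht, ht'⟩ := hgood (dd K n (n + 1) w') (isCocycle_dd K w') (by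
      rw [← dd_rs, hw', dd_rs, hw, map_zero])
    have hz : IsCocycle (w' - t) := (isCocycle_iff rfl).2 (by rw [map_sub, ht, sub_self])
    refine ⟨cls (K := pfC f K) y hyW (w' - t) hz, ?_⟩
    refine Eq.trans (stalkPf_cls f hxy hyW hz)
      (cls_eq_iff.2 (cohomologousAt_of_eq K hle hV' hxV' ?_))
    refine (map_sub (rs K hle) w' t).trans ?_
    rw [ht', hw', sub_zero]

/-- The adjunction unit for complexes. -/
def unitC (f : X ⟶ Y) (K : CochainComplex (Sh k Y) ℤ) : K ⟶ pfC f (pbC f K) where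
  f n := (TopCat.Sheaf.pullbackPushforwardAdjunction (ModuleCat.{u} k) f).unit.app (K.X n)
  comm' i j _ := ((TopCat.Sheaf.pullbackPushforwardAdjunction (ModuleCat.{u} k) f).unit.naturality
    (K.d i j)).symm

/-- The morphism of complexes adjoint to `β`. -/
def adjC {K : CochainComplex (Sh k Y) ℤ} {J : CochainComplex (Sh k X) ℤ} (β : pbC f K ⟶ J) :
    K ⟶ pfC f J :=
  unitC f K ≫ ((TopCat.Sheaf.pushforward (ModuleCat.{u} k) f).mapHomologicalComplex _).map β

theorem stalkPf_stalkMap_adjC {J : CochainComplex (Sh k X) ℤ} (β : pbC f K ⟶ J) (n : ℤ)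
    {x : X} {y : Y} (hxy : f x = y) (c : StalkCoh K n y) :
    stalkPf f J n hxy (stalkMap (adjC f β) n y c) = stalkMap β n x (stalkPb f K n hxy c) := by
  obtain ⟨V, hx, z, hz, rfl⟩ := exists_cls c
  rfl

theorem le_map_map {i : X ⟶ Y} {q : Y ⟶ X} (hiq : i ≫ q = 𝟙 X) (U : Opens X) :
    U ≤ (Opens.map i).obj ((Opens.map q).obj U) := fun x hx => by
  have h : q (i x) = x := congrArg (fun g : X ⟶ X => g x) hiq
  change q (i x) ∈ U
  rwa [h]

theorem sectionMap_naturality {i : X ⟶ Y} {q : Y ⟶ X} (hiq : i ≫ q = 𝟙 X) (F : Sh k Y)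
    {U V : Opens X} (h : U ≤ V) (s : (F.1.obj (op ((Opens.map q).obj V)) : ModuleCat.{u} k)) :
    shRes _ (le_map_map hiq U) (pbSec i F _ (shRes F (map_le q h) s)) =
      shRes _ h (shRes _ (le_map_map hiq V) (pbSec i F _ s)) := by
  rw [pbSec_shRes, shRes_shRes, shRes_shRes]

theorem sectionMap_shMap {i : X ⟶ Y} {q : Y ⟶ X} (hiq : i ≫ q = 𝟙 X) {F G : Sh k Y} (g : F ⟶ G)
    (U : Opens X) (s : (F.1.obj (op ((Opens.map q).obj U)) : ModuleCat.{u} k)) :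
    shRes _ (le_map_map hiq U) (pbSec i G _ (shMap g _ s)) =
      shMap ((TopCat.Sheaf.pullback (ModuleCat.{u} k) i).map g) U
        (shRes _ (le_map_map hiq U) (pbSec i F _ s)) := by
  rw [shMap_shRes, pbSec_shMap]

/-- For a section `i` of `q`, the natural morphism from the direct image by `q` to the inverse
image by `i`. -/
def sectionMap {i : X ⟶ Y} {q : Y ⟶ X} (hiq : i ≫ q = 𝟙 X) (F : Sh k Y) :
    (TopCat.Sheaf.pushforward (ModuleCat.{u} k) q).obj F ⟶
      (TopCat.Sheaf.pullback (ModuleCat.{u} k) i).obj F :=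
  ⟨{ app U := ModuleCat.ofHom ((shRes _ (le_map_map hiq U.unop)).comp
      (pbSec i F ((Opens.map q).obj U.unop)))
     naturality U V h := by
      ext s
      exact sectionMap_naturality hiq F h.unop.le s }⟩

/-- The natural morphism between complexes induced by `sectionMap`. -/
def sectionMapC {i : X ⟶ Y} {q : Y ⟶ X} (hiq : i ≫ q = 𝟙 X) (K : CochainComplex (Sh k Y) ℤ) :
    pfC q K ⟶ pbC i K where
  f n := sectionMap hiq (K.X n)
  comm' a b _ := by
    refine ObjectProperty.hom_ext _ (NatTrans.ext (funext fun U => ?_))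
    ext s
    exact (sectionMap_shMap hiq (K.d a b) U.unop s).symm

theorem stalkMap_sectionMapC {i : X ⟶ Y} {q : Y ⟶ X} (hiq : i ≫ q = 𝟙 X)
    (K : CochainComplex (Sh k Y) ℤ) (n : ℤ) (x : X) (hx : q (i x) = x) :
    stalkMap (sectionMapC hiq K) n x = stalkPb i K n rfl ∘ stalkPf q K n hx := by
  funext c
  obtain ⟨V, hxV, z, hz, rfl⟩ := exists_cls c
  exact cls_rs (K := pbC i K) (le_map_map hiq V) hxV (IsCocycle.pbs (f := i) (K := K) hz)

/-- On stalks the map first restricts from `q⁻¹(U)` to neighborhoods of `i x` and then applies the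
stalk isomorphism of `i⁻¹`. Only the first part needs the vanishing hypothesis. -/
theorem quasiIso_sectionMapC {i : X ⟶ Y} {q : Y ⟶ X} (hiq : i ≫ q = 𝟙 X)
    {K : CochainComplex (Sh k Y) ℤ} (hK : Flasque K)
    (hg : ∀ x (V : Opens Y) (U : Opens X), i x ∈ V → x ∈ U → ∃ V' ≤ V, ∃ U' ≤ U, i x ∈ V' ∧ x ∈ U' ∧
      ∀ n, Good K n V' ((Opens.map q).obj U')) : QuasiIso (sectionMapC hiq K) := by
  rw [quasiIso_iff_stalkMap]
  intro n x
  have hx : q (i x) = x := congrArg (fun g : X ⟶ X => g x) hiq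
  rw [stalkMap_sectionMapC hiq K n x hx]
  exact (stalkPb_bijective i n rfl).comp (stalkPf_bijective q hK hx (hg x) n)

/-- This realizes `K ≃ i⁻¹q⁻¹K ≃ i⁻¹J`: on stalks the composite is made of the isomorphisms of
`q⁻¹`, `β` and `i⁻¹`, so no condition on the fibres of `q` enters. -/
theorem quasiIso_adjC_comp_sectionMapC {i : X ⟶ Y} {q : Y ⟶ X} (hiq : i ≫ q = 𝟙 X)
    {K : CochainComplex (Sh k X) ℤ} {J : CochainComplex (Sh k Y) ℤ} (β : pbC q K ⟶ J)
    [QuasiIso β] : QuasiIso (adjC q β ≫ sectionMapC hiq J) := by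
  have hβ := (quasiIso_iff_stalkMap β).1 inferInstance
  rw [quasiIso_iff_stalkMap]
  intro n x
  have hx : q (i x) = x := congrArg (fun g : X ⟶ X => g x) hiq
  have : stalkMap (adjC q β ≫ sectionMapC hiq J) n x =
      stalkPb i J n rfl ∘ stalkMap β n (i x) ∘ stalkPb q K n hx := by
    funext c
    have h₁ : stalkMap (adjC q β ≫ sectionMapC hiq J) n x c =
        stalkMap (sectionMapC hiq J) n x (stalkMap (adjC q β) n x c) := by
      obtain ⟨V, hxV, z, hz, rfl⟩ := exists_cls c
      rfl
    rw [h₁, stalkMap_sectionMapC hiq J n x hx]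
    exact congrArg _ (stalkPf_stalkMap_adjC q β n hx c)
  rw [this]
  exact (stalkPb_bijective i n rfl).comp ((hβ n (i x)).comp (stalkPb_bijective q n hx))

end ComplexFunctors

/-! ### Injective sheaves are flasque -/

section Injective

variable {k : Type u} [Field k] {X Y : TopCat.{u}}

/-- The presheaf extending by zero the constant presheaf `k` on `U`. -/
abbrev freePre (k : Type u) [Field k] (U : Opens X) : X.Presheaf (ModuleCat.{u} k) :=
  Presheaf.freeYoneda U (ModuleCat.of k k)

open scoped Classical in
/-- The inclusion of the extensions by zero for `U ≤ V`. -/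
def freePreMap {U V : Opens X} (h : U ≤ V) : freePre k U ⟶ freePre k V where
  app W := Sigma.map' (fun i : W.unop ⟶ U => i ≫ homOfLE h) fun _ => 𝟙 _
  naturality W W' i := Sigma.hom_ext _ _ fun j => by
    simp [freePre, Presheaf.freeYoneda]

open scoped Classical in
instance {U V : Opens X} (h : U ≤ V) : Mono (freePreMap (k := k) h) := by
  have : ∀ W, Mono ((freePreMap (k := k) h).app W) := fun W => by
    -- Over each `W` the inclusion is split: the retraction is the identity on the summand if `W ≤
    -- U` and zero otherwise.
    have hr : (freePreMap (k := k) h).app W ≫ (Sigma.desc fun j : (yoneda.obj V).obj W =>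
        if h' : W.unop ≤ U then
          Sigma.ι (fun _ : (yoneda.obj U).obj W => ModuleCat.of k k) (homOfLE h') else 0) = 𝟙 _ := by
      refine Sigma.hom_ext _ _ fun j => ?_
      have h' : W.unop ≤ U := leOfHom (X := Opens X) j
      refine (Sigma.ι_comp_map'_assoc _ _ _ _).trans ?_
      rw [Category.id_comp]
      refine (Sigma.ι_desc _ _).trans (Eq.trans ?_ (Category.comp_id _).symm)
      rw [dif_pos h']
      rfl
    exact (SplitMono.mk _ hr).mono
  exact NatTrans.mono_of_mono_app _

/-- The sheaf extending by zero the constant sheaf `k` on `U`. -/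
def freeSh (k : Type u) [Field k] (U : Opens X) : Sh k X :=
  (presheafToSheaf _ _).obj (freePre k U)

/-- The inclusion of the extensions by zero for `U ≤ V`. -/
def freeShMap {U V : Opens X} (h : U ≤ V) : freeSh k U ⟶ freeSh k V :=
  (presheafToSheaf _ _).map (freePreMap h)

instance {U V : Opens X} (h : U ≤ V) : Mono (freeShMap (k := k) h) :=
  have : Mono (C := (Opens X)ᵒᵖ ⥤ ModuleCat.{u} k) (freePreMap (k := k) h) :=
    inferInstanceAs (Mono (freePreMap (k := k) h))
  Functor.map_mono (presheafToSheaf (Opens.grothendieckTopology X) (ModuleCat.{u} k))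
    (freePreMap h)

/-- Sections of `F` over `U` are morphisms from `freeSh k U`, the extension by zero of the constant
sheaf. Extending a section to `V` means extending such a morphism along the monomorphism `freeShMap
h`. -/
theorem exists_shRes_eq_of_injective (F : Sh k X) [Injective F] {U V : Opens X} (h : U ≤ V) :
    Function.Surjective (shRes F h) := by
  intro s
  let J := Opens.grothendieckTopology X
  let adj := sheafificationAdjunction J (ModuleCat.{u} k)
  let a : freePre k U ⟶ F.1 := Presheaf.freeYonedaHomEquiv.symm
    (ModuleCat.ofHom (LinearMap.toSpanSingleton k _ s))
  let a' : freeSh k U ⟶ F := (adj.homEquiv _ F).symm a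
  let g : freeSh k V ⟶ F := Injective.factorThru a' (freeShMap h)
  have hg : (presheafToSheaf J (ModuleCat.{u} k)).map (freePreMap (k := k) h) ≫ g =
      (adj.homEquiv _ F).symm a := Injective.comp_factorThru a' (freeShMap h)
  have hg' : freePreMap h ≫ adj.homEquiv _ F g = a := by
    refine (adj.homEquiv_naturality_left (freePreMap h) g).symm.trans ?_
    exact (congrArg _ hg).trans (Equiv.apply_symm_apply _ _)
  let g' := adj.homEquiv _ F g
  refine ⟨(Presheaf.freeYonedaHomEquiv g').hom (1 : k), ?_⟩
  have h₁ : Presheaf.freeYonedaHomEquiv (freePreMap (k := k) h ≫ g') =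
      ModuleCat.ofHom (LinearMap.toSpanSingleton k _ s) := by
    rw [hg', Equiv.apply_symm_apply]
  have h₂ : Presheaf.freeYonedaHomEquiv (freePreMap (k := k) h ≫ g') =
      Presheaf.freeYonedaHomEquiv g' ≫ F.1.map (homOfLE h).op := by
    have := g'.naturality (homOfLE h).op
    have h₄ := congrArg (fun q => Sigma.ι (fun _ : (yoneda.obj V).obj (op V) => ModuleCat.of k k)
      (𝟙 V) ≫ q) this
    refine Eq.trans ?_ (h₄.trans (Category.assoc _ _ _).symm)
    have e₁ : Sigma.ι (fun _ : (yoneda.obj U).obj (op U) => ModuleCat.of k k) (𝟙 U) ≫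
        (freePreMap (k := k) h).app (op U) =
        Sigma.ι (fun _ : (yoneda.obj V).obj (op U) => ModuleCat.of k k) (homOfLE h) :=
      (Sigma.ι_comp_map' _ _ _).trans (Category.id_comp _)
    have e₂ : Sigma.ι (fun _ : (yoneda.obj V).obj (op V) => ModuleCat.of k k) (𝟙 V) ≫
        (freePre k V).map (homOfLE h).op =
        Sigma.ι (fun _ : (yoneda.obj V).obj (op U) => ModuleCat.of k k) (homOfLE h) :=
      (Sigma.ι_comp_map' _ _ _).trans (Category.id_comp _)
    exact (Category.assoc _ _ _).symm.trans
      ((congrArg (· ≫ g'.app (op U)) (e₁.trans e₂.symm)).trans (Category.assoc _ _ _))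
  have h₃ := congrArg (fun q => q.hom (1 : k)) (h₂.symm.trans h₁)
  refine Eq.trans h₃ ?_
  simp

theorem flasque_of_injective (K : CochainComplex (Sh k X) ℤ) [∀ n, Injective (K.X n)] :
    Flasque K := fun n _ _ h => exists_shRes_eq_of_injective (K.X n) h

theorem subsingleton_sec (K : CochainComplex (Sh k X) ℤ) {n₀ : ℤ} [K.IsStrictlyGE n₀] {n : ℤ}
    (hn : n < n₀) (V : Opens X) : Subsingleton (Sec K n V) :=
  ModuleCat.subsingleton_of_isZero
    ((sectionsFunctor V).map_isZero (K.isZero_of_isStrictlyGE n₀ n hn))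

instance (f : X ⟶ Y) (F : Sh k X) [Injective F] :
    Injective ((TopCat.Sheaf.pushforward (ModuleCat.{u} k) f).obj F) :=
  Injective.injective_of_adjoint
    (TopCat.Sheaf.pullbackPushforwardAdjunction (ModuleCat.{u} k) f) F

end Injective

/-! ### Bounded below derived categories and injective resolutions -/

section

variable {C D : Type*} [Category* C] [Category* D] [Abelian C] [Abelian D]

theorem plus_mapHomologicalComplex (F : C ⥤ D) [F.Additive] {K : CochainComplex C ℤ}
    (hK : CochainComplex.plus C K) :
    CochainComplex.plus D ((F.mapHomologicalComplex (ComplexShape.up ℤ)).obj K) :=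
  (F.mapCochainComplexPlus.obj ⟨K, hK⟩).property

end

section DerivedPlus

variable {C D : Type*} [Category* C] [Category* D] [Abelian C] [Abelian D]
  [HasDerivedCategory C] [HasDerivedCategory D]

/-- The comparison between the localization functors of bounded below and of all complexes. -/
def plusQIso (K : CochainComplex.Plus C) :
    DerivedCategory.Plus.ι.obj (DerivedCategory.Plus.Q.obj K) ≅ DerivedCategory.Q.obj K.obj :=
  (DerivedCategory.quotientCompQhIso C).app K.obj

theorem nonempty_plusQ_iso {K : CochainComplex C ℤ} {L : CochainComplex C ℤ}
    (hK : CochainComplex.plus C K) (hL : CochainComplex.plus C L) (f : K ⟶ L) [QuasiIso f] :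
    Nonempty (DerivedCategory.Plus.Q.obj ⟨K, hK⟩ ≅ DerivedCategory.Plus.Q.obj ⟨L, hL⟩) :=
  ⟨DerivedCategory.Plus.ι.preimageIso (plusQIso ⟨K, hK⟩ ≪≫ asIso (DerivedCategory.Q.map f) ≪≫
    (plusQIso ⟨L, hL⟩).symm)⟩

theorem exists_plusQ_iso (F : DerivedCategory.Plus C) :
    ∃ K : CochainComplex.Plus C, Nonempty (DerivedCategory.Plus.Q.obj K ≅ F) := by
  obtain ⟨F, n, K, e, hK⟩ := F
  exact ⟨⟨K, n, hK⟩, ⟨DerivedCategory.Plus.ι.preimageIso (plusQIso ⟨K, n, hK⟩ ≪≫ e.symm)⟩⟩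

theorem nonempty_rightDerivedFunctorPlus_obj_iso [EnoughInjectives C] (F : C ⥤ D) [F.Additive]
    {J : CochainComplex C ℤ} (hJ : CochainComplex.plus C J) [∀ n, Injective (J.X n)] :
    Nonempty (F.rightDerivedFunctorPlus.obj (DerivedCategory.Plus.Q.obj ⟨J, hJ⟩) ≅
      DerivedCategory.Plus.Q.obj
        ⟨(F.mapHomologicalComplex (ComplexShape.up ℤ)).obj J, plus_mapHomologicalComplex F hJ⟩) := by
  obtain ⟨n, hn⟩ := hJ
  let L : CochainComplex (InjectiveObject C) ℤ :=
    HomologicalComplex.liftObjectProperty _ J inferInstance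
  have hL : L.IsStrictlyGE n := by
    rwa [← CochainComplex.isStrictlyGE_mapHomologicalComplex_obj_iff _ (InjectiveObject.ι _)]
  let L' : CochainComplex.Plus (InjectiveObject C) := ⟨L, n, hL⟩
  have : IsIso (F.rightDerivedFunctorPlusUnit.app
      ((HomotopyCategory.Plus.quotient C).obj
        ((InjectiveObject.ι C).mapCochainComplexPlus.obj L'))) := inferInstance
  exact ⟨(asIso (F.rightDerivedFunctorPlusUnit.app
      ((HomotopyCategory.Plus.quotient C).obj
        ((InjectiveObject.ι C).mapCochainComplexPlus.obj L')))).symm⟩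

/-- Both derived functors are computed on the same injective resolution, where `e` applies
degreewise. -/
theorem nonempty_rightDerivedFunctorPlus_iso [EnoughInjectives C] {F G : C ⥤ D} [F.Additive]
    [G.Additive] (e : F ≅ G) (X : DerivedCategory.Plus C) :
    Nonempty (F.rightDerivedFunctorPlus.obj X ≅ G.rightDerivedFunctorPlus.obj X) := by
  obtain ⟨⟨K, n, hK⟩, ⟨eK⟩⟩ := exists_plusQ_iso X
  obtain ⟨J, i, _, _, hJ⟩ := CochainComplex.Plus.modelCategoryQuillen.exists_quasiIso_injective K n
  obtain ⟨e₁⟩ := nonempty_plusQ_iso ⟨n, hK⟩ ⟨n, hJ⟩ i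
  obtain ⟨e₂⟩ := nonempty_rightDerivedFunctorPlus_obj_iso F ⟨n, hJ⟩
  obtain ⟨e₃⟩ := nonempty_rightDerivedFunctorPlus_obj_iso G ⟨n, hJ⟩
  let e₄ := (NatIso.mapHomologicalComplex e (ComplexShape.up ℤ)).app J
  obtain ⟨e₅⟩ := nonempty_plusQ_iso (plus_mapHomologicalComplex F ⟨n, hJ⟩)
    (plus_mapHomologicalComplex G ⟨n, hJ⟩) e₄.hom
  exact ⟨F.rightDerivedFunctorPlus.mapIso (eK.symm ≪≫ e₁) ≪≫ e₂ ≪≫ e₅ ≪≫ e₃.symm ≪≫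
    G.rightDerivedFunctorPlus.mapIso (eK.symm ≪≫ e₁).symm⟩

end DerivedPlus

/-! ### The formal comparison between the smash functor and a derived direct image -/

section Comparison

variable {k : Type u} [Field k] {X Y Z : TopCat.{u}}

theorem nonempty_inverseImage_obj_iso (f : X ⟶ Y) {K : CochainComplex (Sh k Y) ℤ}
    (hK : CochainComplex.plus _ K) :
    Nonempty ((inverseImage f).obj (DerivedCategory.Plus.Q.obj ⟨K, hK⟩) ≅
      DerivedCategory.Plus.Q.obj ⟨pbC f K, plus_mapHomologicalComplex _ hK⟩) :=
  ⟨DerivedCategory.Plus.ι.preimageIso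
    ((TopCat.Sheaf.pullback (ModuleCat.{u} k) f).mapDerivedCategory.mapIso (plusQIso ⟨K, hK⟩) ≪≫
      (Functor.mapDerivedCategoryFactors _).app K ≪≫ (plusQIso ⟨pbC (k := k) f K, plus_mapHomologicalComplex _ hK⟩).symm)⟩

/-- Direct images compose strictly, so a commutative square gives an equality of complexes and not
merely an isomorphism. -/
theorem pfC_pfC_eq {W : TopCat.{u}} {f : X ⟶ Y} {g : Y ⟶ W} {f' : X ⟶ Z} {g' : Z ⟶ W}
    (h : f ≫ g = f' ≫ g') (K : CochainComplex (Sh k X) ℤ) :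
    pfC g (pfC f K) = pfC g' (pfC f' K) := by
  have h₁ : pfC g (pfC f K) = pfC (f ≫ g) K := rfl
  have h₂ : pfC g' (pfC f' K) = pfC (f' ≫ g') K := rfl
  rw [h₁, h₂, h]

/-- With `I` representing `F` and `J` an injective resolution of `γ⁻¹I`, one has `F ≃ σ⁻¹J ≃ p_*J`.
Since `p_*J` again consists of injectives, `Rc_*F` is `c_*p_*J = q_*j_*J`. The latter is
quasi-isomorphic to `i⁻¹j_*J`, which represents `i⁻¹Rj_*γ⁻¹F`. -/
theorem nonempty_iso_derivedDirectImage {γ : Y ⟶ X} {j : Y ⟶ Z} {i : X ⟶ Z} {q : Z ⟶ X}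
    {c : X ⟶ X} {p : Y ⟶ X} {σ : X ⟶ Y} (hiq : i ≫ q = 𝟙 X) (hσγ : σ ≫ γ = 𝟙 X)
    (hσp : σ ≫ p = 𝟙 X) (hpc : p ≫ c = j ≫ q) (F : Dplus k X)
    (h : ∀ (I : CochainComplex (Sh k X) ℤ) (hI : CochainComplex.plus _ I)
      (_ : DerivedCategory.Plus.Q.obj ⟨I, hI⟩ ≅ F) (J : CochainComplex (Sh k Y) ℤ)
      (_ : CochainComplex.plus _ J) (_ : ∀ n, Injective (J.X n)) (β : pbC γ I ⟶ J)
      (_ : QuasiIso β), QuasiIso (sectionMapC hiq (pfC j J)) ∧ QuasiIso (sectionMapC hσp J)) :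
    Nonempty ((inverseImage i).obj ((derivedDirectImage j).obj ((inverseImage γ).obj F)) ≅
      (derivedDirectImage c).obj F) := by
  obtain ⟨⟨I, n, hI⟩, ⟨e⟩⟩ := exists_plusQ_iso F
  obtain ⟨J, β, _, _, hJ⟩ :=
    CochainComplex.Plus.modelCategoryQuillen.exists_quasiIso_injective
      (pbC (k := k) γ I) n
  obtain ⟨_, _⟩ := h I ⟨n, hI⟩ e J ⟨n, hJ⟩ inferInstance β inferInstance
  have hJ' : CochainComplex.plus _ J := ⟨n, hJ⟩
  have : ∀ n, Injective ((pfC p J).X n) := fun n =>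
    inferInstanceAs (Injective ((TopCat.Sheaf.pushforward (ModuleCat.{u} k) p).obj (J.X n)))
  have hjJ := plus_mapHomologicalComplex (TopCat.Sheaf.pushforward (ModuleCat.{u} k) j) hJ'
  have hpJ := plus_mapHomologicalComplex (TopCat.Sheaf.pushforward (ModuleCat.{u} k) p) hJ'
  have hσJ := plus_mapHomologicalComplex (TopCat.Sheaf.pullback (ModuleCat.{u} k) σ) hJ'
  have hqjJ := plus_mapHomologicalComplex (TopCat.Sheaf.pushforward (ModuleCat.{u} k) q) hjJ
  obtain ⟨e₁⟩ := nonempty_inverseImage_obj_iso γ ⟨n, hI⟩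
  obtain ⟨e₂⟩ := nonempty_plusQ_iso (plus_mapHomologicalComplex _ ⟨n, hI⟩) hJ' β
  obtain ⟨e₃⟩ := nonempty_rightDerivedFunctorPlus_obj_iso
    (TopCat.Sheaf.pushforward (ModuleCat.{u} k) j) hJ'
  obtain ⟨e₄⟩ := nonempty_inverseImage_obj_iso i hjJ
  obtain ⟨e₅⟩ := nonempty_plusQ_iso hqjJ (plus_mapHomologicalComplex _ hjJ)
    (sectionMapC hiq (pfC j J))
  have := quasiIso_adjC_comp_sectionMapC hσγ β
  obtain ⟨e₆⟩ := nonempty_plusQ_iso ⟨n, hI⟩ hσJ (adjC γ β ≫ sectionMapC hσγ J)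
  obtain ⟨e₇⟩ := nonempty_plusQ_iso hpJ hσJ (sectionMapC hσp J)
  obtain ⟨e₈⟩ := nonempty_rightDerivedFunctorPlus_obj_iso
    (TopCat.Sheaf.pushforward (ModuleCat.{u} k) c) hpJ
  obtain ⟨e₉⟩ := nonempty_plusQ_iso
    (plus_mapHomologicalComplex (TopCat.Sheaf.pushforward (ModuleCat.{u} k) c) hpJ) hqjJ
    (eqToHom (pfC_pfC_eq hpc J))
  exact ⟨(inverseImage i).mapIso ((derivedDirectImage j).mapIso ((inverseImage γ).mapIso e.symm ≪≫
      e₁ ≪≫ e₂) ≪≫ e₃) ≪≫ e₄ ≪≫ e₅.symm ≪≫ e₉.symm ≪≫ e₈.symm ≪≫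
      (derivedDirectImage c).mapIso (e₇ ≪≫ e₆.symm ≪≫ e)⟩

end Comparison

/-! ### Direct images with proper supports under a proper map -/

section Proper

variable {k : Type u} [Field k] {X Y : TopCat.{u}}

/-- The support of a section is closed in `f⁻¹(U)`, so it inherits properness over `U` from `f`. -/
theorem properSections_eq_top {f : X ⟶ Y} (hf : IsProperMap f) (F : X.Presheaf (ModuleCat.{u} k))
    (U : Opens Y) : properSections f F U = ⊤ := by
  refine eq_top_iff.2 fun s _ => (properOver_iff _ _ _).2 ⟨fun x hx => hx.1, fun l y hl hy ht => ?_⟩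
  obtain ⟨x, hxy, hle⟩ := hf.ultrafilter_le_nhds_of_tendsto ht
  have hx : x ∈ (Opens.map f).obj U := by
    change f x ∈ U
    rwa [hxy]
  exact ⟨x, sectionSupport_closed F hx (mem_closure_iff_ultrafilter.2 ⟨l, hl, hle⟩), hxy, hle⟩

/-- The direct image with proper supports coincides with the direct image for a proper map. -/
def properDirectImageIso (f : X ⟶ Y) (hf : IsProperMap f) :
    properDirectImage (k := k) f ≅ TopCat.Sheaf.pushforward (ModuleCat.{u} k) f :=
  NatIso.ofComponents (fun F =>
    { hom := ⟨{ app U := ModuleCat.ofHom (properSections f F.1 U.unop).subtype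
                naturality _ _ _ := rfl }⟩
      inv := ⟨{ app U := ModuleCat.ofHom (LinearMap.codRestrict (properSections f F.1 U.unop)
                  LinearMap.id fun s => by rw [properSections_eq_top hf]; trivial)
                naturality _ _ _ := rfl }⟩
      hom_inv_id := rfl
      inv_hom_id := rfl }) fun _ => rfl

variable {E : Type u} [NormedAddCommGroup E] [NormedSpace ℂ E]

theorem norm_contractFun {R : ℝ} (hR : 0 < R) (x : E) : ‖contractFun R x‖ = max (‖x‖ - R) 0 := by
  unfold contractFun
  split_ifs with h
  · rw [norm_zero, max_eq_right (by linarith)]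
  · have hx : 0 < ‖x‖ := by linarith
    rw [norm_smul, Real.norm_eq_abs, abs_of_nonneg (div_nonneg (by linarith) hx.le),
      div_mul_cancel₀ _ hx.ne', max_eq_left (by linarith)]

/-- The map lowers norms by at most `R`, so preimages of bounded sets are bounded; in a proper space
closed bounded sets are compact. -/
theorem isProperMap_contractMap [ProperSpace E] {R : ℝ} (hR : 0 < R) :
    IsProperMap (contractMap E R hR) := by
  refine isProperMap_iff_isCompact_preimage.2 ⟨(contractMap E R hR).hom.continuous, fun K hK => ?_⟩
  refine Metric.isCompact_of_isClosed_isBounded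
    (hK.isClosed.preimage (contractMap E R hR).hom.continuous) ?_
  obtain ⟨C, hC⟩ := hK.isBounded.exists_norm_le
  refine (isBounded_iff_forall_norm_le).2 ⟨C + R, fun x hx => ?_⟩
  have h₁ : ‖contractFun R x‖ ≤ C := hC _ hx
  rw [norm_contractFun hR] at h₁
  linarith [le_max_left (‖x‖ - R) 0]

end Proper

/-! ### From locally constant cohomology sheaves to local constancy along paths -/

section LocallyConstant

variable {k : Type u} [Field k] {X Y : TopCat.{u}}

/-- Every germ of `H` at a point of `U` is the germ of exactly one of the sections `σ m`. -/
def IsConstantFamily (H : Sh k X) (U : Opens X) {M : Type u}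
    (σ : M → (H.1.obj (op U) : ModuleCat.{u} k)) : Prop :=
  (∀ m m' (W : Opens X) (h : W ≤ U) (y : X), y ∈ W → shRes H h (σ m) = shRes H h (σ m') →
    m = m') ∧
  ∀ (V : Opens X) (s : (H.1.obj (op V) : ModuleCat.{u} k)) (y : X), y ∈ V → y ∈ U →
    ∃ (W : Opens X) (h : W ≤ V) (h' : W ≤ U) (m : M), y ∈ W ∧ shRes H h s = shRes H h' (σ m)

/-- The labels are the values in the module `M` of the constant sheaf. Sheafification is locally
surjective, so every germ has a label; it is locally injective and the constant presheaf has
identity restrictions, so the label is unique. -/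
theorem exists_isConstantFamily_of_isConstant (G : Sh k X)
    (hG : Sheaf.IsConstant (Opens.grothendieckTopology X) G) :
    ∃ (M : Type u) (σ : M → (G.1.obj (op ⊤) : ModuleCat.{u} k)), IsConstantFamily G ⊤ σ := by
  obtain ⟨M, ⟨e⟩⟩ := hG.mem_essImage
  let P : (Opens X)ᵒᵖ ⥤ ModuleCat.{u} k := (Functor.const _).obj M
  let C : Sh k X := (presheafToSheaf (Opens.grothendieckTopology X) _).obj P
  let e' : C ≅ G := e
  let τ : ∀ V : Opens X, M →ₗ[k] (C.1.obj (op V) : ModuleCat.{u} k) := fun V =>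
    ((toSheafify (Opens.grothendieckTopology X) P).app (op V)).hom
  have hτ : ∀ (U V : Opens X) (h : U ≤ V) (m : M), shRes C h (τ V m) = τ U m := fun U V h m =>
    (congrArg (fun g => g m)
      ((toSheafify (Opens.grothendieckTopology X) P).naturality (homOfLE h).op)).symm
  refine ⟨M, fun m => shMap e'.hom ⊤ (τ ⊤ m), fun m m' W h y hy he => ?_, fun V s y hy _ => ?_⟩
  · rw [← shMap_shRes, ← shMap_shRes] at he
    have he' := shMap_injective e'.hom W he
    rw [hτ, hτ] at he'
    have := Presheaf.isLocallyInjective_toSheafify' (Opens.grothendieckTopology X) P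
    obtain ⟨W', i, hi, -⟩ := Presheaf.equalizerSieve_mem (Opens.grothendieckTopology X)
      (toSheafify (Opens.grothendieckTopology X) P) (X := op W) m m' he' y hy
    exact hi
  · obtain ⟨W, h, ⟨m, hm⟩, hyW⟩ := (TopCat.Presheaf.isLocallySurjective_iff _).1
      (Presheaf.isLocallySurjective_toSheafify' (Opens.grothendieckTopology X) P) V
      (shMap e'.inv V s) y hy
    replace hm : τ W m = shRes C h (shMap e'.inv V s) := hm
    refine ⟨W, h, le_top, m, hyW, ?_⟩
    rw [← shMap_shRes, hτ, hm, shMap_shRes, ← shMap_comp, e'.inv_hom_id, shMap_id]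

theorem exists_isConstantFamily {H : Sh k X} (hH : IsLocallyConstantSheaf H) (x : X) :
    ∃ (U : Opens X) (M : Type u) (σ : M → (H.1.obj (op U) : ModuleCat.{u} k)), x ∈ U ∧
      IsConstantFamily H U σ := by
  obtain ⟨U, hx, hU⟩ := hH x
  obtain ⟨M, σ, hσ⟩ := exists_isConstantFamily_of_isConstant (X := TopCat.of U)
    (U.sheafRestrict.obj H) hU
  have hle : U ≤ U.isOpenEmbedding.functor.obj ⊤ := fun y hy => ⟨⟨y, hy⟩, trivial, rfl⟩
  have hle' : ∀ W : Opens X, U.isOpenEmbedding.functor.obj ((Opens.map U.inclusion').obj W) ≤ W := by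
    rintro W _ ⟨y, hy, rfl⟩
    exact hy
  have hle'' : ∀ W : Opens (TopCat.of U), U.isOpenEmbedding.functor.obj W ≤ U := by
    rintro W _ ⟨y, hy, rfl⟩
    exact y.2
  let σ' : M → (H.1.obj (op (U.isOpenEmbedding.functor.obj ⊤)) : ModuleCat.{u} k) := σ
  refine ⟨U, M, fun m => shRes H hle (σ' m), hx, fun m m' W h y hy he => ?_, fun V s y hy hyU => ?_⟩
  · refine hσ.1 m m' ((Opens.map U.inclusion').obj W) le_top ⟨y, h hy⟩ hy ?_
    have := congrArg (shRes H (hle' W)) he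
    simp only [shRes_shRes] at this
    exact this
  · obtain ⟨W, h, h', m, hyW, he⟩ := hσ.2 ((Opens.map U.inclusion').obj V)
      (shRes H (hle' V) s) ⟨y, hyU⟩ hy trivial
    have h₁ : U.isOpenEmbedding.functor.obj W ≤
        U.isOpenEmbedding.functor.obj ((Opens.map U.inclusion').obj V) :=
      (U.isOpenEmbedding.functor.map (homOfLE h)).le
    have h₂ : U.isOpenEmbedding.functor.obj W ≤ U.isOpenEmbedding.functor.obj ⊤ :=
      (U.isOpenEmbedding.functor.map (homOfLE h')).le
    replace he : shRes H h₁ (shRes H (hle' V) s) = shRes H h₂ (σ' m) := he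
    refine ⟨U.isOpenEmbedding.functor.obj W, h₁.trans (hle' V), hle'' W, m, ⟨⟨y, hyU⟩, hyW, rfl⟩, ?_⟩
    rw [shRes_shRes] at he ⊢
    exact he

theorem IsLocallyConstantSheaf.of_iso {F G : Sh k X} (e : F ≅ G) (h : IsLocallyConstantSheaf F) :
    IsLocallyConstantSheaf G := fun x => by
  obtain ⟨U, hx, hU⟩ := h x
  exact ⟨U, hx, Sheaf.isConstant_congr _ (U.sheafRestrict.mapIso e)⟩

variable {K L : CochainComplex (Sh k X) ℤ}

theorem exists_cls_section {n : ℤ} {U : Opens X}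
    (s : ((K.homology n).1.obj (op U) : ModuleCat.{u} k)) {x : X} (hx : x ∈ U) :
    ∃ c : StalkCoh K n x, ∀ (W : Opens X) (hW : W ≤ U) (hxW : x ∈ W) (z : Sec K n W)
      (hz : IsCocycle z), hcl z hz = shRes _ hW s → cls x hxW z hz = c := by
  obtain ⟨W, h, z, hz, hxW, he⟩ := exists_hcl_eq s hx
  refine ⟨cls x hxW z hz, fun W' hW' hxW' z' hz' he' => ?_⟩
  rw [cls_eq_iff, cohomologousAt_iff_hcl hz' hz]
  exact ⟨W' ⊓ W, inf_le_left, inf_le_right, ⟨hxW', hxW⟩, by rw [he, he', shRes_shRes, shRes_shRes]⟩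

/-- The sections `σ m` of the cohomology sheaf that label its germs on `U` provide the
trivialization over the part of the path inside `U`. -/
theorem locConstAlong_of_isLocallyConstantSheaf {n : ℤ}
    (hK : IsLocallyConstantSheaf (K.homology n)) {p : ℝ → X} (hp : Continuous p) :
    LocConstAlong K n p := by
  intro b
  obtain ⟨U, M, σ, hb, hσ⟩ := exists_isConstantFamily hK (p b)
  have key : ∀ m r, ∃ c : StalkCoh K n (p r), ∀ (W : Opens X) (hW : W ≤ U) (hxW : p r ∈ W)
      (z : Sec K n W) (hz : IsCocycle z), hcl z hz = shRes _ hW (σ m) → cls (p r) hxW z hz = c := by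
    intro m r
    by_cases hr : p r ∈ U
    · exact exists_cls_section (σ m) hr
    · exact ⟨cls (p r) (V := ⊤) trivial 0 (isCocycle_zero K), fun W hW hxW => (hr (hW hxW)).elim⟩
  choose c hc using key
  refine ⟨p ⁻¹' U, hp.continuousAt (U.isOpen.mem_nhds hb), M, c, fun r hr => ⟨fun m m' he => ?_,
    fun a => ?_⟩, fun m r hr => ?_⟩
  · obtain ⟨W, h, z, hz, hxW, hs⟩ := exists_hcl_eq (σ m) hr
    obtain ⟨W', h', z', hz', hxW', hs'⟩ := exists_hcl_eq (σ m') hr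
    have h₁ := hc m r W h hxW z hz hs
    have h₂ := hc m' r W' h' hxW' z' hz' hs'
    obtain ⟨V, hV, hV', hxV, heV⟩ := (cohomologousAt_iff_hcl hz hz').1
      (cls_eq_iff.1 (h₁.trans (he.trans h₂.symm)))
    refine hσ.1 m m' V (hV.trans h) (p r) hxV ?_
    rw [hs, hs', shRes_shRes, shRes_shRes] at heV
    exact heV
  · obtain ⟨V, hx, z, hz, rfl⟩ := exists_cls a
    obtain ⟨W, h, h', m, hxW, he⟩ := hσ.2 V (hcl z hz) (p r) hx hr
    refine ⟨m, ?_⟩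
    rw [← hcl_rs] at he
    exact (hc m r W h' hxW _ _ he).symm.trans (cls_rs h hxW hz)
  · obtain ⟨W, h, z, hz, hxW, hs⟩ := exists_hcl_eq (σ m) hr
    exact ⟨W, z, hz, hxW, Filter.Eventually.of_forall fun r' hr' => hc m r' W h hr' z hz hs⟩

theorem locConstAlong_const (n : ℤ) (x : X) : LocConstAlong K n fun _ => x := by
  refine fun b => ⟨Set.univ, Filter.univ_mem, StalkCoh K n x, fun c _ => c,
    fun _ _ => Function.bijective_id, fun c _ _ => ?_⟩
  obtain ⟨V, hx, z, hz, rfl⟩ := exists_cls c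
  exact ⟨V, z, hz, hx, Filter.Eventually.of_forall fun _ _ => rfl⟩

theorem LocConstAlong.map {n : ℤ} {p : ℝ → X} (h : LocConstAlong K n p) (f : K ⟶ L) [QuasiIso f] :
    LocConstAlong L n p := by
  have hf := (quasiIso_iff_stalkMap f).1 inferInstance n
  intro b
  obtain ⟨N, hN, M, g, hg, hM⟩ := h b
  refine ⟨N, hN, M, fun m r => stalkMap f n (p r) (g m r), fun r hr => (hf (p r)).comp (hg r hr),
    fun m r hr => ?_⟩
  obtain ⟨V, z, hz, hV, hev⟩ := hM m r hr
  refine ⟨V, mp f z, hz.mp f, hV, hev.mono fun r' hr' hm => ?_⟩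
  exact congrArg (stalkMap f n (p r')) (hr' hm)

theorem LocConstAlong.pbC {f : X ⟶ Y} {K : CochainComplex (Sh k Y) ℤ} {n : ℤ} {p : ℝ → X}
    (h : LocConstAlong K n fun r => f (p r)) : LocConstAlong (pbC f K) n p := by
  intro b
  obtain ⟨N, hN, M, g, hg, hM⟩ := h b
  refine ⟨N, hN, M, fun m r => stalkPb f K n rfl (g m r),
    fun r hr => (stalkPb_bijective f n rfl).comp (hg r hr), fun m r hr => ?_⟩
  obtain ⟨V, z, hz, hV, hev⟩ := hM m r hr
  refine ⟨(Opens.map f).obj V, pbs f K z, hz.pbs, hV, hev.mono fun r' hr' hm => ?_⟩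
  exact congrArg (stalkPb f K n rfl) (hr' hm)

/-- Inverse images preserve stalk cohomology, and a cocycle of `f⁻¹K` near `p r` is cohomologous
there to the inverse image of a cocycle of `K`. For the inclusion of a subspace, this passes from
the restriction of `K` to `K` itself. -/
theorem LocConstAlong.of_pbC {f : X ⟶ Y} {K : CochainComplex (Sh k Y) ℤ} {n : ℤ} {p : ℝ → X}
    (hp : Continuous p) (h : LocConstAlong (Smash.pbC f K) n p) :
    LocConstAlong K n fun r => f (p r) := by
  intro b
  obtain ⟨N, hN, M, g, hg, hM⟩ := h b
  let e : ∀ r, StalkCoh K n (f (p r)) ≃ StalkCoh (Smash.pbC f K) n (p r) := fun r =>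
    Equiv.ofBijective _ (stalkPb_bijective f n rfl)
  refine ⟨N, hN, M, fun m r => (e r).symm (g m r),
    fun r hr => (e r).symm.bijective.comp (hg r hr), fun m r hr => ?_⟩
  obtain ⟨U, u, hu, hU, hev⟩ := hM m r hr
  obtain ⟨c, hc⟩ := (e r).surjective (cls (p r) hU u hu)
  obtain ⟨V, hV, v, hv, rfl⟩ := exists_cls c
  have hc' : CohomologousAt _ (p r) (pbs f K v) u := cls_eq_iff.1 hc
  refine ⟨V, v, hv, hV, ?_⟩
  filter_upwards [hev, hp.continuousAt.eventually hc'.eventually,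
    hp.continuousAt (U.isOpen.mem_nhds hU)] with r' h₁ h₂ h₃ hm
  rw [Equiv.eq_symm_apply, ← h₁ h₃]
  exact cls_eq_iff.2 h₂

theorem isLocallyConstantSheaf_homology {f : X ⟶ Y} {F : Dplus k Y}
    (hF : IsLocallyConstant ((inverseImage f).obj F)) {I : CochainComplex (Sh k Y) ℤ}
    (hI : CochainComplex.plus _ I) (e : DerivedCategory.Plus.Q.obj ⟨I, hI⟩ ≅ F) (n : ℤ) :
    IsLocallyConstantSheaf ((Smash.pbC f I).homology n) := by
  obtain ⟨e₁⟩ := nonempty_inverseImage_obj_iso f hI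
  refine IsLocallyConstantSheaf.of_iso ?_ (hF n)
  exact (DerivedCategory.Plus.homologyFunctor _ n).mapIso ((inverseImage f).mapIso e.symm ≪≫ e₁) ≪≫
    (DerivedCategory.homologyFunctor _ n).mapIso (plusQIso _) ≪≫
    (DerivedCategory.homologyFunctorFactors _ n).app _

end LocallyConstant

/-! ### The contractions and the trivialization of `E × ℝ_{<0}` -/

section Geometry

variable {E : Type u} [NormedAddCommGroup E] [NormedSpace ℂ E]

theorem contractFun_of_le {a : ℝ} {x : E} (h : ‖x‖ ≤ a) : contractFun a x = 0 := if_pos h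

theorem contractFun_of_lt {a : ℝ} {x : E} (h : a < ‖x‖) :
    contractFun a x = ((‖x‖ - a) / ‖x‖) • x := if_neg h.not_ge

theorem contractFun_zero (x : E) : contractFun 0 x = x := by
  rcases (norm_nonneg x).eq_or_lt with h | h
  · rw [contractFun_of_le h.symm.le, norm_eq_zero.1 h.symm]
  · rw [contractFun_of_lt h, sub_zero, div_self h.ne', one_smul]

theorem norm_sub_contractFun_le {a : ℝ} (ha : 0 ≤ a) (x : E) : ‖x - contractFun a x‖ ≤ a := by
  rcases le_or_gt ‖x‖ a with h | h
  · rwa [contractFun_of_le h, sub_zero]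
  · have hx : 0 < ‖x‖ := ha.trans_lt h
    have h₁ : x - contractFun a x = (a / ‖x‖) • x := by
      rw [contractFun_of_lt h]
      nth_rewrite 1 [← one_smul ℝ x]
      rw [← sub_smul]
      congr 1
      field_simp
      ring
    rw [h₁, norm_smul, Real.norm_of_nonneg (by positivity), div_mul_cancel₀ _ hx.ne']

theorem norm_contractFun_le {a : ℝ} (ha : 0 ≤ a) (x : E) : ‖contractFun a x‖ ≤ ‖x‖ := by
  rcases le_or_gt ‖x‖ a with h | h
  · rw [contractFun_of_le h, norm_zero]
    exact norm_nonneg x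
  · have hx : 0 < ‖x‖ := ha.trans_lt h
    rw [contractFun_of_lt h, norm_smul, Real.norm_of_nonneg (div_nonneg (by linarith) hx.le),
      div_mul_cancel₀ _ hx.ne']
    linarith

/-- The contraction of the ball of radius `a` compensated by the dilation of factor `u`. -/
def stretchFun (a u : ℝ) (x : E) : E := contractFun a x + u • (x - contractFun a x)

theorem stretchFun_of_le {a u : ℝ} {x : E} (h : ‖x‖ ≤ a) : stretchFun a u x = u • x := by
  rw [stretchFun, contractFun_of_le h, zero_add, sub_zero]

theorem stretchFun_of_lt {a u : ℝ} {x : E} (ha : 0 ≤ a) (h : a < ‖x‖) :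
    stretchFun a u x = ((‖x‖ - a + u * a) / ‖x‖) • x := by
  have hx : 0 < ‖x‖ := ha.trans_lt h
  have : stretchFun a u x =
      ((‖x‖ - a) / ‖x‖) • x + u • ((1 : ℝ) • x - ((‖x‖ - a) / ‖x‖) • x) := by
    rw [stretchFun, contractFun_of_lt h, one_smul]
  rw [this, ← sub_smul, smul_smul, ← add_smul]
  congr 1
  field_simp
  ring

theorem norm_stretchFun_of_lt {a u : ℝ} {x : E} (ha : 0 ≤ a) (hu : 0 < u) (h : a < ‖x‖) :
    ‖stretchFun a u x‖ = ‖x‖ - a + u * a := by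
  have hx : 0 < ‖x‖ := ha.trans_lt h
  rw [stretchFun_of_lt ha h, norm_smul, Real.norm_of_nonneg, div_mul_cancel₀ _ hx.ne']
  have := mul_nonneg hu.le ha
  exact div_nonneg (by linarith) hx.le

/-- The stretch dilates the ball of radius `a` to the ball of radius `u * a` and translates radially
outside, so the distance to the ball and the direction are unchanged there. -/
theorem contractFun_stretchFun {a u : ℝ} (ha : 0 ≤ a) (hu : 0 < u) (x : E) :
    contractFun (u * a) (stretchFun a u x) = contractFun a x := by
  rcases le_or_gt ‖x‖ a with h | h
  · rw [contractFun_of_le h, stretchFun_of_le h, contractFun_of_le]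
    rw [norm_smul, Real.norm_of_nonneg hu.le]
    exact mul_le_mul_of_nonneg_left h hu.le
  · have hx : 0 < ‖x‖ := ha.trans_lt h
    have h' := norm_stretchFun_of_lt ha hu h
    have h₀ := mul_nonneg hu.le ha
    have hp : 0 < ‖x‖ - a + u * a := by linarith
    rw [contractFun_of_lt (by rw [h']; linarith), h', stretchFun_of_lt ha h, contractFun_of_lt h,
      smul_smul]
    congr 1
    field_simp
    ring

theorem stretchFun_stretchFun {a u : ℝ} (ha : 0 ≤ a) (hu : 0 < u) (x : E) :
    stretchFun (u * a) u⁻¹ (stretchFun a u x) = x := by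
  rw [stretchFun, contractFun_stretchFun ha hu, stretchFun, add_sub_cancel_left, smul_smul,
    inv_mul_cancel₀ hu.ne', one_smul, add_sub_cancel]

/-- Joint continuity down to radius zero is what lets `retractMap` be continuous across the
hyperplane `s = 0`. -/
theorem continuous_contractFun_prod : Continuous fun p : E × ℝ => contractFun (max p.2 0) p.1 := by
  have h : ∀ p : E × ℝ, contractFun (max p.2 0) p.1 =
      (max (‖p.1‖ - max p.2 0) 0 / max ‖p.1‖ (max p.2 0)) • p.1 := by
    intro p
    rcases le_or_gt ‖p.1‖ (max p.2 0) with hx | hx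
    · rw [contractFun_of_le hx, max_eq_right (by linarith : ‖p.1‖ - max p.2 0 ≤ 0), zero_div,
        zero_smul]
    · rw [contractFun_of_lt hx, max_eq_left (by linarith : 0 ≤ ‖p.1‖ - max p.2 0),
        max_eq_left hx.le]
  refine continuous_iff_continuousAt.2 fun p => ?_
  -- The denominator vanishes exactly at the origin with nonpositive parameter; there the bound by
  -- `‖x‖` replaces the quotient formula.
  by_cases hp : max ‖p.1‖ (max p.2 0) = 0
  · have h₁ : p.1 = 0 := norm_eq_zero.1
      (le_antisymm ((le_max_left _ _).trans hp.le) (norm_nonneg _))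
    have h₂ : contractFun (max p.2 0) p.1 = 0 := by
      rw [h₁]
      exact contractFun_of_le (by rw [norm_zero]; exact le_max_right _ _)
    rw [ContinuousAt, h₂]
    refine squeeze_zero_norm (a := fun q : E × ℝ => ‖q.1‖)
      (fun q => norm_contractFun_le (le_max_right _ _) q.1) ?_
    have := (continuous_fst (X := E) (Y := ℝ)).norm.tendsto p
    simpa [h₁] using this
  · simp only [ContinuousAt, h]
    have hd : ContinuousAt
        (fun p : E × ℝ => max (‖p.1‖ - max p.2 0) 0 / max ‖p.1‖ (max p.2 0)) p :=
      ContinuousAt.div (by fun_prop) (by fun_prop) hp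
    have hs : Continuous fun q : ℝ × E => q.1 • q.2 := continuous_smul
    exact (hs.tendsto _).comp (hd.prodMk continuous_fst.continuousAt)

variable {R : ℝ} (hR : 0 < R)

variable (E R) in
/-- The retraction `(x, s) ↦ c^{R |s|}(x)` for `s ≤ 0`, extended by `x` for `s ≥ 0`. -/
def retractMap : TopCat.of (E × ℝ) ⟶ TopCat.of E :=
  TopCat.ofHom ⟨fun p => contractFun (max (R * -p.2) 0) p.1,
    continuous_contractFun_prod.comp (f := fun p : E × ℝ => (p.1, R * -p.2)) (by fun_prop)⟩

theorem continuous_stretchFun_inv {R : ℝ} (hR : 0 < R) : Continuous fun p : E × Set.Iio (0 : ℝ) =>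
    stretchFun (-p.2.1 * R) (-p.2.1)⁻¹ p.1 := by
  have h : (fun p : E × Set.Iio (0 : ℝ) => contractFun (-p.2.1 * R) p.1) =
      fun p => contractFun (max (-p.2.1 * R) 0) p.1 := by
    funext p
    rw [max_eq_left]
    exact mul_nonneg (neg_nonneg.2 p.2.2.le) hR.le
  have hc : Continuous fun p : E × Set.Iio (0 : ℝ) => contractFun (-p.2.1 * R) p.1 := by
    rw [h]
    exact continuous_contractFun_prod.comp
      (f := fun p : E × Set.Iio (0 : ℝ) => (p.1, -p.2.1 * R)) (by fun_prop)
  have hi : Continuous fun p : E × Set.Iio (0 : ℝ) => (-p.2.1)⁻¹ :=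
    Continuous.inv₀ (by fun_prop) fun p => neg_ne_zero.2 p.2.2.ne
  exact hc.add (hi.smul (continuous_fst.sub hc))

variable (E) in
/-- The map `(x, s) ↦ c^{R |s|}(x) + |s|⁻¹ (x - c^{R |s|}(x))`. -/
def flowProj : TopCat.of (E × Set.Iio (0 : ℝ)) ⟶ TopCat.of E :=
  TopCat.ofHom ⟨fun p => stretchFun (-p.2.1 * R) (-p.2.1)⁻¹ p.1, continuous_stretchFun_inv hR⟩

variable (E) in
/-- The section `x ↦ (x, -1)`. -/
def unitSection : TopCat.of E ⟶ TopCat.of (E × Set.Iio (0 : ℝ)) :=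
  TopCat.ofHom ⟨fun x => (x, ⟨-1, by simp⟩), by fun_prop⟩

variable (E) in
/-- The trivialization of `E × ℝ_{<0}` along the fibers of `flowProj`. -/
def flowHomeo : E × ℝ ≃ₜ TopCat.of (E × Set.Iio (0 : ℝ)) where
  toFun p := (stretchFun R (Real.exp (-p.2)) p.1,
    ⟨-Real.exp (-p.2), neg_lt_zero.2 (Real.exp_pos _)⟩)
  invFun p := (stretchFun (-p.2.1 * R) (-p.2.1)⁻¹ p.1, -Real.log (-p.2.1))
  left_inv p := by
    refine Prod.ext ?_ ?_
    · change stretchFun (- -Real.exp (-p.2) * R) (- -Real.exp (-p.2))⁻¹ _ = _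
      rw [neg_neg, stretchFun_stretchFun hR.le (Real.exp_pos _)]
    · change -Real.log (- -Real.exp (-p.2)) = p.2
      rw [neg_neg, Real.log_exp, neg_neg]
  right_inv := by
    rintro ⟨x, s, hs⟩
    have hs' : 0 < -s := neg_pos.2 hs
    have he : Real.exp (- -Real.log (-s)) = -s := by rw [neg_neg, Real.exp_log hs']
    refine Prod.ext ?_ (Subtype.ext ?_)
    · change stretchFun R (Real.exp (- -Real.log (-s))) (stretchFun (-s * R) (-s)⁻¹ x) = x
      rw [he]
      have := stretchFun_stretchFun (mul_nonneg hs'.le hR.le) (inv_pos.2 hs') x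
      rwa [inv_inv, inv_mul_cancel_left₀ hs'.ne'] at this
    · change -Real.exp (- -Real.log (-s)) = s
      rw [he, neg_neg]
  continuous_toFun := by
    have hc := continuous_contractFun (E := E) hR
    have : Continuous fun p : E × ℝ => stretchFun R (Real.exp (-p.2)) p.1 := by
      unfold stretchFun
      fun_prop
    exact this.prodMk (Continuous.subtype_mk (by fun_prop) _)
  continuous_invFun := by
    refine (continuous_stretchFun_inv hR).prodMk (Continuous.neg ?_)
    exact Continuous.log (by fun_prop) fun p => neg_ne_zero.2 p.2.2.ne

theorem flowProj_flowHomeo (w : E) (r : ℝ) : flowProj E hR (flowHomeo E hR (w, r)) = w :=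
  congrArg Prod.fst ((flowHomeo E hR).left_inv (w, r))

theorem iMap_retractMap : iMap E ≫ retractMap E R = 𝟙 _ := by
  ext x
  change contractFun (max (R * -0) 0) x = x
  rw [neg_zero, mul_zero, max_self, contractFun_zero]

theorem unitSection_gammaMap : unitSection E ≫ gammaMap E = 𝟙 _ := by
  ext x
  change |(-1 : ℝ)|⁻¹ • x = x
  simp

theorem unitSection_flowProj : unitSection E ≫ flowProj E hR = 𝟙 _ := by
  ext x
  change stretchFun (- -1 * R) (- -1)⁻¹ x = x
  simp [stretchFun]

/-- At height `s` the projection stretches the ball of radius `|s|R` by `|s|⁻¹` to the ball of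
radius `R`, and contracting commutes with such a stretch. -/
theorem flowProj_contractMap : flowProj E hR ≫ contractMap E R hR = jMap E ≫ retractMap E R := by
  ext ⟨x, s, hs⟩
  have hs' : 0 < -s := neg_pos.2 hs
  change contractFun R (stretchFun (-s * R) (-s)⁻¹ x) = contractFun (max (R * -s) 0) x
  have := contractFun_stretchFun (mul_nonneg hs'.le hR.le) (inv_pos.2 hs') x
  rw [inv_mul_cancel_left₀ hs'.ne'] at this
  rw [this, max_eq_left (mul_nonneg hR.le hs'.le), mul_comm]

theorem retractMap_flowHomeo (w : E) (r : ℝ) :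
    retractMap E R (jMap E (flowHomeo E hR (w, r))) = contractFun R w := by
  have := congrArg (fun g => g (flowHomeo E hR (w, r))) (flowProj_contractMap (E := E) hR)
  refine Eq.trans this.symm ?_
  exact congrArg (contractFun R) (flowProj_flowHomeo hR w r)

theorem flowHomeo_zero (w : E) : flowHomeo E hR (w, 0) = unitSection E w := by
  refine Prod.ext ?_ (Subtype.ext ?_)
  · change stretchFun R (Real.exp (-0)) w = w
    simp [stretchFun]
  · change -Real.exp (-0) = -1
    simp

theorem gammaMap_flowHomeo_of_le {w : E} (hw : ‖w‖ ≤ R) (r : ℝ) :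
    gammaMap E (flowHomeo E hR (w, r)) = w := by
  change |-Real.exp (-r)|⁻¹ • stretchFun R (Real.exp (-r)) w = w
  rw [stretchFun_of_le hw, abs_neg, abs_of_pos (Real.exp_pos _), smul_smul,
    inv_mul_cancel₀ (Real.exp_pos _).ne', one_smul]

/-- Along this fibre the norm of `γ` is `R + e^r (‖w‖ - R)`. -/
theorem le_norm_gammaMap_flowHomeo {w : E} (hw : R < ‖w‖) (r : ℝ) :
    R ≤ ‖(gammaMap E (flowHomeo E hR (w, r)) : E)‖ := by
  change R ≤ ‖|-Real.exp (-r)|⁻¹ • stretchFun R (Real.exp (-r)) w‖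
  have h := Real.exp_pos (-r)
  rw [norm_smul, norm_stretchFun_of_lt hR.le h hw, abs_neg, abs_of_pos h,
    Real.norm_of_nonneg (inv_nonneg.2 h.le), inv_mul_eq_div, le_div_iff₀ h]
  linarith

end Geometry

/-! ### The two quasi-isomorphisms and the conclusion -/

section Main

variable {k : Type u} [Field k] {E : Type u} [NormedAddCommGroup E] [NormedSpace ℂ E]
  {R : ℝ} (hR : 0 < R)
variable {J : CochainComplex (Sh k (TopCat.of (E × Set.Iio (0 : ℝ)))) ℤ} (hJ : Flasque J)
  {n₀ : ℤ} (hn₀ : ∀ n < n₀, ∀ V, Subsingleton (Sec J n V))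
  (hlc : ∀ n w, LocConstAlong J n fun r => flowHomeo E hR (w, r))

include hJ hn₀ hlc

/-- The neighborhoods `q⁻¹(U') ∩ {|s| < δ}` of `(x, 0)` are arbitrarily small. In flow coordinates
their part in `s < 0` is `D × (-log δ, ∞)`, inside `D × ℝ` coming from `q⁻¹(U')`, so restriction to
a half-line applies. -/
theorem quasiIso_sectionMapC_retractMap :
    QuasiIso (sectionMapC (iMap_retractMap (E := E) (R := R)) (pfC (jMap E) J)) := by
  refine quasiIso_sectionMapC _ (hJ.pfC (jMap E)) fun x V U hV hU => ?_
  obtain ⟨ε, hε, hεV⟩ := Metric.isOpen_iff.1 V.isOpen _ hV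
  have hR₁ : 0 < R + 1 := by linarith
  -- For `|s| < δ` the contraction moves points by at most `R * δ`, and its value is within `δ` of
  -- `x`; the total must not exceed `ε`.
  obtain ⟨δ, hδ, hδε⟩ : ∃ δ, 0 < δ ∧ (R + 1) * δ = ε :=
    ⟨ε / (R + 1), by positivity, by field_simp⟩
  let U' : Opens (TopCat.of E) := ⟨Metric.ball x δ, Metric.isOpen_ball⟩ ⊓ U
  let S : Opens (TopCat.of (E × ℝ)) :=
    ⟨{p | -δ < p.2 ∧ p.2 < δ}, (isOpen_lt continuous_const continuous_snd).inter
      (isOpen_lt continuous_snd continuous_const)⟩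
  let V' : Opens (TopCat.of (E × ℝ)) := (Opens.map (retractMap E R)).obj U' ⊓ S
  have hδ' : δ ≤ ε := by nlinarith
  have hxU : x ∈ U' := ⟨Metric.mem_ball_self hδ, hU⟩
  refine ⟨V', ?_, U', inf_le_right, ⟨?_, ?_⟩, hxU, fun n => ?_⟩
  · rintro ⟨y, s⟩ ⟨⟨hy, -⟩, hs, hs'⟩
    refine hεV ?_
    have hm : max (R * -s) 0 ≤ R * δ := by
      refine max_le (mul_le_mul_of_nonneg_left ?_ hR.le) (by positivity)
      have : -δ < s := hs
      linarith
    have h₁ : dist y (contractFun (max (R * -s) 0) y) ≤ R * δ := by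
      rw [dist_eq_norm]
      exact (norm_sub_contractFun_le (le_max_right _ _) y).trans hm
    have h₂ : dist (contractFun (max (R * -s) 0) y) x < δ := hy
    have h₃ := dist_triangle y (contractFun (max (R * -s) 0) y) x
    refine Metric.mem_ball.2 (max_lt ?_ ?_)
    · change dist y x < ε
      linarith
    · change dist s 0 < ε
      rw [Real.dist_0_eq_abs]
      exact (abs_lt.2 ⟨hs, hs'⟩).trans_le hδ'
  · have := congrArg (fun g => g x) (iMap_retractMap (E := E) (R := R))
    exact (congrArg (· ∈ U') this).mpr hxU
  · exact ⟨neg_lt_zero.2 hδ, hδ⟩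
  · refine Good.pfC _ inf_le_left ?_
    have hc : Continuous (contractFun R : E → E) := continuous_contractFun hR
    let D : Opens E := ⟨contractFun R ⁻¹' U', U'.isOpen.preimage hc⟩
    have h := good_boxOpens_ioi (flowHomeo E hR) hJ hn₀ hlc D (-Real.log δ) n
    have hmem : ∀ w r, retractMap E R (jMap E (flowHomeo E hR (w, r))) ∈ U' ↔ w ∈ D :=
      fun w r => by
        rw [retractMap_flowHomeo]
        rfl
    have hexp : ∀ r, (-δ < -Real.exp (-r) ∧ -Real.exp (-r) < δ) ↔ -Real.log δ < r := by
      intro r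
      have : 0 < Real.exp (-r) := Real.exp_pos _
      rw [neg_lt_neg_iff, ← Real.lt_log_iff_exp_lt hδ]
      exact ⟨fun h => by linarith [h.1], fun h => ⟨by linarith, by linarith⟩⟩
    have h₁ : (Opens.map (jMap E)).obj V' =
        boxOpens (flowHomeo E hR) D (ioiOpens (-Real.log δ)) := by
      refine le_antisymm ?_ ?_ <;> refine (opens_le_iff (flowHomeo E hR)).2 fun w r hw => ?_
      · exact (mem_boxOpens _ _ _ _ _).2 ⟨(hmem w r).1 hw.1, (hexp r).1 hw.2⟩
      · obtain ⟨h₁, h₂⟩ := (mem_boxOpens _ _ _ _ _).1 hw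
        exact ⟨(hmem w r).2 h₁, (hexp r).2 h₂⟩
    have h₂ : (Opens.map (jMap E)).obj ((Opens.map (retractMap E R)).obj U') =
        boxOpens (flowHomeo E hR) D ⊤ := by
      refine le_antisymm ?_ ?_ <;> refine (opens_le_iff (flowHomeo E hR)).2 fun w r hw => ?_
      · exact (mem_boxOpens _ _ _ _ _).2 ⟨(hmem w r).1 hw, trivial⟩
      · exact (hmem w r).2 ((mem_boxOpens _ _ _ _ _).1 hw).1
    rw [h₁, h₂]
    exact h

/-- Small neighborhoods of `(x, -1)` are boxes `U' × (-δ, δ)` in flow coordinates, where `-1` has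
parameter `0`, and `p⁻¹(U')` is `U' × ℝ`. -/
theorem quasiIso_sectionMapC_flowProj :
    QuasiIso (sectionMapC (unitSection_flowProj (E := E) hR) J) := by
  refine quasiIso_sectionMapC _ hJ fun x V U hV hU => ?_
  have hV' : flowHomeo E hR (x, 0) ∈ V := by rwa [flowHomeo_zero]
  obtain ⟨D, δ, hxD, hδ, hD, -⟩ := exists_boxOpens_le (flowHomeo E hR) (V := V) (W := V) (w := x)
    (a := 0) (b := 0) le_rfl
    (fun r hr => by rwa [le_antisymm hr.2 hr.1]) hV'
  let U' : Opens (TopCat.of E) := (D : Opens (TopCat.of E)) ⊓ U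
  refine ⟨boxOpens (flowHomeo E hR) U' (iooOpens (0 - δ) (0 + δ)), ?_, U', inf_le_right, ?_,
    ⟨hxD, hU⟩, fun n => ?_⟩
  · refine le_trans ((opens_le_iff (flowHomeo E hR)).2 fun w r h => ?_) hD
    rw [mem_boxOpens] at h ⊢
    exact ⟨h.1.1, h.2⟩
  · rw [← flowHomeo_zero hR]
    exact (mem_boxOpens _ _ _ _ _).2 ⟨⟨hxD, hU⟩, by linarith, by linarith⟩
  · have h₂ : (Opens.map (flowProj E hR)).obj U' = boxOpens (flowHomeo E hR) U' ⊤ := by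
      have hmem : ∀ w r, flowProj E hR (flowHomeo E hR (w, r)) ∈ U' ↔ w ∈ U' := fun w r => by
        rw [flowProj_flowHomeo]
      refine le_antisymm ?_ ?_ <;> refine (opens_le_iff (flowHomeo E hR)).2 fun w r hw => ?_
      · exact (mem_boxOpens _ _ _ _ _).2 ⟨(hmem w r).1 hw, trivial⟩
      · exact (hmem w r).2 ((mem_boxOpens _ _ _ _ _).1 hw).1
    rw [h₂]
    exact good_boxOpens_ioo (flowHomeo E hR) hJ hn₀ hlc U' (by linarith) n

omit hJ hn₀ hlc

/-- Over `‖w‖ ≤ R` the path is constant. Otherwise it lies in the closed subspace `{R ≤ ‖x‖}`, where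
the hypothesis on `F` applies, and the result is carried back to `E`. -/
theorem locConstAlong_gammaMap_flowHomeo {F : Dplus k (TopCat.of E)}
    (hF : IsLocallyConstantOn F {x : E | R ≤ ‖x‖})
    {I : CochainComplex (Sh k (TopCat.of E)) ℤ} (hI : CochainComplex.plus _ I)
    (e : DerivedCategory.Plus.Q.obj ⟨I, hI⟩ ≅ F) (n : ℤ) (w : E) :
    LocConstAlong I n fun r => gammaMap E (flowHomeo E hR (w, r)) := by
  rcases le_or_gt ‖w‖ R with hw | hw
  · have : (fun r => gammaMap E (flowHomeo E hR (w, r))) = fun _ => w :=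
      funext fun r => gammaMap_flowHomeo_of_le hR hw r
    rw [this]
    exact locConstAlong_const n _
  · have hc : Continuous fun r => gammaMap E (flowHomeo E hR (w, r)) :=
      (gammaMap E).hom.continuous.comp ((flowHomeo E hR).continuous.comp (by fun_prop))
    let p : ℝ → TopCat.of {x : E | R ≤ ‖x‖} :=
      fun r => ⟨gammaMap E (flowHomeo E hR (w, r)), le_norm_gammaMap_flowHomeo hR hw r⟩
    have hp : Continuous p := hc.subtype_mk _
    exact LocConstAlong.of_pbC (p := p) hp (locConstAlong_of_isLocallyConstantSheaf
      (isLocallyConstantSheaf_homology hF hI e n) hp)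

theorem nonempty_smash_iso (F : Dplus k (TopCat.of E))
    (hF : IsLocallyConstantOn F {x : E | R ≤ ‖x‖}) :
    Nonempty ((smash E k).obj F ≅ (derivedDirectImage (contractMap E R hR)).obj F) := by
  refine nonempty_iso_derivedDirectImage (iMap_retractMap (E := E) (R := R)) unitSection_gammaMap
    (unitSection_flowProj hR) (flowProj_contractMap hR) F fun I hI e J hJ hinj β hβ => ?_
  obtain ⟨n₀, hn₀⟩ := hJ
  have hfl := flasque_of_injective J
  have hsub : ∀ n < n₀, ∀ V, Subsingleton (Sec J n V) := fun n hn V => subsingleton_sec J hn V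
  have hlc : ∀ n w, LocConstAlong J n fun r => flowHomeo E hR (w, r) := fun n w =>
    (locConstAlong_gammaMap_flowHomeo hR hF hI e n w).pbC.map β
  exact ⟨quasiIso_sectionMapC_retractMap hR hfl hsub hlc,
    quasiIso_sectionMapC_flowProj hR hfl hsub hlc⟩

theorem nonempty_derivedProperDirectImage_iso [ProperSpace E] (F : Dplus k (TopCat.of E)) :
    Nonempty ((derivedDirectImage (contractMap E R hR)).obj F ≅
      (derivedProperDirectImage (contractMap E R hR)).obj F) :=
  nonempty_rightDerivedFunctorPlus_iso
    (properDirectImageIso _ (isProperMap_contractMap hR)).symm F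

end Main

end Smash

end

theorem lemma5p7 (k : Type u) [Field k] (E : Type u) [NormedAddCommGroup E] [NormedSpace ℂ E]
    (hE : Module.finrank ℂ E = 1) (R : ℝ) (hR : 0 < R) (F : Smash.Db k (TopCat.of E))
    (hF : Smash.IsLocallyConstantOn ((Smash.dbToPlus k (TopCat.of E)).obj F) {x : E | R ≤ ‖x‖}) :
    Nonempty ((Smash.smash E k).obj ((Smash.dbToPlus k (TopCat.of E)).obj F) ≅
      (Smash.derivedDirectImage (Smash.contractMap E R hR)).obj
        ((Smash.dbToPlus k (TopCat.of E)).obj F)) ∧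
    Nonempty ((Smash.derivedDirectImage (Smash.contractMap E R hR)).obj
        ((Smash.dbToPlus k (TopCat.of E)).obj F) ≅
      (Smash.derivedProperDirectImage (Smash.contractMap E R hR)).obj
        ((Smash.dbToPlus k (TopCat.of E)).obj F)) := by
  have : FiniteDimensional ℂ E := Module.finite_of_finrank_eq_succ hE
  have : ProperSpace E := FiniteDimensional.proper ℂ E
  exact ⟨Smash.nonempty_smash_iso hR ((Smash.dbToPlus k (TopCat.of E)).obj F) hF,
    Smash.nonempty_derivedProperDirectImage_iso hR ((Smash.dbToPlus k (TopCat.of E)).obj F)⟩
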